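/- Let $g\ge 0$, $\sigma>0$, $\gamma\in\mathbb R$. Let $c_*\in\mathbb R$ be a critical velocity, i.e. $c_*^4=4\sigma(g+c_*\gamma)$ and $g+c_*\gamma>0$, and let $\omega<0$ be the corresponding frequency, $\sigma\omega^2+c_*^2\omega+(g+c_*\gamma)=0$. Let $0<\delta<|\omega|$, let $\chi$ be the characteristic function of $(-|\omega|-\delta,-|\omega|+\delta)\cup(|\omega|-\delta,|\omega|+\delta)$, and split the space $H^2(\mathbb R)$ of real-valued functions, with $\|u\|_{H^2}=\|(1+\xi^2)\hat u\|_{L^2}$, as $\mathcal X_1+\mathcal X_2$ with $\mathcal X_1=\chi(D)H^2$, $\mathcal X_2=(1-\chi(D))H^2$, both with the $H^2$ norm. The Fourier transform $\hat u$ is the unitary one in the angular frequency $\xi$. For $\varepsilon>0$ and $u\in\mathcal X_1$ put $$\|u\|_{\mathfrak E_\omega}=\Big(\int_{\mathbb R}\big(1+\varepsilon^{-2}(|\xi|-|\omega|)^2\big)|\hat u(\xi)|^2\,d\xi\Big)^{1/2}.$$ Let $\ell(\xi)=g+c_*\gamma-c_*^2|\xi|+\sigma|\xi|^2$ be the symbol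 of $L(D)$, let $J=(1+|D|U)^2+U_\alpha^2$, and define $$F(U)=-\frac{1-\chi(D)}{L(D)}\Big[\tfrac{\gamma^2}{2}U^2+gU|D|U+\tfrac g2|D|(U^2)-\tfrac\sigma2|D|\big((|D|U)^2\big)\Big],$$ $$\tilde R(U)=-\sigma\Big(\frac{U_\alpha}{J^{1/2}}\Big)_\alpha+\sigma|D|\Big(\frac{1+|D|U}{J^{1/2}}\Big)-\Big[-\sigma U_{\alpha\alpha}-\tfrac\sigma2|D|\big((|D|U)^2\big)+\tfrac\sigma2\partial_\alpha\big((U_\alpha)^3\big)\Big].$$ For a velocity $c$ consider, for $U_1\in\mathcal X_1$ and $U_3\in\mathcal X_2$, with $U=U_1+U_2$ and $U_2=F(U_1)+U_3$, the remainder equation $$U_3=\frac{1-\chi(D)}{L(D)}\Big[(c_*-c)\gamma U+(c^2-c_*^2)|D|U-\tfrac\sigma2\partial_\alpha\big((U_\alpha)^3\big)+\tfrac{\gamma^2}2U|D|(U^2)-\tfrac{\gamma^2}2U^2|D|U-\tfrac{\gamma^2}6|D|(U^3)-\tilde R(U)\Big]+F(U)-F(U_1).\qquad(*)$$ There are $M_0>0$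 and $C>0$, depending only on $g,\gamma,\sigma,c_*,\omega,\delta$, such that for every $M\in(0,M_0]$ there are $R_1,R_2,\varepsilon_0>0$ with the following properties for all $\varepsilon\in(0,\varepsilon_0]$ and all $c$ with $|c-c_*|\le\varepsilon^2$. Put $X_1=\{U_1\in\mathcal X_1:\|U_1\|_{\mathfrak E_\omega}\le R_1\}$ and $X_2=\{U_3\in\mathcal X_2:\|U_3\|_{H^2}\le R_2\}$. 1. For all $U_1\in X_1$ and $U_3\in X_2$ one has $\|\hat U_1\|_{L^1}<M/2$, $U_2=F(U_1)+U_3\in\mathcal X_2$, $\|U_2\|_{H^2}<M/2$, and $J>0$ almost everywhere for $U=U_1+U_2$. 2. For each $U_1\in X_1$ the equation $(*)$ has a unique solution $U_3=U_3(U_1)\in X_2$; the map $U_3:X_1\to\mathcal X_2$ is smooth; and for all $U_1\in X_1$ $$\|U_3(U_1)\|_{H^2}\le C\varepsilon\|U_1\|_{\mathfrak E_\omega}^2,\qquad \|dU_3[U_1]\|_{\mathcal L(\mathcal X_1,\mathcal X_2)}\le\varepsilon\|U_1\|_{\mathfrak E_\omega}.$$ 3. Consequently $U_2(U_1)=F(U_1)+U_3(U_1)\in\mathcal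 X_2$ and $U(U_1)=U_1+U_2(U_1)\in H^2(\mathbb R)$ are smooth functions of $U_1\in X_1$. -/

import Mathlib

open MeasureTheory Real

namespace Babenko

noncomputable section

/-! ### Fourier transform and Fourier multipliers on `L²(ℝ)`

Mathlib's Fourier transform uses the kernel `exp (-2π i x η)`.  The angular frequency is
`ξ = 2π η`, and the unitary angular transform is `û(2π η) = (2π)^(-1/2) 𝓕u(η)`.  All symbols
below are functions of the angular frequency `ξ`. -/

/-- The space `L²(ℝ)` of real-valued functions. -/
abbrev L2R : Type := Lp ℝ 2 (volume : Measure ℝ)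

/-- The space `L²(ℝ)` of complex-valued functions. -/
abbrev L2C : Type := Lp ℂ 2 (volume : Measure ℝ)

/-- The (Plancherel) Fourier transform of a real-valued `L²` function, as a real-linear map. -/
def fourierL2 : L2R →ₗ[ℝ] L2C :=
  ((Lp.fourierTransformₗᵢ ℝ ℂ).toLinearEquiv.toLinearMap.restrictScalars ℝ) ∘ₗ
    (Complex.ofRealCLM.compLpL 2 (volume : Measure ℝ)).toLinearMap

theorem fourierL2_injective : Function.Injective fourierL2 := by
  intro u v h
  have h1 : Complex.ofRealCLM.compLpL 2 (volume : Measure ℝ) u =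
      Complex.ofRealCLM.compLpL 2 (volume : Measure ℝ) v :=
    (Lp.fourierTransformₗᵢ ℝ ℂ).injective h
  apply Lp.ext
  have hu := Complex.ofRealCLM.coeFn_compLpL (p := 2) (μ := (volume : Measure ℝ)) u
  have hv := Complex.ofRealCLM.coeFn_compLpL (p := 2) (μ := (volume : Measure ℝ)) v
  rw [h1] at hu
  filter_upwards [hu, hv] with x hx hy
  have := hx.symm.trans hy
  simpa using this

open Classical in
/-- The `L²` Fourier transform of a real function (and `0` if the function is not in `L²`). -/
def FT (f : ℝ → ℝ) : ℝ → ℂ :=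
  if h : MemLp f 2 (volume : Measure ℝ) then ⇑(fourierL2 (h.toLp f)) else 0

open Classical in
/-- The Fourier multiplier `m(D)` with symbol `m(ξ)`, with domain the `f ∈ L²` for which
`m f̂ ∈ L²` (and value `0` off the domain).  All symbols used below satisfy
`m(-ξ) = conj (m ξ)`, so that `m(D) f` is real and taking the real part changes nothing. -/
def mult (m : ℝ → ℂ) (f : ℝ → ℝ) : ℝ → ℝ :=
  if h : MemLp (fun η : ℝ => m (2 * π * η) * FT f η) 2 (volume : Measure ℝ) then
    fun x => ((Lp.fourierTransformₗᵢ ℝ ℂ).symm (h.toLp _) x).re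
  else 0

/-- The operator `|D|`, with symbol `|ξ|`. -/
def absD : (ℝ → ℝ) → ℝ → ℝ := mult fun ξ => ((|ξ| : ℝ) : ℂ)

/-- The operator `|D|²`, with symbol `|ξ|²`. -/
def absDSq : (ℝ → ℝ) → ℝ → ℝ := mult fun ξ => ((|ξ| ^ 2 : ℝ) : ℂ)

/-- The derivative `∂_α`, with symbol `iξ`. -/
def dα : (ℝ → ℝ) → ℝ → ℝ := mult fun ξ => Complex.I * (ξ : ℂ)

/-! ### The Sobolev space `H²(ℝ)` of real-valued functions -/

theorem memLp_weight_congr {w : ℝ → ℂ} {f h : ℝ → ℂ} (hf : MemLp (fun η => w η * f η) 2 volume)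
    (e : f =ᵐ[volume] h) : MemLp (fun η => w η * h η) 2 volume :=
  (memLp_congr_ae (e.mono fun η hη => by simp only [hη])).1 hf

/-- The weight `1 + ξ²` at `ξ = 2π η`. -/
def weight (η : ℝ) : ℂ := ((1 + (2 * π * η) ^ 2 : ℝ) : ℂ)

theorem weight_ne_zero (η : ℝ) : weight η ≠ 0 := by
  unfold weight
  have : (1 + (2 * π * η) ^ 2 : ℝ) ≠ 0 := by positivity
  exact_mod_cast this

/-- The functions `u ∈ L²(ℝ)` with `(1 + ξ²) û ∈ L²`. -/
def H2Submodule : Submodule ℝ L2R where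
  carrier := {u | MemLp (fun η => weight η * fourierL2 u η) 2 volume}
  zero_mem' := by
    have e : (0 : ℝ → ℂ) =ᵐ[volume] fourierL2 0 := by
      rw [map_zero]; exact (Lp.coeFn_zero ℂ 2 volume).symm
    refine memLp_weight_congr (w := weight) ?_ e
    simp
  add_mem' := by
    intro u v hu hv
    have e : (fun η => fourierL2 u η + fourierL2 v η) =ᵐ[volume] fourierL2 (u + v) := by
      rw [map_add]; exact (Lp.coeFn_add _ _).symm
    refine memLp_weight_congr (w := weight) ?_ e
    simp only [mul_add]
    exact MemLp.add hu hv
  smul_mem' := by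
    intro a u hu
    have e : (fun η => a • fourierL2 u η) =ᵐ[volume] fourierL2 (a • u) := by
      rw [map_smul]; exact (Lp.coeFn_smul a (fourierL2 u)).symm
    refine memLp_weight_congr (w := weight) ?_ e
    simp only [mul_smul_comm]
    exact MemLp.const_smul hu a

/-- The Sobolev space `H²(ℝ)` of real-valued functions. -/
def H2 : Type := H2Submodule

instance : AddCommGroup H2 := inferInstanceAs (AddCommGroup H2Submodule)

instance : Module ℝ H2 := inferInstanceAs (Module ℝ H2Submodule)

namespace H2

/-- The inclusion of `H²` in `L²`. -/
def toL2 : H2 →ₗ[ℝ] L2R := H2Submodule.subtype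

theorem toL2_injective : Function.Injective toL2 := Subtype.val_injective

/-- An element of `H²` as a function on `ℝ` (a representative of its a.e. class). -/
instance : CoeFun H2 fun _ => ℝ → ℝ := ⟨fun u => ⇑(toL2 u)⟩

/-- The Fourier transform on `H²`. -/
def hat (u : H2) : ℝ → ℂ := ⇑(fourierL2 (toL2 u))

theorem hat_add (u v : H2) : hat (u + v) =ᵐ[volume] fun η => hat u η + hat v η := by
  unfold hat; rw [map_add, map_add]; exact Lp.coeFn_add _ _

theorem hat_smul (a : ℝ) (u : H2) : hat (a • u) =ᵐ[volume] fun η => a • hat u η := by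
  unfold hat; rw [map_smul, map_smul]; exact Lp.coeFn_smul _ _

theorem hat_zero : hat 0 =ᵐ[volume] 0 := by
  unfold hat; rw [map_zero, map_zero]; exact Lp.coeFn_zero _ _ _

theorem memLp_weight (u : H2) : MemLp (fun η => weight η * hat u η) 2 volume := u.2

/-- The map `u ↦ (1 + ξ²) û` from `H²` to `L²`, which gives `H²` its norm. -/
def weighted : H2 →ₗ[ℝ] L2C where
  toFun u := (memLp_weight u).toLp _
  map_add' u v := by
    rw [← MemLp.toLp_add]
    refine MemLp.toLp_congr _ _ ?_
    filter_upwards [hat_add u v] with η h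
    simp only [h, mul_add, Pi.add_apply]
  map_smul' a u := by
    rw [RingHom.id_apply, ← MemLp.toLp_const_smul]
    refine MemLp.toLp_congr _ _ ?_
    filter_upwards [hat_smul a u] with η h
    simp only [h, mul_smul_comm, Pi.smul_apply]

theorem weighted_injective : Function.Injective weighted := by
  intro u v h
  apply toL2_injective
  apply fourierL2_injective
  apply Lp.ext
  have h' := (MemLp.toLp_eq_toLp_iff (memLp_weight u) (memLp_weight v)).1 h
  filter_upwards [h'] with η hη
  exact mul_left_cancel₀ (weight_ne_zero η) hη

end H2

/-- `‖u‖_{H²} = ‖(1 + ξ²) û‖_{L²}`. -/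
instance : NormedAddCommGroup H2 :=
  NormedAddCommGroup.induced H2 L2C H2.weighted H2.weighted_injective

instance : NormedSpace ℝ H2 := NormedSpace.induced ℝ H2 L2C H2.weighted

/-! ### The splitting `H² = 𝒳₁ + 𝒳₂` -/

/-- The set `(-|ω|-δ, -|ω|+δ) ∪ (|ω|-δ, |ω|+δ)` of frequencies. -/
def band (ω δ : ℝ) : Set ℝ :=
  Set.Ioo (-|ω| - δ) (-|ω| + δ) ∪ Set.Ioo (|ω| - δ) (|ω| + δ)

/-- The characteristic function `χ` of the frequency band. -/
def χ (ω δ : ℝ) : ℝ → ℝ := (band ω δ).indicator 1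

/-- The functions in `H²` whose Fourier transform vanishes off the set `S` of frequencies. -/
def supportedOn (S : Set ℝ) : Submodule ℝ H2 where
  carrier := {u | ∀ᵐ η : ℝ, 2 * π * η ∉ S → H2.hat u η = 0}
  zero_mem' := by
    filter_upwards [H2.hat_zero] with η h _
    simpa using h
  add_mem' := by
    intro u v hu hv
    filter_upwards [hu, hv, H2.hat_add u v] with η h1 h2 h3 h
    rw [h3, h1 h, h2 h, add_zero]
  smul_mem' := by
    intro a u hu
    filter_upwards [hu, H2.hat_smul a u] with η h1 h2 h
    rw [h2, h1 h, smul_zero]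

/-- `𝒳₁ = χ(D) H²`. -/
abbrev X1 (ω δ : ℝ) : Submodule ℝ H2 := supportedOn (band ω δ)

/-- `𝒳₂ = (1 - χ(D)) H²`. -/
abbrev X2 (ω δ : ℝ) : Submodule ℝ H2 := supportedOn (band ω δ)ᶜ

/-- The scaled norm `(∫ (1 + ε⁻² (|ξ| - |ω|)²) |û(ξ)|² dξ)^(1/2)`, after `ξ = 2π η`. -/
def normE (ε ω : ℝ) (u : H2) : ℝ :=
  √(∫ η : ℝ, (1 + (ε ^ 2)⁻¹ * (|2 * π * η| - |ω|) ^ 2) * ‖H2.hat u η‖ ^ 2)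

/-- The norm `∫ |û(ξ)| dξ`, after `ξ = 2π η`. -/
def normHatL1 (u : H2) : ℝ := √(2 * π) * ∫ η : ℝ, ‖H2.hat u η‖

/-- The closed ball `{U₁ ∈ 𝒳₁ : ‖U₁‖_{𝔈_ω} ≤ R₁}`. -/
def ballE (ε ω δ R₁ : ℝ) : Set (X1 ω δ) := {u | normE ε ω u ≤ R₁}

/-! ### The remainder equation -/

/-- The symbol `ℓ(ξ) = g + c⁎ γ - c⁎² |ξ| + σ |ξ|²` of `L(D)`; here `cs` is `c⁎`. -/
def ell (g γ σ cs : ℝ) (ξ : ℝ) : ℝ := g + cs * γ - cs ^ 2 * |ξ| + σ * |ξ| ^ 2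

/-- The operator `(1 - χ(D)) / L(D)`. -/
def invL (g γ σ cs ω δ : ℝ) : (ℝ → ℝ) → ℝ → ℝ :=
  mult fun ξ => (((1 - χ ω δ ξ) / ell g γ σ cs ξ : ℝ) : ℂ)

/-- `J = (1 + |D|U)² + U_α²`. -/
def J (U : ℝ → ℝ) (x : ℝ) : ℝ := (1 + absD U x) ^ 2 + dα U x ^ 2

/-- The capillary terms `-σ (U_α / J^{1/2})_α + σ |D| ((1 + |D|U) / J^{1/2})`.  As `|D|`
annihilates constants, `1` is subtracted so that the argument of `|D|` lies in `L²`. -/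
def capillary (σ : ℝ) (U : ℝ → ℝ) (x : ℝ) : ℝ :=
  -σ * dα (fun y => dα U y / √(J U y)) x
    + σ * absD (fun y => (1 + absD U y) / √(J U y) - 1) x

/-- The remainder `R̃(U)`: the capillary terms minus
`-σ U_αα - (σ/2) |D| (|D|U)² + (σ/2) ∂_α (U_α)³`. -/
def remR (σ : ℝ) (U : ℝ → ℝ) (x : ℝ) : ℝ :=
  capillary σ U x
    - (σ * absDSq U x - σ / 2 * absD (fun y => absD U y ^ 2) x
      + σ / 2 * dα (fun y => dα U y ^ 3) x)

/-- `F(U) = -(1-χ(D)) L(D)⁻¹ [ (γ²/2) U² + g U |D|U + (g/2) |D|U² - (σ/2) |D|(|D|U)² ]`. -/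
def F (g γ σ cs ω δ : ℝ) (U : ℝ → ℝ) (x : ℝ) : ℝ :=
  -invL g γ σ cs ω δ (fun y =>
      γ ^ 2 / 2 * U y ^ 2 + g * U y * absD U y + g / 2 * absD (fun z => U z ^ 2) y
        - σ / 2 * absD (fun z => absD U z ^ 2) y) x

/-- The right-hand side of the remainder equation, for the velocity `c`, as a function of `U₁`
and of `U`. -/
def rhs (g γ σ cs c ω δ : ℝ) (U₁ U : ℝ → ℝ) (x : ℝ) : ℝ :=
  invL g γ σ cs ω δ (fun y =>
      (cs - c) * γ * U y + (c ^ 2 - cs ^ 2) * absD U y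
        - σ / 2 * dα (fun z => dα U z ^ 3) y
        + γ ^ 2 / 2 * (U y * absD (fun z => U z ^ 2) y)
        - γ ^ 2 / 2 * (U y ^ 2 * absD U y)
        - γ ^ 2 / 6 * absD (fun z => U z ^ 3) y
        - remR σ U y) x
    + F g γ σ cs ω δ U x - F g γ σ cs ω δ U₁ x

/-- `U₃` solves the remainder equation `U₃ = rhs(U₁, U)` with `U = U₁ + F(U₁) + U₃`. -/
def RemainderEq (g γ σ cs c ω δ : ℝ) (U₁ U₃ : ℝ → ℝ) : Prop :=
  U₃ =ᵐ[volume]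
    rhs g γ σ cs c ω δ U₁ (fun x => U₁ x + F g γ σ cs ω δ U₁ x + U₃ x)

end

end Babenko

open Babenko

/-! With x = U₁ and y = U₃, the remainder equation is a fixed-point equation y = K(x, y) + a L₁(F(x)
+ y) + b L₂(F(x) + y), where a = c⁎ - c and b = c² - c⁎² are O(ε²). The terms linear in U₁ are
absent because 1 - χ(D) annihilates 𝒳₁ (`invLX2_outI_eq_zero`). At a critical velocity ω is a double
root, so ℓ(ξ) = σ(|ξ| - |ω|)² (`ell_eq`) and (1 - χ(D))/L(D) gains two derivatives (`invLBdd`).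

A function in H² is encoded by Φ = (1 + ξ²)û in complex L². Multiplication becomes a weighted
convolution, which makes L² with the weights 1 + |ξ| and 1 + ξ² into the algebras H¹ and H². Every
multiplier becomes a bounded operator, and J^(-1/2) - 1 comes from the implicit function theorem in
the algebra H¹ (`exists_invSqrt`). Hence K is analytic near 0 with K(0) = 0 and dK(0) = 0, and the
right-hand side is a contraction in y on small balls. `exists_contDiff_fixedPoint` then gives
existence, uniqueness and smoothness.

The powers of ε come from Cauchy–Schwarz: the function (1 + ε⁻²(|ξ| - |ω|)²)⁻¹ has integral O(ε), so
t = ∫(1 + ξ²)|Û₁| is at most a constant times √ε ‖U₁‖_𝔈 (`wnorm_weightedL_le`). A product is bounded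
in L² by the L¹ size of one weighted transform times the L² size of the other
(`IsWeight.enorm_mul_le`). The derivative of a cubic expression, as an operator on H², is therefore
O(t²), that is O(ε‖U₁‖²).

It remains to see that K(x, 0) is cubic. The capillary terms lose their linear and quadratic parts
by algebra in H¹ (`vanishesToOrder_capillary`) and the identity `outD_mul_eq`. In F(U₁ + F(U₁)) -
F(U₁) every surviving product contains the quadratic factor F(U₁) (`derivOrder_restricted`).
Integrating the derivative along the segment from 0 to U₁ gives ‖U₃‖ ≤ Cε‖U₁‖². Differentiating the
fixed-point identity bounds dU₃, and the factor there is made 1 by shrinking R₁ and ε₀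
(`exists_fixedPoint_perturbedMap`). -/

namespace Babenko
noncomputable section

open scoped FourierTransform ComplexConjugate SchwartzMap ENNReal

/-! ### The inverse Fourier transform on `L¹ ∩ L²` -/

/-- The inverse Fourier transform on `L²`. -/
abbrev invFourierL2 : L2C ≃ₗᵢ[ℂ] L2C := (Lp.fourierTransformₗᵢ ℝ ℂ).symm

theorem integral_fourierInv_mul_eq {f g : ℝ → ℂ} (hf : Integrable f) (hg : Integrable g) :
    ∫ x, 𝓕⁻ f x * g x = ∫ x, f x * 𝓕⁻ g x := by
  have h := VectorFourier.integral_fourierIntegral_smul_eq_flip (μ := volume) (ν := volume)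
    (L := innerₗ ℝ) (f := f) (g := fun x => g (-x)) continuous_fourierChar
    (continuous_inner (𝕜 := ℝ) (E := ℝ)) hf hg.comp_neg
  calc ∫ x, 𝓕⁻ f x * g x = ∫ x, 𝓕 f (-x) * g x := by simp only [fourierInv_eq_fourier_neg]
    _ = ∫ x, 𝓕 f x * g (-x) := by
      rw [← integral_neg_eq_self]; simp
    _ = ∫ x, f x * 𝓕 (fun x => g (-x)) x := by
      rw [flip_innerₗ] at h
      exact h
    _ = _ := by simp only [fourierInv_eq_fourier_comp_neg]

/-- Both sides have the same integral against every smooth compactly supported function: the L²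
transform is compatible with the distributional one, and the integral transform can be moved to the
test function by Fubini. -/
theorem invFourierL2_ae_eq (φ : L2C) (hφ : Integrable φ) :
    ⇑(invFourierL2 φ) =ᵐ[volume] 𝓕⁻ (φ : ℝ → ℂ) := by
  have hcont : Continuous (𝓕⁻ (φ : ℝ → ℂ)) := by
    have := VectorFourier.fourierIntegral_continuous (μ := volume) (L := -innerₗ ℝ)
      continuous_fourierChar (continuous_inner (𝕜 := ℝ) (E := ℝ)).neg hφ
    exact this
  apply ae_eq_of_integral_contDiff_smul_eq
  · exact (Lp.memLp _).locallyIntegrable (by norm_num)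
  · exact hcont.locallyIntegrable
  · intro g g_smooth g_cpt
    have hg₁ : HasCompactSupport (Complex.ofRealCLM ∘ g) := g_cpt.comp_left rfl
    have hg₂ : ContDiff ℝ _ (Complex.ofRealCLM ∘ g) := Complex.ofRealCLM.contDiff.comp g_smooth
    set G := hg₁.toSchwartzMap hg₂ with hG
    have e := congrArg (fun T => T G) (Lp.fourierInv_toTemperedDistribution_eq φ)
    simp only [TemperedDistribution.fourierInv_apply, Lp.toTemperedDistribution_apply] at e
    have hGi : Integrable (G : ℝ → ℂ) := G.integrable
    have h2 := integral_fourierInv_mul_eq hGi hφ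
    have h3 : ∀ x, G x = (g x : ℂ) := fun x => rfl
    simp only [SchwartzMap.fourierInv_coe, smul_eq_mul] at e
    rw [h2] at e
    simp only [h3] at e
    simp only [Complex.real_smul]
    exact e.symm

theorem fourierInv_conj_neg (φ : ℝ → ℂ) (x : ℝ) :
    𝓕⁻ (fun η => conj (φ (-η))) x = conj (𝓕⁻ φ x) := by
  rw [fourierInv_eq, fourierInv_eq, ← integral_neg_eq_self, ← integral_conj]
  congr 1
  ext η
  simp [Circle.smul_def, ← Circle.coe_inv_eq_conj, AddChar.map_neg_eq_inv]

/-! ### Hermitian symmetry -/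

/-- Pointwise complex conjugation on `L²`. -/
def conjL2 : L2C →L[ℝ] L2C := (Complex.conjCLE : ℂ →L[ℝ] ℂ).compLpL 2 volume

theorem conjL2_ae (φ : L2C) : conjL2 φ =ᵐ[volume] fun x => conj (φ x) := by
  filter_upwards [(Complex.conjCLE : ℂ →L[ℝ] ℂ).coeFn_compLpL (p := 2) (μ := volume) φ] with x hx
  exact hx

/-- The map `φ ↦ conj φ(-·)` on `L²`. -/
def reflect : L2C →L[ℝ] L2C :=
  (Lp.compMeasurePreservingₗᵢ ℝ (Neg.neg : ℝ → ℝ)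
    (Measure.measurePreserving_neg volume)).toContinuousLinearMap ∘L conjL2

theorem reflect_ae (φ : L2C) : reflect φ =ᵐ[volume] fun x => conj (φ (-x)) := by
  have h1 := Lp.coeFn_compMeasurePreserving (conjL2 φ) (Measure.measurePreserving_neg (volume : Measure ℝ))
  have h2 := (Measure.measurePreserving_neg (volume : Measure ℝ)).quasiMeasurePreserving.ae_eq_comp
    (conjL2_ae φ)
  exact h1.trans h2

theorem norm_reflect_le (φ : L2C) : ‖reflect φ‖ ≤ ‖φ‖ := by
  have h1 : ‖reflect φ‖ = ‖conjL2 φ‖ :=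
    (Lp.compMeasurePreservingₗᵢ ℝ (Neg.neg : ℝ → ℝ)
      (Measure.measurePreserving_neg volume)).norm_map (conjL2 φ)
  rw [h1]
  apply Lp.norm_le_norm_of_ae_le
  filter_upwards [conjL2_ae φ] with x hx
  simp [hx]

/-- Both sides are continuous in φ, so Schwartz functions suffice, and for these the transform is an
integral that can be conjugated. -/
theorem invFourierL2_reflect (φ : L2C) : invFourierL2 (reflect φ) = conjL2 (invFourierL2 φ) := by
  refine DenseRange.induction_on
    (p := fun φ : L2C => invFourierL2 (reflect φ) = conjL2 (invFourierL2 φ))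
    (SchwartzMap.denseRange_toLpCLM (E := ℝ) (F := ℂ) (p := 2) (μ := volume) ENNReal.ofNat_ne_top) φ ?_ ?_
  · exact isClosed_eq (by fun_prop) (by fun_prop)
  · intro f
    have hf : ⇑(SchwartzMap.toLpCLM ℝ ℂ 2 volume f) =ᵐ[volume] f := f.coeFn_toLp 2 volume
    set F : L2C := SchwartzMap.toLpCLM ℝ ℂ 2 volume f with hF
    have hint : Integrable F := f.integrable.congr hf.symm
    have hint' : Integrable (reflect F) := by
      refine Integrable.congr ?_ (reflect_ae F).symm
      exact (Complex.conjCLE : ℂ →L[ℝ] ℂ).integrable_comp hint.comp_neg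
    apply Lp.ext
    refine (invFourierL2_ae_eq _ hint').trans ?_
    refine Filter.EventuallyEq.trans ?_ (conjL2_ae _).symm
    filter_upwards [invFourierL2_ae_eq _ hint] with x hx
    rw [hx, fourierInv_congr_ae (reflect_ae F), fourierInv_conj_neg]

/-- The real part of the inverse Fourier transform. -/
def reInvFourier : L2C →L[ℝ] L2R :=
  (Complex.reCLM.compLpL 2 volume) ∘L
    (invFourierL2.toContinuousLinearEquiv.toContinuousLinearMap.restrictScalars ℝ)

theorem reInvFourier_ae (φ : L2C) :
    reInvFourier φ =ᵐ[volume] fun x => (invFourierL2 φ x).re :=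
  Complex.reCLM.coeFn_compLpL (p := 2) (μ := (volume : Measure ℝ)) (invFourierL2 φ)

theorem fourierL2_ae (u : L2R) :
    (fun x => (u x : ℂ)) =ᵐ[volume] invFourierL2 (fourierL2 u) := by
  have h : invFourierL2 (fourierL2 u) = Complex.ofRealCLM.compLpL 2 (volume : Measure ℝ) u :=
    (Lp.fourierTransformₗᵢ ℝ ℂ).symm_apply_apply _
  rw [h]
  exact (Complex.ofRealCLM.coeFn_compLpL (p := 2) (μ := (volume : Measure ℝ)) u).symm

theorem reInvFourier_fourierL2 (u : L2R) : reInvFourier (fourierL2 u) = u := by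
  apply Lp.ext
  filter_upwards [reInvFourier_ae (fourierL2 u), fourierL2_ae u] with x h1 h2
  rw [h1, ← h2, Complex.ofReal_re]

theorem fourierL2_eq_iff (u : L2R) (φ : L2C) :
    fourierL2 u = φ ↔ (fun x => (u x : ℂ)) =ᵐ[volume] invFourierL2 φ := by
  constructor
  · rintro rfl; exact fourierL2_ae u
  · intro h
    apply invFourierL2.injective
    exact Lp.ext ((fourierL2_ae u).symm.trans h)

/-- Taking real parts in space is taking the Hermitian part in frequency. Consequently nothing is
lost on Hermitian data, and real-valuedness need never be proved separately. -/
theorem fourierL2_reInvFourier (φ : L2C) :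
    fourierL2 (reInvFourier φ) = (2⁻¹ : ℝ) • (φ + reflect φ) := by
  rw [fourierL2_eq_iff]
  have e : invFourierL2 ((2⁻¹ : ℝ) • (φ + reflect φ)) =
      (2⁻¹ : ℝ) • (invFourierL2 φ + conjL2 (invFourierL2 φ)) := by
    rw [← invFourierL2_reflect, ← map_add]
    exact map_smul (invFourierL2.toLinearEquiv.toLinearMap.restrictScalars ℝ) _ _
  rw [e]
  filter_upwards [reInvFourier_ae φ, Lp.coeFn_smul (2⁻¹ : ℝ) (invFourierL2 φ + conjL2 (invFourierL2 φ)),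
    Lp.coeFn_add (invFourierL2 φ) (conjL2 (invFourierL2 φ)), conjL2_ae (invFourierL2 φ)] with x h1 h2 h3 h4
  rw [h1, h2, Pi.smul_apply, h3, Pi.add_apply, h4, Complex.add_conj]
  simp

theorem reflect_fourierL2 (u : L2R) : reflect (fourierL2 u) = fourierL2 u := by
  have h := fourierL2_reInvFourier (fourierL2 u)
  rw [reInvFourier_fourierL2] at h
  have h2 := congrArg (fun z => (2 : ℝ) • z) h
  simp only [smul_smul] at h2
  norm_num [two_smul] at h2
  exact h2.symm

theorem fourierL2_reInvFourier_of_reflect {φ : L2C} (h : reflect φ = φ) :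
    fourierL2 (reInvFourier φ) = φ := by
  rw [fourierL2_reInvFourier, h, ← two_smul ℝ φ, smul_smul]
  norm_num

/-! ### Functions with a given Fourier transform -/

/-- The real function `f` is in `L²` and has Fourier transform `φ`. -/
def HasFT (f : ℝ → ℝ) (φ : ℝ → ℂ) : Prop := MemLp f 2 volume ∧ FT f =ᵐ[volume] φ

theorem FT_eq {f : ℝ → ℝ} (hf : MemLp f 2 volume) : FT f = fourierL2 (hf.toLp f) := by
  simp [FT, hf]

theorem hasFT_coe (u : L2R) : HasFT u (fourierL2 u) := by
  refine ⟨Lp.memLp u, ?_⟩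
  rw [FT_eq (Lp.memLp u), Lp.toLp_coeFn]

namespace HasFT

variable {f g : ℝ → ℝ} {φ ψ : ℝ → ℂ}

theorem memLp_right (h : HasFT f φ) : MemLp φ 2 volume := by
  rw [← memLp_congr_ae h.2, FT_eq h.1]
  exact Lp.memLp _

theorem fourierL2_eq (h : HasFT f φ) : fourierL2 (h.1.toLp f) = h.memLp_right.toLp φ := by
  apply Lp.ext
  have := h.2
  rw [FT_eq h.1] at this
  exact this.trans (MemLp.coeFn_toLp _).symm

theorem congr_right (h : HasFT f φ) (e : φ =ᵐ[volume] ψ) : HasFT f ψ := ⟨h.1, h.2.trans e⟩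

theorem congr_left (h : HasFT f φ) (e : f =ᵐ[volume] g) : HasFT g φ := by
  have hg : MemLp g 2 volume := (memLp_congr_ae e).1 h.1
  refine ⟨hg, ?_⟩
  rw [FT_eq hg, ← MemLp.toLp_congr h.1 hg e, ← FT_eq h.1]
  exact h.2

theorem add (h : HasFT f φ) (h' : HasFT g ψ) :
    HasFT (fun x => f x + g x) (fun η => φ η + ψ η) := by
  have hfg : MemLp (fun x => f x + g x) 2 volume := h.1.add h'.1
  refine ⟨hfg, ?_⟩
  have e : hfg.toLp _ = h.1.toLp f + h'.1.toLp g := (MemLp.toLp_add h.1 h'.1)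
  rw [FT_eq hfg, e, map_add]
  have h2 := h.2; have h3 := h'.2
  rw [FT_eq h.1] at h2; rw [FT_eq h'.1] at h3
  filter_upwards [Lp.coeFn_add (fourierL2 (h.1.toLp f)) (fourierL2 (h'.1.toLp g)), h2, h3]
    with η a b c
  rw [a, Pi.add_apply, b, c]

theorem const_mul (h : HasFT f φ) (r : ℝ) :
    HasFT (fun x => r * f x) (fun η => r * φ η) := by
  have hfg : MemLp (fun x => r * f x) 2 volume := h.1.const_mul r
  refine ⟨hfg, ?_⟩
  have e : hfg.toLp _ = r • h.1.toLp f := (MemLp.toLp_const_smul r h.1)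
  rw [FT_eq hfg, e, map_smul]
  have h2 := h.2
  rw [FT_eq h.1] at h2
  filter_upwards [Lp.coeFn_smul r (fourierL2 (h.1.toLp f)), h2] with η a b
  rw [a, Pi.smul_apply, b, Complex.real_smul]

theorem ae_eq_fourierInv (h : HasFT f φ) (hφ : Integrable φ) :
    (fun x => (f x : ℂ)) =ᵐ[volume] 𝓕⁻ φ := by
  have h1 := (fourierL2_eq_iff _ _).1 h.fourierL2_eq
  have h2 : Integrable (h.memLp_right.toLp φ) := hφ.congr (MemLp.coeFn_toLp _).symm
  filter_upwards [h1, invFourierL2_ae_eq _ h2, h.1.coeFn_toLp] with x a b c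
  rw [← c, a, b, fourierInv_congr_ae (MemLp.coeFn_toLp _)]

/-- The way back from pointwise information to Fourier information, used for products and for
J^(-1/2). Square integrability of `f` is a conclusion here. -/
theorem of_ae_eq_fourierInv (h2 : MemLp φ 2 volume) (hφ : Integrable φ)
    (h : (fun x => (f x : ℂ)) =ᵐ[volume] 𝓕⁻ φ) : HasFT f φ := by
  have h3 : Integrable (h2.toLp φ) := hφ.congr (MemLp.coeFn_toLp _).symm
  have e : (fun x => (f x : ℂ)) =ᵐ[volume] invFourierL2 (h2.toLp φ) := by
    filter_upwards [h, invFourierL2_ae_eq _ h3] with x a b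
    rw [a, b, fourierInv_congr_ae (MemLp.coeFn_toLp _)]
  have hf : MemLp f 2 volume := by
    have := ((memLp_congr_ae e).2 (Lp.memLp _)).re
    simpa using this
  refine ⟨hf, ?_⟩
  have e2 : fourierL2 (hf.toLp f) = h2.toLp φ := by
    rw [fourierL2_eq_iff]
    filter_upwards [e, hf.coeFn_toLp] with x a b
    rw [b, a]
  rw [FT_eq hf, e2]
  exact MemLp.coeFn_toLp _

theorem conj_neg (h : HasFT f φ) : (fun η => conj (φ (-η))) =ᵐ[volume] φ := by
  have h1 := reflect_fourierL2 (h.1.toLp f)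
  rw [h.fourierL2_eq] at h1
  have h2 := reflect_ae (h.memLp_right.toLp φ)
  rw [h1] at h2
  have h4 : ⇑(h.memLp_right.toLp φ) =ᵐ[volume] φ := MemLp.coeFn_toLp _
  have h3 := (Measure.measurePreserving_neg (volume : Measure ℝ)).quasiMeasurePreserving.ae_eq_comp h4
  filter_upwards [h2, h3, h4] with η a b c
  simp only [Function.comp] at b
  rw [← b, ← a, c]

theorem mult_ae (h : HasFT f φ) {m : ℝ → ℂ}
    (hm : MemLp (fun η => m (2 * π * η) * φ η) 2 volume) :
    mult m f =ᵐ[volume] reInvFourier (hm.toLp _) := by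
  have hm' : MemLp (fun η => m (2 * π * η) * FT f η) 2 volume :=
    memLp_weight_congr (w := fun η => m (2 * π * η)) hm h.2.symm
  have e : hm'.toLp _ = hm.toLp _ := by
    rw [MemLp.toLp_eq_toLp_iff]
    filter_upwards [h.2] with η a
    rw [a]
  have : mult m f = fun x => (invFourierL2 (hm'.toLp _) x).re := by
    unfold mult; rw [dif_pos hm']
  rw [this, e]
  exact (reInvFourier_ae _).symm

/-- The product of a Hermitian symbol with a Hermitian transform is Hermitian, so the real part in
the definition of the multiplier has no effect. -/
theorem mult (h : HasFT f φ) {m : ℝ → ℂ} (hs : ∀ ξ, m (-ξ) = conj (m ξ))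
    (hm : MemLp (fun η => m (2 * π * η) * φ η) 2 volume) :
    HasFT (mult m f) (fun η => m (2 * π * η) * φ η) := by
  have hr : reflect (hm.toLp _) = hm.toLp _ := by
    apply Lp.ext
    have h4 := MemLp.coeFn_toLp hm
    have h3 := (Measure.measurePreserving_neg (volume : Measure ℝ)).quasiMeasurePreserving.ae_eq_comp h4
    filter_upwards [reflect_ae (hm.toLp _), h3, h4, h.conj_neg] with η a b c d
    simp only [Function.comp] at b
    rw [a, b, c, mul_neg, hs, map_mul, Complex.conj_conj, d]
  have := hasFT_coe (reInvFourier (hm.toLp _))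
  rw [fourierL2_reInvFourier_of_reflect hr] at this
  exact (this.congr_right (MemLp.coeFn_toLp _)).congr_left (h.mult_ae hm).symm

end HasFT

end
end Babenko

/-! ### Convolution algebras of weighted Fourier transforms -/

namespace Babenko
noncomputable section

open scoped FourierTransform ComplexConjugate ENNReal NNReal Convolution

/-! ### Young's inequality -/

theorem lintegral_lconvolution {p q : ℝ → ℝ≥0∞} (hp : AEMeasurable p) (hq : AEMeasurable q) :
    ∫⁻ x, (p ⋆ₗ q) x = (∫⁻ x, p x) * ∫⁻ x, q x := by
  simp only [lconvolution_def]
  rw [lintegral_lintegral_swap]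
  · calc ∫⁻ y, ∫⁻ x, p y * q (-y + x) = ∫⁻ y, p y * ∫⁻ x, q x := by
          congr 1; ext y
          rw [lintegral_const_mul'' _ (by
            exact (hq.comp_quasiMeasurePreserving
              (measurePreserving_add_left volume (-y)).quasiMeasurePreserving)),
            lintegral_add_left_eq_self (f := q)]
      _ = _ := lintegral_mul_const'' _ hp
  · fun_prop

theorem eLpNorm_two_sq (p : ℝ → ℝ≥0∞) :
    eLpNorm p 2 volume ^ 2 = ∫⁻ x, p x ^ 2 := by
  rw [eLpNorm_eq_lintegral_rpow_enorm_toReal (by norm_num) (by norm_num)]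
  simp only [ENNReal.toReal_ofNat, enorm_eq_self, ENNReal.rpow_ofNat]
  rw [← ENNReal.rpow_natCast, ← ENNReal.rpow_mul]
  norm_num

theorem eLpNorm_lconvolution_one {p q : ℝ → ℝ≥0∞} (hp : AEMeasurable p) (hq : AEMeasurable q) :
    eLpNorm (p ⋆ₗ q) 1 volume = eLpNorm p 1 volume * eLpNorm q 1 volume := by
  simp only [eLpNorm_one_eq_lintegral_enorm, enorm_eq_self]
  exact lintegral_lconvolution hp hq

/-- Cauchy–Schwarz for the measure p(y) dy, obtained by splitting p into two factors p^(1/2).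
Integrating in x gives Young's inequality L¹ * L² → L². -/
theorem lconvolution_sq_le {p q : ℝ → ℝ≥0∞} (hp : AEMeasurable p) (hq : AEMeasurable q) (x : ℝ) :
    (p ⋆ₗ q) x ^ 2 ≤ (∫⁻ y, p y) * (p ⋆ₗ fun y => q y ^ 2) x := by
  have hq' : AEMeasurable (fun y => q (-y + x)) := by fun_prop
  have h := ENNReal.lintegral_mul_le_Lp_mul_Lq volume (Real.HolderConjugate.two_two)
    (f := fun y => p y ^ (1 / 2 : ℝ)) (g := fun y => p y ^ (1 / 2 : ℝ) * q (-y + x))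
    (by fun_prop) (by fun_prop)
  have e1 : ∀ y, ((fun y => p y ^ (1 / 2 : ℝ)) * fun y => p y ^ (1 / 2 : ℝ) * q (-y + x)) y
      = p y * q (-y + x) := by
    intro y
    simp only [Pi.mul_apply]
    rw [← mul_assoc, ← ENNReal.rpow_add_of_nonneg _ _ (by norm_num) (by norm_num)]
    norm_num
  have e2 : ∀ y, (p y ^ (1 / 2 : ℝ)) ^ (2 : ℝ) = p y := by
    intro y; rw [← ENNReal.rpow_mul]; norm_num
  have e3 : ∀ y, (p y ^ (1 / 2 : ℝ) * q (-y + x)) ^ (2 : ℝ) = p y * q (-y + x) ^ 2 := by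
    intro y; rw [ENNReal.mul_rpow_of_nonneg _ _ (by norm_num), e2]; simp
  simp only [e1, e2, e3] at h
  simp only [lconvolution_def]
  calc (∫⁻ y, p y * q (-y + x)) ^ 2
      ≤ ((∫⁻ y, p y) ^ (1 / 2 : ℝ) * (∫⁻ y, p y * q (-y + x) ^ 2) ^ (1 / 2 : ℝ)) ^ 2 := by
        gcongr
    _ = _ := by
        rw [mul_pow, ← ENNReal.rpow_natCast, ← ENNReal.rpow_natCast, ← ENNReal.rpow_mul,
          ← ENNReal.rpow_mul]
        norm_num

theorem eLpNorm_lconvolution_two_le {p q : ℝ → ℝ≥0∞} (hp : AEMeasurable p)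
    (hq : AEMeasurable q) :
    eLpNorm (p ⋆ₗ q) 2 volume ≤ eLpNorm p 1 volume * eLpNorm q 2 volume := by
  have : eLpNorm (p ⋆ₗ q) 2 volume ^ 2 ≤ (eLpNorm p 1 volume * eLpNorm q 2 volume) ^ 2 := by
    rw [mul_pow, eLpNorm_two_sq, eLpNorm_two_sq]
    simp only [eLpNorm_one_eq_lintegral_enorm, enorm_eq_self]
    calc ∫⁻ x, (p ⋆ₗ q) x ^ 2 ≤ ∫⁻ x, (∫⁻ y, p y) * (p ⋆ₗ fun y => q y ^ 2) x :=
          lintegral_mono fun x => lconvolution_sq_le hp hq x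
      _ = (∫⁻ y, p y) * ∫⁻ x, (p ⋆ₗ fun y => q y ^ 2) x :=
          lintegral_const_mul'' _ (aemeasurable_lconvolution hp (by fun_prop))
      _ = _ := by rw [lintegral_lconvolution hp (by fun_prop), sq, mul_assoc]
  exact (ENNReal.pow_le_pow_left_iff two_ne_zero).1 this

theorem eLpNorm_lconvolution_two_le' {p q : ℝ → ℝ≥0∞} (hp : AEMeasurable p)
    (hq : AEMeasurable q) :
    eLpNorm (p ⋆ₗ q) 2 volume ≤ eLpNorm p 2 volume * eLpNorm q 1 volume := by
  rw [lconvolution_comm, mul_comm]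
  exact eLpNorm_lconvolution_two_le hq hp

/-! ### Convolution of complex functions -/

/-- The convolution of complex-valued functions. -/
abbrev conv (φ ψ : ℝ → ℂ) : ℝ → ℂ := φ ⋆[ContinuousLinearMap.mul ℂ ℂ, volume] ψ

theorem enorm_conv_le (φ ψ : ℝ → ℂ) (x : ℝ) :
    ‖conv φ ψ x‖ₑ ≤ ((fun y => ‖φ y‖ₑ) ⋆ₗ fun y => ‖ψ y‖ₑ) x := by
  rw [conv, convolution_def, lconvolution_def]
  refine (enorm_integral_le_lintegral_enorm _).trans (le_of_eq ?_)
  congr 1; ext y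
  simp [enorm_mul, sub_eq_add_neg, add_comm]

theorem fourierInv_conv {φ ψ : ℝ → ℂ} (hφ : Integrable φ) (hψ : Integrable ψ) (x : ℝ) :
    𝓕⁻ (conv φ ψ) x = 𝓕⁻ φ x * 𝓕⁻ ψ x := by
  simp only [fourierInv_eq_fourier_neg]
  exact fourier_mul_convolution_eq hφ hψ (-x)

theorem HasFT.mul {f g : ℝ → ℝ} {φ ψ : ℝ → ℂ} (h : HasFT f φ) (h' : HasFT g ψ)
    (hφ : Integrable φ) (hψ : Integrable ψ) : HasFT (fun x => f x * g x) (conv φ ψ) := by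
  have hi : Integrable (conv φ ψ) := hφ.integrable_convolution _ hψ
  have h2 : MemLp (conv φ ψ) 2 volume := by
    refine ⟨hi.1, ?_⟩
    refine (eLpNorm_mono_enorm (g := ((fun y => ‖φ y‖ₑ) ⋆ₗ fun y => ‖ψ y‖ₑ))
      (fun x => by simpa using enorm_conv_le φ ψ x)).trans_lt ?_
    refine (eLpNorm_lconvolution_two_le hφ.1.enorm hψ.1.enorm).trans_lt ?_
    rw [eLpNorm_enorm, eLpNorm_enorm]
    exact ENNReal.mul_lt_top (memLp_one_iff_integrable.2 hφ).2 h'.memLp_right.2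
  refine HasFT.of_ae_eq_fourierInv h2 hi ?_
  filter_upwards [h.ae_eq_fourierInv hφ, h'.ae_eq_fourierInv hψ] with x a b
  rw [fourierInv_conv hφ hψ, ← a, ← b, Complex.ofReal_mul]

theorem conv_congr {φ φ' ψ ψ' : ℝ → ℂ} (h : φ =ᵐ[volume] φ') (h' : ψ =ᵐ[volume] ψ') :
    conv φ ψ = conv φ' ψ' := convolution_congr _ h h'

theorem conv_comm (φ ψ : ℝ → ℂ) : conv φ ψ = conv ψ φ := by
  rw [conv, ← convolution_flip]
  congr 1
  ext; simp

/-! ### Bounded Fourier multipliers on `L²` -/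

/-- A bounded measurable symbol. -/
def BddSymbol (m : ℝ → ℂ) : Prop := Measurable m ∧ ∃ C : ℝ, ∀ η, ‖m η‖ ≤ C

theorem BddSymbol.of_le {m : ℝ → ℂ} (hm : Measurable m) (C : ℝ) (h : ∀ η, ‖m η‖ ≤ C) :
    BddSymbol m := ⟨hm, C, h⟩

theorem BddSymbol.memLp {m : ℝ → ℂ} (hm : BddSymbol m) {f : ℝ → ℂ} {p : ℝ≥0∞}
    (hf : MemLp f p volume) : MemLp (fun η => m η * f η) p volume := by
  obtain ⟨C, hC⟩ := hm.2
  refine hf.of_le_mul (c := C) (hm.1.aestronglyMeasurable.mul hf.1) ?_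
  filter_upwards with η
  rw [norm_mul]
  gcongr
  exact hC η

/-- Multiplication by a bounded measurable symbol on `L²`. -/
def bmul (m : ℝ → ℂ) (hm : BddSymbol m) : L2C →L[ℝ] L2C :=
  LinearMap.mkContinuousOfExistsBound
    { toFun := fun Φ => (hm.memLp (Lp.memLp Φ)).toLp _
      map_add' := fun Φ Ψ => by
        rw [← MemLp.toLp_add]
        refine MemLp.toLp_congr _ _ ?_
        filter_upwards [Lp.coeFn_add Φ Ψ] with η h
        simp only [h, mul_add, Pi.add_apply]
      map_smul' := fun a Φ => by
        rw [RingHom.id_apply, ← MemLp.toLp_const_smul]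
        refine MemLp.toLp_congr _ _ ?_
        filter_upwards [Lp.coeFn_smul a Φ] with η h
        simp only [h, mul_smul_comm, Pi.smul_apply] }
    (by
      obtain ⟨C, hC⟩ := hm.2
      refine ⟨C, fun Φ => Lp.norm_le_mul_norm_of_ae_le_mul ?_⟩
      filter_upwards [(hm.memLp (Lp.memLp Φ)).coeFn_toLp] with η h
      have : ‖m η * Φ η‖ ≤ C * ‖Φ η‖ := by
        rw [norm_mul]; gcongr; exact hC η
      simpa [h] using this)

theorem bmul_ae (m : ℝ → ℂ) (hm : BddSymbol m) (Φ : L2C) :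
    bmul m hm Φ =ᵐ[volume] fun η => m η * Φ η := (hm.memLp (Lp.memLp Φ)).coeFn_toLp

/-! ### Weights, and the algebra of functions whose weighted Fourier transform is in `L²` -/

/-- The norm `∫ |Φ|`, possibly infinite. -/
def wnorm (Φ : L2C) : ℝ≥0∞ := eLpNorm Φ 1 volume

theorem wnorm_add_le (Φ Ψ : L2C) : wnorm (Φ + Ψ) ≤ wnorm Φ + wnorm Ψ := by
  unfold wnorm
  rw [eLpNorm_congr_ae (Lp.coeFn_add Φ Ψ)]
  exact eLpNorm_add_le (Lp.aestronglyMeasurable _) (Lp.aestronglyMeasurable _) le_rfl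

theorem wnorm_smul_le (r : ℝ) (Φ : L2C) : wnorm (r • Φ) ≤ ‖r‖ₑ * wnorm Φ := by
  unfold wnorm
  rw [eLpNorm_congr_ae (Lp.coeFn_smul r Φ)]
  exact eLpNorm_const_smul_le

theorem wnorm_reflect (Φ : L2C) : wnorm (reflect Φ) = wnorm Φ := by
  unfold wnorm
  rw [eLpNorm_congr_ae (reflect_ae Φ)]
  have h := eLpNorm_comp_measurePreserving (p := 1) (Lp.aestronglyMeasurable Φ)
    (Measure.measurePreserving_neg (volume : Measure ℝ))
  rw [← h]
  exact eLpNorm_congr_norm_ae (by filter_upwards with x; simp)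

theorem wnorm_bmul_le {m : ℝ → ℂ} (hm : BddSymbol m) {C : ℝ} (hC : ∀ η, ‖m η‖ ≤ C) (Φ : L2C) :
    wnorm (bmul m hm Φ) ≤ ENNReal.ofReal C * wnorm Φ := by
  unfold wnorm
  rw [eLpNorm_congr_ae (bmul_ae m hm Φ)]
  refine eLpNorm_le_mul_eLpNorm_of_ae_le_mul ?_ _
  filter_upwards with η
  rw [norm_mul]
  gcongr
  exact hC η

/-- Weights `w ≥ 1` which are subadditive and submultiplicative up to constants, with
`1 / w ∈ L²`. -/
structure IsWeight (w : ℝ → ℝ) : Prop where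
  measurable : Measurable w
  one_le : ∀ x, 1 ≤ w x
  add_le : ∀ x y, w (x + y) ≤ 2 * (w x + w y)
  mul_le : ∀ x y, w (x + y) ≤ 2 * (w x * w y)
  memLp_inv : MemLp (fun x => (w x)⁻¹) 2 volume

namespace IsWeight

variable {w : ℝ → ℝ} (hw : IsWeight w)

/-- The `L²` norm of `1 / w`. -/
def const (_ : IsWeight w) : ℝ≥0∞ := eLpNorm (fun x => (w x)⁻¹) 2 volume

theorem pos {w : ℝ → ℝ} (hw : IsWeight w) (x : ℝ) : 0 < w x := one_pos.trans_le (hw.one_le x)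

theorem const_ne_top : hw.const ≠ ∞ := hw.memLp_inv.2.ne

/-- The function with weighted transform `Φ` has transform `Φ / w`. -/
def unw (_ : IsWeight w) (Φ : L2C) (η : ℝ) : ℂ := ((w η)⁻¹ : ℝ) * Φ η

theorem mul_unw (Φ : L2C) (η : ℝ) : (w η : ℂ) * hw.unw Φ η = Φ η := by
  have := (hw.pos η).ne'
  rw [unw, ← mul_assoc, ← Complex.ofReal_mul, mul_inv_cancel₀ this, Complex.ofReal_one, one_mul]

theorem eLpNorm_unw_one_le (Φ : L2C) :
    eLpNorm (hw.unw Φ) 1 volume ≤ hw.const * ENNReal.ofReal ‖Φ‖ := by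
  have h := eLpNorm_smul_le_mul_eLpNorm (p := 2) (q := 2) (r := 1) (f := Φ)
    (φ := fun x => (w x)⁻¹) (Lp.aestronglyMeasurable Φ) hw.memLp_inv.1
  have e : ((fun x => (w x)⁻¹) • (Φ : ℝ → ℂ)) = hw.unw Φ := by
    ext x; simp [unw]
  rw [e] at h
  refine h.trans (le_of_eq ?_)
  rw [Lp.norm_def, ENNReal.ofReal_toReal (Lp.eLpNorm_ne_top Φ)]
  rfl

theorem unw_aesm (Φ : L2C) : AEStronglyMeasurable (hw.unw Φ) volume :=
  (Complex.measurable_ofReal.comp hw.measurable.inv).aestronglyMeasurable.mul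
    (Lp.aestronglyMeasurable Φ)

theorem integrable_unw (Φ : L2C) : Integrable (hw.unw Φ) :=
  memLp_one_iff_integrable.1 ⟨hw.unw_aesm Φ, (hw.eLpNorm_unw_one_le Φ).trans_lt
    (ENNReal.mul_lt_top hw.const_ne_top.lt_top ENNReal.ofReal_lt_top)⟩

theorem norm_unw_le (Φ : L2C) (η : ℝ) : ‖hw.unw Φ η‖ ≤ ‖Φ η‖ := by
  rw [unw, norm_mul, Complex.norm_real, norm_inv, norm_eq_abs, abs_of_pos (hw.pos η)]
  exact mul_le_of_le_one_left (norm_nonneg _) (inv_le_one_of_one_le₀ (hw.one_le η))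

theorem memLp_unw (Φ : L2C) : MemLp (hw.unw Φ) 2 volume :=
  (Lp.memLp Φ).of_le (hw.unw_aesm Φ) (by filter_upwards with η using hw.norm_unw_le Φ η)

theorem unw_add (Φ Ψ : L2C) :
    hw.unw (Φ + Ψ) =ᵐ[volume] fun η => hw.unw Φ η + hw.unw Ψ η := by
  filter_upwards [Lp.coeFn_add Φ Ψ] with η h
  simp only [unw, h, Pi.add_apply, mul_add]

theorem unw_smul (r : ℝ) (Φ : L2C) :
    hw.unw (r • Φ) =ᵐ[volume] fun η => r • hw.unw Φ η := by
  filter_upwards [Lp.coeFn_smul r Φ] with η h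
  simp only [unw, h, Pi.smul_apply, mul_smul_comm]

/-- The weighted transform of the product. -/
def mulFun (Φ Ψ : L2C) (η : ℝ) : ℂ := w η * conv (hw.unw Φ) (hw.unw Ψ) η

theorem mulFun_aesm (Φ Ψ : L2C) : AEStronglyMeasurable (hw.mulFun Φ Ψ) volume :=
  (Complex.measurable_ofReal.comp hw.measurable).aestronglyMeasurable.mul
    ((hw.integrable_unw Φ).integrable_convolution (ContinuousLinearMap.mul ℂ ℂ)
      (hw.integrable_unw Ψ)).1

theorem enorm_eq_mul_enorm_unw (Φ : L2C) (η : ℝ) :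
    ‖Φ η‖ₑ = ENNReal.ofReal (w η) * ‖hw.unw Φ η‖ₑ := by
  rw [← hw.mul_unw Φ η, enorm_mul]
  congr 1
  rw [← ofReal_norm, Complex.norm_real, norm_eq_abs, abs_of_pos (hw.pos η)]

/-- Submultiplicativity of the weight loads both factors. This is the form that yields the estimates
with the L¹ norm of a weighted transform. -/
theorem enorm_mulFun_le_mul (Φ Ψ : L2C) (x : ℝ) :
    ‖hw.mulFun Φ Ψ x‖ₑ ≤ 2 * ((fun y => ‖Φ y‖ₑ) ⋆ₗ fun y => ‖Ψ y‖ₑ) x := by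
  have e : ‖hw.mulFun Φ Ψ x‖ₑ = ENNReal.ofReal (w x) * ‖conv (hw.unw Φ) (hw.unw Ψ) x‖ₑ := by
    rw [mulFun, enorm_mul]
    congr 1
    rw [← ofReal_norm, Complex.norm_real, norm_eq_abs, abs_of_pos (hw.pos x)]
  rw [e]
  refine (mul_le_mul_right (enorm_conv_le _ _ x) _).trans ?_
  simp only [lconvolution_def]
  rw [← lintegral_const_mul' _ _ ENNReal.ofReal_ne_top, ← lintegral_const_mul' _ _ (by norm_num)]
  refine lintegral_mono fun y => ?_
  dsimp only
  rw [hw.enorm_eq_mul_enorm_unw Φ y, hw.enorm_eq_mul_enorm_unw Ψ (-y + x)]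
  have h : ENNReal.ofReal (w x) ≤ 2 * (ENNReal.ofReal (w y) * ENNReal.ofReal (w (-y + x))) := by
    have := hw.mul_le y (-y + x)
    rw [add_neg_cancel_left] at this
    rw [← ENNReal.ofReal_mul (hw.pos y).le, ← ENNReal.ofReal_ofNat 2, ← ENNReal.ofReal_mul (by norm_num)]
    exact ENNReal.ofReal_le_ofReal this
  calc _ ≤ 2 * (ENNReal.ofReal (w y) * ENNReal.ofReal (w (-y + x))) *
        (‖hw.unw Φ y‖ₑ * ‖hw.unw Ψ (-y + x)‖ₑ) := by gcongr
    _ = _ := by ring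

/-- Subadditivity loads only one factor at a time. The other is unweighted, hence in L¹ because 1/w
is in L², so Young's inequality gives the algebra property. -/
theorem enorm_mulFun_le_add (Φ Ψ : L2C) (x : ℝ) :
    ‖hw.mulFun Φ Ψ x‖ₑ ≤ 2 * (((fun y => ‖Φ y‖ₑ) ⋆ₗ fun y => ‖hw.unw Ψ y‖ₑ) x +
      ((fun y => ‖hw.unw Φ y‖ₑ) ⋆ₗ fun y => ‖Ψ y‖ₑ) x) := by
  have e : ‖hw.mulFun Φ Ψ x‖ₑ = ENNReal.ofReal (w x) * ‖conv (hw.unw Φ) (hw.unw Ψ) x‖ₑ := by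
    rw [mulFun, enorm_mul]
    congr 1
    rw [← ofReal_norm, Complex.norm_real, norm_eq_abs, abs_of_pos (hw.pos x)]
  rw [e]
  refine (mul_le_mul_right (enorm_conv_le _ _ x) _).trans ?_
  simp only [lconvolution_def]
  have hΨ : AEMeasurable (fun y => ‖hw.unw Ψ (-y + x)‖ₑ) := by
    have h0 : AEMeasurable (fun y => ‖hw.unw Ψ y‖ₑ) := (hw.unw_aesm Ψ).enorm
    have h1 := h0.comp_quasiMeasurePreserving
      (quasiMeasurePreserving_sub_left volume x)
    refine h1.congr (Filter.Eventually.of_forall fun y => ?_)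
    simp only [Function.comp, sub_eq_neg_add]
  have hΦ : AEMeasurable (fun y => ‖Φ y‖ₑ) := (Lp.aestronglyMeasurable Φ).enorm
  rw [← lintegral_add_left' (by fun_prop),
    ← lintegral_const_mul' _ _ ENNReal.ofReal_ne_top, ← lintegral_const_mul' _ _ (by norm_num)]
  refine lintegral_mono fun y => ?_
  dsimp only
  rw [hw.enorm_eq_mul_enorm_unw Φ y, hw.enorm_eq_mul_enorm_unw Ψ (-y + x)]
  have h : ENNReal.ofReal (w x) ≤ 2 * (ENNReal.ofReal (w y) + ENNReal.ofReal (w (-y + x))) := by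
    have := hw.add_le y (-y + x)
    rw [add_neg_cancel_left] at this
    rw [← ENNReal.ofReal_add (hw.pos y).le (hw.pos _).le, ← ENNReal.ofReal_ofNat 2,
      ← ENNReal.ofReal_mul (by norm_num)]
    exact ENNReal.ofReal_le_ofReal this
  calc _ ≤ 2 * (ENNReal.ofReal (w y) + ENNReal.ofReal (w (-y + x))) *
        (‖hw.unw Φ y‖ₑ * ‖hw.unw Ψ (-y + x)‖ₑ) := by gcongr
    _ = _ := by ring

theorem eLpNorm_coe (Φ : L2C) : eLpNorm Φ 2 volume = ENNReal.ofReal ‖Φ‖ := by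
  rw [Lp.norm_def, ENNReal.ofReal_toReal (Lp.eLpNorm_ne_top Φ)]

theorem eLpNorm_two_mulFun_le (Φ Ψ : L2C) :
    eLpNorm (hw.mulFun Φ Ψ) 2 volume ≤ 4 * hw.const * ENNReal.ofReal ‖Φ‖ * ENNReal.ofReal ‖Ψ‖ := by
  have hΦ : AEMeasurable (fun y => ‖Φ y‖ₑ) := (Lp.aestronglyMeasurable Φ).enorm
  have hΨ : AEMeasurable (fun y => ‖Ψ y‖ₑ) := (Lp.aestronglyMeasurable Ψ).enorm
  have hΦ' : AEMeasurable (fun y => ‖hw.unw Φ y‖ₑ) := (hw.unw_aesm Φ).enorm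
  have hΨ' : AEMeasurable (fun y => ‖hw.unw Ψ y‖ₑ) := (hw.unw_aesm Ψ).enorm
  have h1 := eLpNorm_lconvolution_two_le' hΦ hΨ'
  have h2 := eLpNorm_lconvolution_two_le hΦ' hΨ
  have m1 := aemeasurable_lconvolution (μ := volume) hΦ hΨ'
  have m2 := aemeasurable_lconvolution (μ := volume) hΦ' hΨ
  simp only [eLpNorm_enorm, eLpNorm_coe] at h1 h2
  have h3 := eLpNorm_add_le (p := 2) m1.aestronglyMeasurable m2.aestronglyMeasurable (by norm_num)
  have h4 := eLpNorm_le_mul_eLpNorm_of_ae_le_mul' (c := 2) (f := hw.mulFun Φ Ψ) (μ := volume)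
    (g := ((fun y => ‖Φ y‖ₑ) ⋆ₗ fun y => ‖hw.unw Ψ y‖ₑ) +
      ((fun y => ‖hw.unw Φ y‖ₑ) ⋆ₗ fun y => ‖Ψ y‖ₑ))
    (by filter_upwards with x; simpa using hw.enorm_mulFun_le_add Φ Ψ x) 2
  refine h4.trans ((mul_le_mul_right (h3.trans (add_le_add h1 h2)) _).trans ?_)
  calc _ ≤ (2 : ℝ≥0∞) * (ENNReal.ofReal ‖Φ‖ * (hw.const * ENNReal.ofReal ‖Ψ‖) +
        hw.const * ENNReal.ofReal ‖Φ‖ * ENNReal.ofReal ‖Ψ‖) := by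
        gcongr
        · norm_num
        · exact hw.eLpNorm_unw_one_le Ψ
        · exact hw.eLpNorm_unw_one_le Φ
    _ = _ := by ring

theorem memLp_mulFun (Φ Ψ : L2C) : MemLp (hw.mulFun Φ Ψ) 2 volume :=
  ⟨hw.mulFun_aesm Φ Ψ, (hw.eLpNorm_two_mulFun_le Φ Ψ).trans_lt
    (ENNReal.mul_lt_top (ENNReal.mul_lt_top (ENNReal.mul_lt_top (by norm_num)
      hw.const_ne_top.lt_top) ENNReal.ofReal_lt_top) ENNReal.ofReal_lt_top)⟩

theorem mulFun_comm (Φ Ψ : L2C) : hw.mulFun Φ Ψ = hw.mulFun Ψ Φ := by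
  ext η; rw [mulFun, mulFun, conv_comm]

theorem mulFun_add (Φ Ψ Ψ' : L2C) :
    hw.mulFun Φ (Ψ + Ψ') =ᵐ[volume] hw.mulFun Φ Ψ + hw.mulFun Φ Ψ' := by
  filter_upwards [(hw.integrable_unw Φ).ae_convolution_exists (ContinuousLinearMap.mul ℂ ℂ)
    (hw.integrable_unw Ψ), (hw.integrable_unw Φ).ae_convolution_exists
      (ContinuousLinearMap.mul ℂ ℂ) (hw.integrable_unw Ψ')] with η h1 h2
  have h3 := h1.distrib_add h2
  simp only [Pi.add_apply, mulFun]
  rw [conv_congr (φ := hw.unw Φ) Filter.EventuallyEq.rfl (hw.unw_add Ψ Ψ'), ← mul_add]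
  exact congrArg _ h3

theorem mulFun_smul (r : ℝ) (Φ Ψ : L2C) :
    hw.mulFun Φ (r • Ψ) = r • hw.mulFun Φ Ψ := by
  ext η
  simp only [Pi.smul_apply, mulFun]
  rw [conv_congr (φ := hw.unw Φ) Filter.EventuallyEq.rfl (hw.unw_smul r Ψ), ← mul_smul_comm]
  congr 1
  simp only [conv, convolution_def, ContinuousLinearMap.mul_apply', mul_smul_comm]
  exact integral_smul r _

/-- The weighted transform of the product, as an element of `L²`. -/
def mulL2 (Φ Ψ : L2C) : L2C := (hw.memLp_mulFun Φ Ψ).toLp _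

theorem mulL2_comm (Φ Ψ : L2C) : hw.mulL2 Φ Ψ = hw.mulL2 Ψ Φ := by
  unfold mulL2
  simp only [hw.mulFun_comm Φ Ψ]

theorem mulL2_add (Φ Ψ Ψ' : L2C) :
    hw.mulL2 Φ (Ψ + Ψ') = hw.mulL2 Φ Ψ + hw.mulL2 Φ Ψ' := by
  unfold mulL2
  rw [← MemLp.toLp_add]
  exact MemLp.toLp_congr _ _ (hw.mulFun_add Φ Ψ Ψ')

theorem mulL2_smul (r : ℝ) (Φ Ψ : L2C) : hw.mulL2 Φ (r • Ψ) = r • hw.mulL2 Φ Ψ := by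
  unfold mulL2
  rw [← MemLp.toLp_const_smul]
  simp only [hw.mulFun_smul r Φ Ψ]

theorem norm_mulL2_le (Φ Ψ : L2C) : ‖hw.mulL2 Φ Ψ‖ ≤ 4 * hw.const.toReal * ‖Φ‖ * ‖Ψ‖ := by
  unfold mulL2
  rw [Lp.norm_toLp]
  refine ENNReal.toReal_le_of_le_ofReal (by positivity) ?_
  refine (hw.eLpNorm_two_mulFun_le Φ Ψ).trans (le_of_eq ?_)
  rw [ENNReal.ofReal_mul (by positivity), ENNReal.ofReal_mul (by positivity),
    ENNReal.ofReal_mul (by positivity), ENNReal.ofReal_toReal hw.const_ne_top]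
  norm_num

/-- The multiplication of functions with weighted transform in `L²`, as a bilinear map on the
weighted transforms. -/
def mul : L2C →L[ℝ] L2C →L[ℝ] L2C :=
  LinearMap.mkContinuous₂
    (LinearMap.mk₂ ℝ hw.mulL2
      (fun Φ Φ' Ψ => by rw [hw.mulL2_comm, hw.mulL2_add, hw.mulL2_comm Φ, hw.mulL2_comm Φ'])
      (fun r Φ Ψ => by rw [hw.mulL2_comm, hw.mulL2_smul, hw.mulL2_comm Φ])
      hw.mulL2_add hw.mulL2_smul)
    (4 * hw.const.toReal) hw.norm_mulL2_le

theorem mul_comm' (Φ Ψ : L2C) : hw.mul Φ Ψ = hw.mul Ψ Φ := hw.mulL2_comm Φ Ψ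

theorem mul_ae (Φ Ψ : L2C) : hw.mul Φ Ψ =ᵐ[volume] hw.mulFun Φ Ψ :=
  (hw.memLp_mulFun Φ Ψ).coeFn_toLp

theorem unw_mul (Φ Ψ : L2C) : hw.unw (hw.mul Φ Ψ) =ᵐ[volume] conv (hw.unw Φ) (hw.unw Ψ) := by
  filter_upwards [hw.mul_ae Φ Ψ] with η h
  have := (hw.pos η).ne'
  rw [unw, h, mulFun, ← mul_assoc, ← Complex.ofReal_mul, inv_mul_cancel₀ this,
    Complex.ofReal_one, one_mul]

theorem wnorm_mul_le (Φ Ψ : L2C) : wnorm (hw.mul Φ Ψ) ≤ 2 * wnorm Φ * wnorm Ψ := by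
  have hΦ : AEMeasurable (fun y => ‖Φ y‖ₑ) := (Lp.aestronglyMeasurable Φ).enorm
  have hΨ : AEMeasurable (fun y => ‖Ψ y‖ₑ) := (Lp.aestronglyMeasurable Ψ).enorm
  unfold wnorm
  rw [eLpNorm_congr_ae (hw.mul_ae Φ Ψ)]
  have h4 := eLpNorm_le_mul_eLpNorm_of_ae_le_mul' (c := 2) (f := hw.mulFun Φ Ψ) (μ := volume)
    (g := ((fun y => ‖Φ y‖ₑ) ⋆ₗ fun y => ‖Ψ y‖ₑ))
    (by filter_upwards with x; simpa using hw.enorm_mulFun_le_mul Φ Ψ x) 1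
  rw [eLpNorm_lconvolution_one hΦ hΨ, eLpNorm_enorm, eLpNorm_enorm] at h4
  simpa [mul_assoc] using h4

/-- The asymmetric estimate behind every gain in ε: the factor measured in L¹ is the small one,
while the other stays in the L² norm that defines operator norms. -/
theorem enorm_mul_le (Φ Ψ : L2C) :
    ENNReal.ofReal ‖hw.mul Φ Ψ‖ ≤ 2 * wnorm Φ * ENNReal.ofReal ‖Ψ‖ := by
  have hΦ : AEMeasurable (fun y => ‖Φ y‖ₑ) := (Lp.aestronglyMeasurable Φ).enorm
  have hΨ : AEMeasurable (fun y => ‖Ψ y‖ₑ) := (Lp.aestronglyMeasurable Ψ).enorm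
  rw [← eLpNorm_coe, eLpNorm_congr_ae (hw.mul_ae Φ Ψ)]
  have h4 := eLpNorm_le_mul_eLpNorm_of_ae_le_mul' (c := 2) (f := hw.mulFun Φ Ψ) (μ := volume)
    (g := ((fun y => ‖Φ y‖ₑ) ⋆ₗ fun y => ‖Ψ y‖ₑ))
    (by filter_upwards with x; simpa using hw.enorm_mulFun_le_mul Φ Ψ x) 2
  refine h4.trans ?_
  have h5 := eLpNorm_lconvolution_two_le hΦ hΨ
  rw [eLpNorm_enorm, eLpNorm_enorm, eLpNorm_coe] at h5
  rw [mul_assoc]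
  exact mul_le_mul_right h5 _

/-! ### Point values -/

/-- The value at `x` of the function with weighted transform `Φ`. -/
def val (Φ : L2C) (x : ℝ) : ℂ := 𝓕⁻ (hw.unw Φ) x

theorem val_add (Φ Ψ : L2C) (x : ℝ) : hw.val (Φ + Ψ) x = hw.val Φ x + hw.val Ψ x := by
  unfold val
  rw [fourierInv_congr_ae (hw.unw_add Φ Ψ)]
  simp only [fourierInv_eq, smul_add]
  exact integral_add ((Real.fourierIntegral_convergent_iff (-x)).2 (hw.integrable_unw Φ) |>.congr
    (by filter_upwards with v; simp)) ((Real.fourierIntegral_convergent_iff (-x)).2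
      (hw.integrable_unw Ψ) |>.congr (by filter_upwards with v; simp))

theorem val_smul (r : ℝ) (Φ : L2C) (x : ℝ) : hw.val (r • Φ) x = r • hw.val Φ x := by
  unfold val
  rw [fourierInv_congr_ae (hw.unw_smul r Φ)]
  simp only [fourierInv_eq]
  rw [← integral_smul]
  congr 1; ext v
  rw [smul_comm]

theorem val_mul (Φ Ψ : L2C) (x : ℝ) : hw.val (hw.mul Φ Ψ) x = hw.val Φ x * hw.val Ψ x := by
  unfold val
  rw [fourierInv_congr_ae (hw.unw_mul Φ Ψ), fourierInv_conv (hw.integrable_unw Φ)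
    (hw.integrable_unw Ψ)]

theorem norm_val_le (Φ : L2C) (x : ℝ) : ‖hw.val Φ x‖ ≤ hw.const.toReal * ‖Φ‖ := by
  unfold val
  rw [fourierInv_eq]
  refine (norm_integral_le_integral_norm _).trans ?_
  have h := hw.eLpNorm_unw_one_le Φ
  rw [eLpNorm_one_eq_lintegral_enorm] at h
  have : ∫ v, ‖𝐞 (inner ℝ v x) • hw.unw Φ v‖ = (∫⁻ v, ‖hw.unw Φ v‖ₑ).toReal := by
    simp only [Circle.norm_smul]
    rw [integral_norm_eq_lintegral_enorm (hw.unw_aesm Φ)]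
  rw [this]
  refine ENNReal.toReal_le_of_le_ofReal (by positivity) (h.trans (le_of_eq ?_))
  rw [ENNReal.ofReal_mul (by positivity), ENNReal.ofReal_toReal hw.const_ne_top]

/-- Point values are ring homomorphisms to ℂ and together determine Φ, so an algebraic identity
between weighted transforms can be checked as an identity between complex numbers. -/
theorem val_injective : Function.Injective hw.val := by
  intro Φ Ψ h
  have h1 := hw.memLp_unw Φ
  have h2 := hw.memLp_unw Ψ
  have i1 : Integrable (h1.toLp _) := (hw.integrable_unw Φ).congr h1.coeFn_toLp.symm
  have i2 : Integrable (h2.toLp _) := (hw.integrable_unw Ψ).congr h2.coeFn_toLp.symm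
  have e : invFourierL2 (h1.toLp _) = invFourierL2 (h2.toLp _) := by
    apply Lp.ext
    filter_upwards [invFourierL2_ae_eq _ i1, invFourierL2_ae_eq _ i2] with x a b
    rw [a, b, fourierInv_congr_ae h1.coeFn_toLp, fourierInv_congr_ae h2.coeFn_toLp]
    exact congrFun h x
  have e2 := (MemLp.toLp_eq_toLp_iff _ _).1 (invFourierL2.injective e)
  apply Lp.ext
  filter_upwards [e2] with η a
  rw [← hw.mul_unw Φ η, ← hw.mul_unw Ψ η, a]

theorem mul_assoc' (Φ Ψ Θ : L2C) : hw.mul (hw.mul Φ Ψ) Θ = hw.mul Φ (hw.mul Ψ Θ) := by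
  apply hw.val_injective
  ext x
  simp only [val_mul, mul_assoc]

end IsWeight

end
end Babenko

/-! ### H² in weighted coordinates, the two subspaces, and the inverse of L(D) -/

namespace Babenko
noncomputable section

open scoped FourierTransform ComplexConjugate ENNReal NNReal

/-! ### The weights of `H¹` and `H²` -/

/-- The weight `1 + |ξ|` at `ξ = 2π η`. -/
def weight₁ (η : ℝ) : ℝ := 1 + |2 * π * η|

/-- The weight `1 + ξ²` at `ξ = 2π η`. -/
def weight₂ (η : ℝ) : ℝ := 1 + (2 * π * η) ^ 2

theorem weight_eq (η : ℝ) : weight η = (weight₂ η : ℂ) := rfl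

theorem one_add_sq_le_weight₂ (x : ℝ) : 1 + x ^ 2 ≤ weight₂ x := by
  have h : (1 : ℝ) ≤ (2 * π) ^ 2 := by nlinarith [pi_gt_three]
  unfold weight₂
  nlinarith [sq_nonneg x]

theorem isWeight₁ : IsWeight weight₁ where
  measurable := by unfold weight₁; fun_prop
  one_le x := by unfold weight₁; linarith [abs_nonneg (2 * π * x)]
  add_le x y := by
    unfold weight₁
    rw [mul_add]
    linarith [abs_add_le (2 * π * x) (2 * π * y), abs_nonneg (2 * π * x), abs_nonneg (2 * π * y)]
  mul_le x y := by
    unfold weight₁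
    rw [mul_add]
    nlinarith [abs_add_le (2 * π * x) (2 * π * y), abs_nonneg (2 * π * x),
      abs_nonneg (2 * π * y), mul_nonneg (abs_nonneg (2 * π * x)) (abs_nonneg (2 * π * y))]
  memLp_inv := by
    have hm : Measurable (fun x => (weight₁ x)⁻¹) := by unfold weight₁; fun_prop
    refine (memLp_two_iff_integrable_sq hm.aestronglyMeasurable).2 ?_
    refine integrable_inv_one_add_sq.mono' (hm.pow_const 2).aestronglyMeasurable ?_
    filter_upwards with x
    have h1 : 1 + x ^ 2 ≤ weight₁ x ^ 2 := by
      refine (one_add_sq_le_weight₂ x).trans ?_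
      unfold weight₁ weight₂
      nlinarith [abs_nonneg (2 * π * x), sq_abs (2 * π * x)]
    rw [norm_eq_abs, abs_of_nonneg (by positivity), inv_pow]
    exact inv_anti₀ (by positivity) h1

theorem isWeight₂ : IsWeight weight₂ where
  measurable := by unfold weight₂; fun_prop
  one_le x := by unfold weight₂; nlinarith [sq_nonneg (2 * π * x)]
  add_le x y := by
    unfold weight₂
    nlinarith [sq_nonneg (2 * π * x - 2 * π * y)]
  mul_le x y := by
    unfold weight₂
    nlinarith [sq_nonneg (2 * π * x - 2 * π * y), mul_nonneg (sq_nonneg (2 * π * x)) (sq_nonneg (2 * π * y))]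
  memLp_inv := by
    have hm : Measurable (fun x => (weight₂ x)⁻¹) := by unfold weight₂; fun_prop
    refine (memLp_two_iff_integrable_sq hm.aestronglyMeasurable).2 ?_
    refine integrable_inv_one_add_sq.mono' (hm.pow_const 2).aestronglyMeasurable ?_
    filter_upwards with x
    have h0 := one_add_sq_le_weight₂ x
    have h1 : 1 + x ^ 2 ≤ weight₂ x ^ 2 := by nlinarith [sq_nonneg x]
    rw [norm_eq_abs, abs_of_nonneg (by positivity), inv_pow]
    exact inv_anti₀ (by positivity) h1

/-! ### `H²` as a Banach space -/

/-- The isometric embedding `u ↦ (1 + ξ²) û`. -/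
def weightedL : H2 →L[ℝ] L2C := (⟨H2.weighted, fun _ => rfl⟩ : H2 →ₗᵢ[ℝ] L2C).toContinuousLinearMap

theorem norm_weightedL (u : H2) : ‖weightedL u‖ = ‖u‖ := rfl

theorem weightedL_ae (u : H2) : weightedL u =ᵐ[volume] fun η => weight η * H2.hat u η :=
  (H2.memLp_weight u).coeFn_toLp

theorem unw_weightedL (u : H2) : isWeight₂.unw (weightedL u) =ᵐ[volume] H2.hat u := by
  filter_upwards [weightedL_ae u] with η h
  have := (isWeight₂.pos η).ne'
  rw [IsWeight.unw, h, weight_eq, ← mul_assoc, ← Complex.ofReal_mul, inv_mul_cancel₀ this,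
    Complex.ofReal_one, one_mul]

theorem IsWeight.bddSymbol_inv {w : ℝ → ℝ} (hw : IsWeight w) :
    BddSymbol (fun η => ((w η)⁻¹ : ℝ)) := by
  refine .of_le (Complex.measurable_ofReal.comp hw.measurable.inv) 1 fun η => ?_
  rw [Complex.norm_real, norm_inv, norm_eq_abs, abs_of_pos (hw.pos η)]
  exact inv_le_one_of_one_le₀ (hw.one_le η)

/-- The real function whose transform is the Hermitian part of `Φ / (1 + ξ²)`. -/
def ofWeightedL2 : L2C →L[ℝ] L2R := reInvFourier ∘L bmul _ isWeight₂.bddSymbol_inv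

theorem weight_mul_fourierL2_ofWeightedL2 (Φ : L2C) :
    (fun η => weight η * fourierL2 (ofWeightedL2 Φ) η) =ᵐ[volume]
      ((2⁻¹ : ℝ) • (Φ + reflect Φ) : L2C) := by
  have h := fourierL2_reInvFourier (bmul _ isWeight₂.bddSymbol_inv Φ)
  set Ψ := bmul _ isWeight₂.bddSymbol_inv Φ with hΨ
  have h1 := bmul_ae _ isWeight₂.bddSymbol_inv Φ
  have h2 := (Measure.measurePreserving_neg (volume : Measure ℝ)).quasiMeasurePreserving.ae_eq_comp h1
  rw [show ofWeightedL2 Φ = reInvFourier Ψ from rfl, h]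
  filter_upwards [h1, h2, Lp.coeFn_smul (2⁻¹ : ℝ) (Φ + reflect Φ), Lp.coeFn_add Φ (reflect Φ),
    Lp.coeFn_smul (2⁻¹ : ℝ) (Ψ + reflect Ψ), Lp.coeFn_add Ψ (reflect Ψ), reflect_ae Φ, reflect_ae Ψ]
    with η a b c d e f g i
  simp only [Function.comp] at b
  rw [c, e, Pi.smul_apply, Pi.smul_apply, d, f, Pi.add_apply, Pi.add_apply, g, i]
  rw [← hΨ] at a b
  rw [a, b, weight_eq, map_mul, Complex.conj_ofReal,
    show weight₂ (-η) = weight₂ η by unfold weight₂; ring, ← mul_add, mul_smul_comm, ← mul_assoc,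
    ← Complex.ofReal_mul, mul_inv_cancel₀ (isWeight₂.pos η).ne', Complex.ofReal_one, one_mul]

/-- The left inverse of `weightedL`. -/
def ofWeightedₗ : L2C →ₗ[ℝ] H2 where
  toFun Φ := (⟨ofWeightedL2 Φ, (memLp_congr_ae (weight_mul_fourierL2_ofWeightedL2 Φ)).2
    (Lp.memLp _)⟩ : H2Submodule)
  map_add' Φ Ψ := H2.toL2_injective (ofWeightedL2.map_add Φ Ψ)
  map_smul' r Φ := H2.toL2_injective (ofWeightedL2.map_smul r Φ)

theorem weightedL_ofWeightedₗ (Φ : L2C) :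
    weightedL (ofWeightedₗ Φ) = (2⁻¹ : ℝ) • (Φ + reflect Φ) :=
  Lp.ext ((weightedL_ae _).trans (weight_mul_fourierL2_ofWeightedL2 Φ))

/-- The left inverse of `weightedL`, as a continuous linear map. -/
def ofWeighted : L2C →L[ℝ] H2 :=
  ofWeightedₗ.mkContinuous 1 fun Φ => by
    rw [← norm_weightedL, weightedL_ofWeightedₗ, norm_smul]
    have h1 := norm_add_le Φ (reflect Φ)
    have h2 := norm_reflect_le Φ
    rw [norm_inv, Real.norm_ofNat]
    linarith

theorem toL2_ofWeighted (Φ : L2C) :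
    H2.toL2 (ofWeighted Φ) = reInvFourier (bmul _ isWeight₂.bddSymbol_inv Φ) := rfl

theorem weightedL_ofWeighted (Φ : L2C) :
    weightedL (ofWeighted Φ) = (2⁻¹ : ℝ) • (Φ + reflect Φ) := weightedL_ofWeightedₗ Φ

theorem ofWeighted_weightedL (u : H2) : ofWeighted (weightedL u) = u := by
  apply H2.toL2_injective
  rw [toL2_ofWeighted]
  have : bmul _ isWeight₂.bddSymbol_inv (weightedL u) = fourierL2 (H2.toL2 u) :=
    Lp.ext ((bmul_ae _ _ _).trans (unw_weightedL u))
  rw [this, reInvFourier_fourierL2]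

/-- The isometric image of H² in L² is the fixed-point set of the continuous projection onto
Hermitian functions, hence closed. -/
instance : CompleteSpace H2 := by
  have hi : Isometry weightedL := AddMonoidHomClass.isometry_of_norm weightedL norm_weightedL
  rw [completeSpace_iff_isComplete_range hi.isUniformInducing]
  have : Set.range weightedL = {Φ | weightedL (ofWeighted Φ) = Φ} := by
    ext Φ
    constructor
    · rintro ⟨u, rfl⟩
      simp only [Set.mem_ofPred_eq, ofWeighted_weightedL]
    · exact fun h => ⟨_, h⟩
  rw [this]
  exact (isClosed_eq (by fun_prop) continuous_id).isComplete

theorem wnorm_weightedL_ofWeighted_le (Φ : L2C) : wnorm (weightedL (ofWeighted Φ)) ≤ wnorm Φ := by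
  rw [weightedL_ofWeighted]
  refine (wnorm_smul_le _ _).trans ?_
  refine (mul_le_mul_right ((wnorm_add_le _ _).trans_eq (by rw [wnorm_reflect])) _).trans ?_
  rw [← two_mul, ← mul_assoc]
  have : ‖(2⁻¹ : ℝ)‖ₑ * 2 = 1 := by
    rw [← ofReal_norm, norm_inv, Real.norm_ofNat, ENNReal.ofReal_inv_of_pos (by norm_num)]
    rw [ENNReal.ofReal_ofNat, ENNReal.inv_mul_cancel (by norm_num) (by norm_num)]
  rw [this, one_mul]

/-! ### Restriction of the frequencies -/

theorem bddSymbol_indicator {S : Set ℝ} (hS : MeasurableSet S) :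
    BddSymbol (fun η => S.indicator (1 : ℝ → ℂ) (2 * π * η)) := by
  refine .of_le ((measurable_one.indicator hS).comp (by fun_prop)) 1 fun η => ?_
  by_cases h : 2 * π * η ∈ S <;> simp [h]

theorem mem_supportedOn_iff {S : Set ℝ} (hS : MeasurableSet S) (u : H2) :
    u ∈ supportedOn S ↔ bmul _ (bddSymbol_indicator hS.compl) (weightedL u) = 0 := by
  rw [Lp.eq_zero_iff_ae_eq_zero]
  constructor
  · intro h
    filter_upwards [h, bmul_ae _ (bddSymbol_indicator hS.compl) (weightedL u), weightedL_ae u]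
      with η a b c
    rw [b, c]
    by_cases hη : 2 * π * η ∈ S
    · simp [hη]
    · simp [a hη]
  · intro h
    change ∀ᵐ η : ℝ, 2 * π * η ∉ S → H2.hat u η = 0
    filter_upwards [h, bmul_ae _ (bddSymbol_indicator hS.compl) (weightedL u), weightedL_ae u]
      with η a b c hη
    rw [b, c] at a
    have hη' : 2 * π * η ∈ Sᶜ := hη
    simpa [Set.indicator_of_mem hη', weight_ne_zero] using a

theorem isClosed_supportedOn {S : Set ℝ} (hS : MeasurableSet S) :
    IsClosed (supportedOn S : Set H2) := by
  have : (supportedOn S : Set H2) =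
      {u | bmul _ (bddSymbol_indicator hS.compl) (weightedL u) = 0} := by
    ext u; exact mem_supportedOn_iff hS u
  rw [this]
  exact isClosed_eq (by fun_prop) continuous_const

theorem measurableSet_band (ω δ : ℝ) : MeasurableSet (band ω δ) :=
  measurableSet_Ioo.union measurableSet_Ioo

theorem neg_mem_band {ω δ ξ : ℝ} : -ξ ∈ band ω δ ↔ ξ ∈ band ω δ := by
  simp only [band, Set.mem_union, Set.mem_Ioo]
  constructor <;> rintro (h | h)
  · right; constructor <;> linarith
  · left; constructor <;> linarith
  · right; constructor <;> linarith
  · left; constructor <;> linarith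

instance (ω δ : ℝ) : CompleteSpace (X1 ω δ) :=
  (isClosed_supportedOn (measurableSet_band ω δ)).completeSpace_coe

instance (ω δ : ℝ) : CompleteSpace (X2 ω δ) :=
  (isClosed_supportedOn (measurableSet_band ω δ).compl).completeSpace_coe

/-! ### The operator `(1 - χ(D)) / L(D)` from `L²` to `𝒳₂` -/

/-- The symbol of `(1 - χ(D)) / L(D)`. -/
def invLSymbol (g γ σ cs ω δ ξ : ℝ) : ℂ := (((1 - χ ω δ ξ) / ell g γ σ cs ξ : ℝ) : ℂ)

/-- The symbol of `(1 + D²) (1 - χ(D)) / L(D)` is bounded. -/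
def InvLBdd (g γ σ cs ω δ : ℝ) : Prop :=
  BddSymbol fun η => weight η * invLSymbol g γ σ cs ω δ (2 * π * η)

variable {g γ σ cs ω δ : ℝ}

theorem invLSymbol_eq_zero {ξ : ℝ} (h : ξ ∈ band ω δ) : invLSymbol g γ σ cs ω δ ξ = 0 := by
  simp [invLSymbol, χ, h]

/-- The operator `(1 - χ(D)) / L(D)`, acting on the Fourier transform. -/
def invLH2 (hB : InvLBdd g γ σ cs ω δ) : L2C →L[ℝ] H2 := ofWeighted ∘L bmul _ hB

/-- The symbol vanishes on the band, and the band is symmetric about 0, so passing to the Hermitian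
part creates no frequencies inside it. -/
theorem invLH2_mem (hB : InvLBdd g γ σ cs ω δ) (Φ : L2C) : invLH2 hB Φ ∈ X2 ω δ := by
  rw [mem_supportedOn_iff (measurableSet_band ω δ).compl, invLH2, ContinuousLinearMap.comp_apply,
    weightedL_ofWeighted, Lp.eq_zero_iff_ae_eq_zero]
  set Ψ := bmul _ hB Φ with hΨ
  have h1 : Ψ =ᵐ[volume] _ := bmul_ae _ hB Φ
  have h2 := (Measure.measurePreserving_neg (volume : Measure ℝ)).quasiMeasurePreserving.ae_eq_comp h1
  filter_upwards [bmul_ae _ (bddSymbol_indicator (measurableSet_band ω δ).compl.compl)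
    ((2⁻¹ : ℝ) • (Ψ + reflect Ψ)), Lp.coeFn_smul (2⁻¹ : ℝ) (Ψ + reflect Ψ),
    Lp.coeFn_add Ψ (reflect Ψ), reflect_ae Ψ, h1, h2] with η a b c d e f
  simp only [Function.comp] at f
  rw [a, b, Pi.smul_apply, c, Pi.add_apply, d, e, f]
  by_cases h : 2 * π * η ∈ band ω δ
  · have h' : 2 * π * (-η) ∈ band ω δ := by
      rw [mul_neg]; exact neg_mem_band.2 h
    rw [invLSymbol_eq_zero h, invLSymbol_eq_zero h']
    simp
  · simp [h]

/-- The operator `(1 - χ(D)) / L(D)`, acting on the Fourier transform, with values in `𝒳₂`. -/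
def invLX2 (hB : InvLBdd g γ σ cs ω δ) : L2C →L[ℝ] X2 ω δ :=
  (invLH2 hB).codRestrict _ (invLH2_mem hB)

theorem coe_invLX2 (hB : InvLBdd g γ σ cs ω δ) (Φ : L2C) :
    (invLX2 hB Φ : H2) = ofWeighted (bmul _ hB Φ) := rfl

theorem HasFT.invL_ae (hB : InvLBdd g γ σ cs ω δ) {f : ℝ → ℝ} {Φ : L2C} (h : HasFT f Φ) :
    invL g γ σ cs ω δ f =ᵐ[volume] (invLX2 hB Φ : H2) := by
  have hb : BddSymbol fun η => invLSymbol g γ σ cs ω δ (2 * π * η) := by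
    obtain ⟨hm, C, hC⟩ := hB
    have e : (fun η => invLSymbol g γ σ cs ω δ (2 * π * η)) = fun η =>
        (((weight₂ η)⁻¹ : ℝ) : ℂ) * (weight η * invLSymbol g γ σ cs ω δ (2 * π * η)) := by
      ext η
      rw [weight_eq, ← mul_assoc, ← Complex.ofReal_mul, inv_mul_cancel₀ (isWeight₂.pos η).ne',
        Complex.ofReal_one, one_mul]
    refine ⟨?_, C, fun η => ?_⟩
    · rw [e]; exact isWeight₂.bddSymbol_inv.1.mul hm
    · refine (congrArg norm (congrFun e η)).trans_le ?_
      rw [norm_mul]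
      refine le_trans (mul_le_of_le_one_left (norm_nonneg _) ?_) (hC η)
      rw [Complex.norm_real, norm_inv, norm_eq_abs, abs_of_pos (isWeight₂.pos η)]
      exact inv_le_one_of_one_le₀ (isWeight₂.one_le η)
  have hm := hb.memLp (Lp.memLp Φ)
  refine (h.mult_ae (m := invLSymbol g γ σ cs ω δ) hm).trans ?_
  rw [coe_invLX2, toL2_ofWeighted]
  have : hm.toLp _ = bmul _ isWeight₂.bddSymbol_inv (bmul _ hB Φ) := by
    apply Lp.ext
    filter_upwards [hm.coeFn_toLp, bmul_ae _ isWeight₂.bddSymbol_inv (bmul _ hB Φ),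
      bmul_ae _ hB Φ] with η a b c
    rw [a, b, c, weight_eq, ← mul_assoc, ← mul_assoc, ← Complex.ofReal_mul,
      inv_mul_cancel₀ (isWeight₂.pos η).ne', Complex.ofReal_one, one_mul]
  rw [this]

theorem wnorm_invLX2_le (hB : InvLBdd g γ σ cs ω δ) :
    ∃ C : ℝ, 0 < C ∧ ∀ Φ, wnorm (weightedL (invLX2 hB Φ : H2)) ≤ ENNReal.ofReal C * wnorm Φ := by
  obtain ⟨C, hC⟩ := hB.2
  refine ⟨max C 1, by positivity, fun Φ => ?_⟩
  rw [coe_invLX2]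
  exact (wnorm_weightedL_ofWeighted_le _).trans
    (wnorm_bmul_le hB (fun η => (hC η).trans (le_max_left _ _)) Φ)

end
end Babenko

namespace Babenko
noncomputable section

open scoped Topology ContDiff ENNReal NNReal

/-! ### Orders of vanishing in the Wiener norm

The order of vanishing of a map `h` on `H²` is measured by a gauge `ν` of its values in terms of
`t ≥ ∫ |weightedL U|`, and by the operator norm (between `L²`-based norms) of its derivative. -/

theorem le_of_ofReal_le_two_mul {a b c : ℝ} (hb : 0 ≤ b) (hc : 0 ≤ c)
    (h : ENNReal.ofReal a ≤ 2 * ENNReal.ofReal b * ENNReal.ofReal c) : a ≤ 2 * b * c := by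
  rw [← ENNReal.ofReal_ofNat 2, ← ENNReal.ofReal_mul (by norm_num),
    ← ENNReal.ofReal_mul (by positivity)] at h
  exact (ENNReal.ofReal_le_ofReal_iff (by positivity)).1 h

/-- A gauge `ν` for which multiplication by `Φ` is bounded by `ν Φ`. -/
structure IsGauge (ν : L2C → ℝ≥0∞) (m : L2C →L[ℝ] L2C →L[ℝ] L2C) : Prop where
  add_le : ∀ Φ Ψ, ν (Φ + Ψ) ≤ ν Φ + ν Ψ
  smul_le : ∀ (r : ℝ) Φ, ν (r • Φ) ≤ ‖r‖ₑ * ν Φ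
  mul_le : ∀ Φ Ψ, ν (m Φ Ψ) ≤ 2 * ν Φ * ν Ψ
  enorm_le : ∀ Φ Ψ, ‖m Φ Ψ‖ₑ ≤ 2 * ν Φ * ‖Ψ‖ₑ
  comm : ∀ Φ Ψ, m Φ Ψ = m Ψ Φ

theorem IsWeight.isGauge_wnorm {w : ℝ → ℝ} (hw : IsWeight w) : IsGauge wnorm hw.mul where
  add_le := wnorm_add_le
  smul_le := wnorm_smul_le
  mul_le := hw.wnorm_mul_le
  enorm_le Φ Ψ := by
    have := hw.enorm_mul_le Φ Ψ
    rwa [ofReal_norm, ofReal_norm] at this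
  comm := hw.mul_comm'

/-- The gauge of `Φ` given by the norm of the multiplication by `Φ` on `H¹`. -/
def mulNorm (Φ : L2C) : ℝ≥0∞ := ‖isWeight₁.mul Φ‖ₑ

/-- By associativity, Φ ↦ (multiplication by Φ) is an algebra homomorphism into the operators, whose
norm is submultiplicative. -/
theorem norm_mul_mul_le (Φ Ψ : L2C) :
    ‖isWeight₁.mul (isWeight₁.mul Φ Ψ)‖ ≤ ‖isWeight₁.mul Φ‖ * ‖isWeight₁.mul Ψ‖ := by
  have : isWeight₁.mul (isWeight₁.mul Φ Ψ) = isWeight₁.mul Φ ∘L isWeight₁.mul Ψ := by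
    ext1 Θ; exact isWeight₁.mul_assoc' Φ Ψ Θ
  rw [this]
  exact ContinuousLinearMap.opNorm_comp_le _ _

theorem isGauge_mulNorm : IsGauge mulNorm isWeight₁.mul where
  add_le Φ Ψ := by unfold mulNorm; rw [map_add]; exact enorm_add_le (isWeight₁.mul Φ) (isWeight₁.mul Ψ)
  smul_le r Φ := by unfold mulNorm; rw [map_smul, enorm_smul]
  mul_le Φ Ψ := by
    unfold mulNorm
    rw [mul_assoc]
    refine le_trans ?_ (le_mul_of_one_le_left zero_le (by norm_num))
    rw [← ofReal_norm, ← ofReal_norm, ← ofReal_norm, ← ENNReal.ofReal_mul (norm_nonneg _)]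
    exact ENNReal.ofReal_le_ofReal (norm_mul_mul_le Φ Ψ)
  enorm_le Φ Ψ := by
    unfold mulNorm
    rw [mul_assoc]
    refine le_trans ?_ (le_mul_of_one_le_left zero_le (by norm_num))
    exact ContinuousLinearMap.le_opENorm _ _
  comm := isWeight₁.mul_comm'

/-- Two gauges are needed. The L¹ gauge survives Fourier multipliers but may be infinite, in
particular no finiteness is known for J^(-1/2) - 1. The multiplication gauge is finite and
continuous, which suits functions produced by the implicit function theorem. This inequality passes
from the first to the second. -/
theorem mulNorm_le_wnorm (Φ : L2C) : mulNorm Φ ≤ 2 * wnorm Φ := by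
  unfold mulNorm
  by_cases h : wnorm Φ = ⊤
  · simp [h]
  have h3 : ‖isWeight₁.mul Φ‖ ≤ 2 * (wnorm Φ).toReal := by
    refine ContinuousLinearMap.opNorm_le_bound _ (by positivity) fun Ψ => ?_
    have h2 := isWeight₁.enorm_mul_le Φ Ψ
    rw [← ENNReal.ofReal_toReal h] at h2
    exact le_of_ofReal_le_two_mul ENNReal.toReal_nonneg (norm_nonneg _) h2
  rw [← ofReal_norm]
  refine (ENNReal.ofReal_le_ofReal h3).trans_eq ?_
  rw [ENNReal.ofReal_mul (by norm_num), ENNReal.ofReal_toReal h, ENNReal.ofReal_ofNat]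

/-- The map `h` vanishes to order `n` at `0`, in the gauge `ν`. -/
structure VanishesToOrder (ν : L2C → ℝ≥0∞) (n : ℕ) (h : H2 → L2C) : Prop where
  contDiffAt : ContDiffAt ℝ ω h 0
  bound : ∃ C : ℝ, 0 ≤ C ∧ ∀ᶠ U in 𝓝 (0 : H2), ∀ t : ℝ, 0 ≤ t → t ≤ 1 →
    wnorm (weightedL U) ≤ ENNReal.ofReal t →
      ν (h U) ≤ ENNReal.ofReal (C * t ^ n) ∧ ‖fderiv ℝ h U‖ ≤ C * t ^ (n - 1)

theorem _root_.ContDiffAt.eventually_differentiableAt {E F : Type*} [NormedAddCommGroup E]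
    [NormedSpace ℝ E] [NormedAddCommGroup F] [NormedSpace ℝ F] {f : E → F} {x : E}
    (hf : ContDiffAt ℝ ω f x) : ∀ᶠ y in 𝓝 x, DifferentiableAt ℝ f y := by
  have h1 : ContDiffAt ℝ 1 f x := hf.of_le le_top
  filter_upwards [h1.eventually (by simp)] with y hy using hy.differentiableAt (by simp)

namespace VanishesToOrder

variable {ν : L2C → ℝ≥0∞} {m : L2C →L[ℝ] L2C →L[ℝ] L2C} {n k : ℕ} {f h : H2 → L2C}

theorem mono (hh : VanishesToOrder ν n h) (hk : k ≤ n) : VanishesToOrder ν k h := by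
  obtain ⟨C, hC, H⟩ := hh.bound
  refine ⟨hh.contDiffAt, C, hC, ?_⟩
  filter_upwards [H] with U hU t ht ht1 hw
  obtain ⟨h1, h2⟩ := hU t ht ht1 hw
  have a := pow_le_pow_of_le_one ht ht1 hk
  have b := pow_le_pow_of_le_one ht ht1 (Nat.sub_le_sub_right hk 1)
  exact ⟨h1.trans (ENNReal.ofReal_le_ofReal (by gcongr)), h2.trans (by gcongr)⟩

theorem add (hν : IsGauge ν m) (hf : VanishesToOrder ν n f) (hh : VanishesToOrder ν n h) :
    VanishesToOrder ν n (fun U => f U + h U) := by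
  obtain ⟨C, hC, H⟩ := hf.bound
  obtain ⟨C', hC', H'⟩ := hh.bound
  refine ⟨hf.contDiffAt.add hh.contDiffAt, C + C', by positivity, ?_⟩
  filter_upwards [H, H', hf.contDiffAt.eventually_differentiableAt,
    hh.contDiffAt.eventually_differentiableAt] with U hU hU' df dh t ht ht1 hw
  obtain ⟨h1, h2⟩ := hU t ht ht1 hw
  obtain ⟨h3, h4⟩ := hU' t ht ht1 hw
  constructor
  · refine (hν.add_le _ _).trans ((add_le_add h1 h3).trans_eq ?_)
    rw [← ENNReal.ofReal_add (by positivity) (by positivity), add_mul]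
  · rw [fderiv_fun_add df dh, add_mul]
    exact (norm_add_le _ _).trans (add_le_add h2 h4)

theorem const_smul (hν : IsGauge ν m) (r : ℝ) (hf : VanishesToOrder ν n f) :
    VanishesToOrder ν n (fun U => r • f U) := by
  obtain ⟨C, hC, H⟩ := hf.bound
  refine ⟨hf.contDiffAt.const_smul r, |r| * C, by positivity, ?_⟩
  filter_upwards [H, hf.contDiffAt.eventually_differentiableAt] with U hU df t ht ht1 hw
  obtain ⟨h1, h2⟩ := hU t ht ht1 hw
  constructor
  · refine (hν.smul_le _ _).trans ((mul_le_mul_right h1 _).trans_eq ?_)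
    rw [← ofReal_norm, ← ENNReal.ofReal_mul (norm_nonneg _), norm_eq_abs, mul_assoc]
  · rw [fderiv_fun_const_smul df, norm_smul, norm_eq_abs, mul_assoc]
    gcongr

theorem sub (hν : IsGauge ν m) (hf : VanishesToOrder ν n f) (hh : VanishesToOrder ν n h) :
    VanishesToOrder ν n (fun U => f U - h U) := by
  simpa [sub_eq_add_neg] using hf.add hν (hh.const_smul hν (-1))

theorem _root_.Babenko.IsGauge.norm_le (hν : IsGauge ν m) {Φ Ψ : L2C} {c : ℝ} (hc : 0 ≤ c)
    (h : ν Φ ≤ ENNReal.ofReal c) : ‖m Φ Ψ‖ ≤ 2 * c * ‖Ψ‖ := by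
  have h1 := (hν.enorm_le Φ Ψ).trans (mul_le_mul_left (mul_le_mul_right h 2) _)
  rw [← ofReal_norm, ← ofReal_norm] at h1
  exact le_of_ofReal_le_two_mul hc (norm_nonneg _) h1

theorem _root_.Babenko.hasFDerivAt_mul (m : L2C →L[ℝ] L2C →L[ℝ] L2C) {U : H2}
    (df : DifferentiableAt ℝ f U) (dh : DifferentiableAt ℝ h U) :
    HasFDerivAt (fun U => m (f U) (h U))
      (m (f U) ∘L fderiv ℝ h U + m.flip (h U) ∘L fderiv ℝ f U) U := by
  have := m.hasFDerivAt_of_bilinear df.hasFDerivAt dh.hasFDerivAt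
  exact this

/-- Leibniz' rule: in each term the undifferentiated factor is measured by the gauge and the
differentiated one in L². -/
theorem mul (hν : IsGauge ν m) (hf : VanishesToOrder ν n f) (hh : VanishesToOrder ν k h) :
    VanishesToOrder ν (n + k) (fun U => m (f U) (h U)) := by
  obtain ⟨C, hC, H⟩ := hf.bound
  obtain ⟨C', hC', H'⟩ := hh.bound
  refine ⟨(m.contDiff.contDiffAt.comp (0 : H2) hf.contDiffAt).clm_apply hh.contDiffAt,
    4 * C * C', by positivity, ?_⟩
  filter_upwards [H, H', hf.contDiffAt.eventually_differentiableAt,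
    hh.contDiffAt.eventually_differentiableAt] with U hU hU' df dh t ht ht1 hw
  obtain ⟨h1, h2⟩ := hU t ht ht1 hw
  obtain ⟨h3, h4⟩ := hU' t ht ht1 hw
  constructor
  · refine (hν.mul_le _ _).trans ((mul_le_mul' (mul_le_mul_right h1 2) h3).trans ?_)
    rw [← ENNReal.ofReal_ofNat 2, ← ENNReal.ofReal_mul (by norm_num),
      ← ENNReal.ofReal_mul (by positivity)]
    refine ENNReal.ofReal_le_ofReal ?_
    have : 0 ≤ C * C' * t ^ (n + k) := by positivity
    rw [pow_add] at *
    nlinarith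
  · rw [(hasFDerivAt_mul m df dh).fderiv]
    refine ContinuousLinearMap.opNorm_le_bound _ (by positivity) fun Z => ?_
    simp only [add_apply, ContinuousLinearMap.comp_apply,
      ContinuousLinearMap.flip_apply]
    rw [hν.comm (fderiv ℝ f U Z)]
    have i1 := (hν.norm_le (Ψ := fderiv ℝ h U Z) (by positivity) h1)
    have i2 := (hν.norm_le (Ψ := fderiv ℝ f U Z) (by positivity) h3)
    have i3 := (fderiv ℝ h U).le_of_opNorm_le h4 Z
    have i4 := (fderiv ℝ f U).le_of_opNorm_le h2 Z
    -- Subtraction is truncated: for k = 0 the left exponent is n and the right one n - 1, which is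
    -- harmless because t ≤ 1.
    have e1 : t ^ n * t ^ (k - 1) ≤ t ^ (n + k - 1) := by
      rw [← pow_add]; exact pow_le_pow_of_le_one ht ht1 (by omega)
    have e2 : t ^ k * t ^ (n - 1) ≤ t ^ (n + k - 1) := by
      rw [← pow_add]; exact pow_le_pow_of_le_one ht ht1 (by omega)
    calc _ ≤ 2 * (C * t ^ n) * (C' * t ^ (k - 1) * ‖Z‖) + 2 * (C' * t ^ k) * (C * t ^ (n - 1) * ‖Z‖) :=
          (norm_add_le _ _).trans (add_le_add (i1.trans (by gcongr)) (i2.trans (by gcongr)))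
      _ = 2 * C * C' * ‖Z‖ * (t ^ n * t ^ (k - 1)) + 2 * C * C' * ‖Z‖ * (t ^ k * t ^ (n - 1)) := by ring
      _ ≤ 2 * C * C' * ‖Z‖ * t ^ (n + k - 1) + 2 * C * C' * ‖Z‖ * t ^ (n + k - 1) := by gcongr
      _ = _ := by ring

theorem clm (L : L2C →L[ℝ] L2C) {c : ℝ} (hL : ∀ Φ, wnorm (L Φ) ≤ ENNReal.ofReal c * wnorm Φ)
    (hf : VanishesToOrder wnorm n f) : VanishesToOrder wnorm n (fun U => L (f U)) := by
  obtain ⟨C, hC, H⟩ := hf.bound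
  refine ⟨L.contDiff.contDiffAt.comp (0 : H2) hf.contDiffAt, (|c| + ‖L‖) * C, by positivity, ?_⟩
  filter_upwards [H, hf.contDiffAt.eventually_differentiableAt] with U hU df t ht ht1 hw
  obtain ⟨h1, h2⟩ := hU t ht ht1 hw
  constructor
  · refine (hL _).trans ((mul_le_mul' (ENNReal.ofReal_le_ofReal (le_abs_self c)) h1).trans ?_)
    rw [← ENNReal.ofReal_mul (abs_nonneg _)]
    refine ENNReal.ofReal_le_ofReal ?_
    rw [add_mul, add_mul, mul_assoc]
    exact le_add_of_nonneg_right (by positivity)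
  · have : fderiv ℝ (fun U => L (f U)) U = L ∘L fderiv ℝ f U :=
      (L.hasFDerivAt.comp U df.hasFDerivAt).fderiv
    rw [this]
    refine (ContinuousLinearMap.opNorm_comp_le _ _).trans ?_
    rw [add_mul, add_mul, mul_assoc ‖L‖]
    exact le_add_of_nonneg_of_le (by positivity) (by gcongr)

theorem weighted : VanishesToOrder wnorm 1 weightedL := by
  refine ⟨weightedL.contDiff.contDiffAt, 1, zero_le_one, ?_⟩
  filter_upwards with U t ht ht1 hw
  refine ⟨by simpa using hw, ?_⟩
  rw [weightedL.fderiv]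
  exact ContinuousLinearMap.opNorm_le_bound _ (by positivity) fun Z => by simp [norm_weightedL]

theorem to_mulNorm (hf : VanishesToOrder wnorm n f) : VanishesToOrder mulNorm n f := by
  obtain ⟨C, hC, H⟩ := hf.bound
  refine ⟨hf.contDiffAt, 2 * C, by positivity, ?_⟩
  filter_upwards [H] with U hU t ht ht1 hw
  obtain ⟨h1, h2⟩ := hU t ht ht1 hw
  constructor
  · refine (mulNorm_le_wnorm _).trans ((mul_le_mul_right h1 2).trans_eq ?_)
    rw [← ENNReal.ofReal_ofNat 2, ← ENNReal.ofReal_mul (by norm_num), mul_assoc]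
  · exact h2.trans (by gcongr; linarith)

/-- Order 0 is just local boundedness, which continuity gives because the multiplication gauge is
itself continuous. -/
theorem of_contDiffAt (hf : ContDiffAt ℝ ω f 0) : VanishesToOrder mulNorm 0 f := by
  have h1 : ∀ᶠ U in 𝓝 (0 : H2), ‖isWeight₁.mul (f U)‖ < ‖isWeight₁.mul (f 0)‖ + 1 :=
    ((isWeight₁.mul.continuous.continuousAt.comp hf.continuousAt).norm).eventually_lt_const
      (by simp)
  have h2 : ∀ᶠ U in 𝓝 (0 : H2), ‖fderiv ℝ f U‖ < ‖fderiv ℝ f 0‖ + 1 :=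
    (hf.continuousAt_fderiv (by simp)).norm.eventually_lt_const (by simp)
  refine ⟨hf, (‖isWeight₁.mul (f 0)‖ + 1) + (‖fderiv ℝ f 0‖ + 1), by positivity, ?_⟩
  filter_upwards [h1, h2] with U a b t ht ht1 hw
  simp only [pow_zero, mul_one, zero_tsub]
  constructor
  · unfold mulNorm
    rw [← ofReal_norm]
    exact ENNReal.ofReal_le_ofReal (a.le.trans (le_add_of_nonneg_right (by positivity)))
  · exact b.le.trans (le_add_of_nonneg_left (by positivity))

theorem congr (hf : VanishesToOrder ν n f) (e : f =ᶠ[𝓝 0] h) : VanishesToOrder ν n h := by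
  obtain ⟨C, hC, H⟩ := hf.bound
  refine ⟨hf.contDiffAt.congr_of_eventuallyEq e.symm, C, hC, ?_⟩
  filter_upwards [H, e.eventuallyEq_nhds] with U hU he t ht ht1 hw
  rw [← he.eq_of_nhds, ← he.fderiv_eq]
  exact hU t ht ht1 hw

/-- A small solution of `2 h = p + h²` vanishes to the same order as `p`. -/
theorem of_two_smul_eq {p : H2 → L2C} (hp : VanishesToOrder mulNorm n p)
    (hh : ContDiffAt ℝ ω h 0) (h0 : h 0 = 0)
    (e : ∀ᶠ U in 𝓝 (0 : H2), (2 : ℝ) • h U = p U + isWeight₁.mul (h U) (h U)) :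
    VanishesToOrder mulNorm n h := by
  obtain ⟨C, hC, H⟩ := hp.bound
  -- With this threshold h² is absorbed into 2h, and in the differentiated equation 2h' = p' + 2hh'
  -- the last term is absorbed as well, so the constant of p serves for h.
  have hs : ∀ᶠ U in 𝓝 (0 : H2), ‖isWeight₁.mul (h U)‖ < 1 / 2 :=
    ((isWeight₁.mul.continuous.continuousAt.comp hh.continuousAt).norm).eventually_lt_const
      (by simp [h0])
  refine ⟨hh, C, hC, ?_⟩
  filter_upwards [H, hs, e.eventually_nhds, hp.contDiffAt.eventually_differentiableAt,
    hh.eventually_differentiableAt] with U hU hs he dp dh t ht ht1 hw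
  obtain ⟨h1, h2⟩ := hU t ht ht1 hw
  constructor
  · unfold mulNorm at h1 ⊢
    rw [← ofReal_norm] at h1 ⊢
    have h1 := (ENNReal.ofReal_le_ofReal_iff (by positivity)).1 h1
    refine ENNReal.ofReal_le_ofReal ?_
    have e1 := congrArg (fun Φ => ‖isWeight₁.mul Φ‖) he.self_of_nhds
    simp only [map_smul, map_add, norm_smul, Real.norm_ofNat] at e1
    have e2 := norm_add_le (isWeight₁.mul (p U)) (isWeight₁.mul (isWeight₁.mul (h U) (h U)))
    have e3 := norm_mul_mul_le (h U) (h U)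
    nlinarith [norm_nonneg (isWeight₁.mul (h U))]
  · refine ContinuousLinearMap.opNorm_le_bound _ (by positivity) fun Z => ?_
    have e1 : HasFDerivAt (fun U => (2 : ℝ) • h U) ((2 : ℝ) • fderiv ℝ h U) U :=
      dh.hasFDerivAt.fun_const_smul 2
    have e2 := dp.hasFDerivAt.add (hasFDerivAt_mul isWeight₁.mul dh dh)
    have e3 := e1.unique (e2.congr_of_eventuallyEq he)
    have e4 := congrArg (fun B => B Z) e3
    simp only [add_apply, ContinuousLinearMap.comp_apply,
      ContinuousLinearMap.flip_apply, smul_apply] at e4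
    rw [isWeight₁.mul_comm' (fderiv ℝ h U Z)] at e4
    have e5 := (fderiv ℝ p U).le_of_opNorm_le h2 Z
    have e6 := (isWeight₁.mul (h U)).le_opNorm (fderiv ℝ h U Z)
    have e7 := congrArg norm e4
    rw [norm_smul, Real.norm_ofNat] at e7
    have e8 := norm_add_le (fderiv ℝ p U Z) (isWeight₁.mul (h U) (fderiv ℝ h U Z) +
      isWeight₁.mul (h U) (fderiv ℝ h U Z))
    have e9 := norm_add_le (isWeight₁.mul (h U) (fderiv ℝ h U Z)) (isWeight₁.mul (h U) (fderiv ℝ h U Z))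
    nlinarith [norm_nonneg (fderiv ℝ h U Z)]

end VanishesToOrder

end
end Babenko

namespace Babenko
noncomputable section

open scoped Topology ContDiff

/-! ### Smooth dependence of fixed points on a parameter -/

section FixedPoint

theorem exists_fixedPoint_of_norm_sub_le {F : Type*} [NormedAddCommGroup F] [CompleteSpace F]
    {K : F → F} {r : ℝ} (hr : 0 < r)
    (hK : ∀ y y', ‖y‖ ≤ r → ‖y'‖ ≤ r → ‖K y - K y'‖ ≤ 1 / 2 * ‖y - y'‖) (h0 : ‖K 0‖ < r / 2) :
    ∃ y, ‖y‖ ≤ 2 * ‖K 0‖ ∧ y = K y := by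
  have key : ∀ y, ‖y‖ ≤ r → ‖K y‖ ≤ 1 / 2 * ‖y‖ + ‖K 0‖ := fun y hy => by
    have h1 := hK y 0 hy (by simpa using hr.le)
    have h2 := norm_sub_norm_le (K y) (K 0)
    rw [sub_zero] at h1
    linarith
  have hmaps : Set.MapsTo K (Metric.closedBall 0 r) (Metric.closedBall 0 r) := by
    intro y hy
    have hy : ‖y‖ ≤ r := by simpa using hy
    have := key y hy
    simp only [mem_closedBall_zero_iff]
    linarith
  have hc : ContractingWith (1 / 2) (hmaps.restrict K _ _) := by
    refine ⟨by rw [← NNReal.coe_lt_coe]; norm_num, LipschitzWith.of_dist_le_mul fun a b => ?_⟩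
    have := hK a b (mem_closedBall_zero_iff.1 a.2) (mem_closedBall_zero_iff.1 b.2)
    simpa [Subtype.dist_eq, dist_eq_norm] using this
  obtain ⟨y, hy, hfix, -, -⟩ := hc.exists_fixedPoint' (Metric.isClosed_closedBall.isComplete) hmaps
    (x := 0) (by simpa using hr.le) (edist_ne_top _ _)
  have hy : ‖y‖ ≤ r := by simpa using hy
  have hfix : K y = y := hfix
  refine ⟨y, ?_, hfix.symm⟩
  have := key y hy
  rw [hfix] at this
  linarith

variable {E F : Type*} [NormedAddCommGroup E] [NormedSpace ℝ E]
  [NormedAddCommGroup F] [NormedSpace ℝ F]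

theorem norm_sub_le_of_norm_fderiv_inr_le {G : E × F → F} {x : E} {r : ℝ}
    (hG : ∀ y, ‖y‖ ≤ r → DifferentiableAt ℝ G (x, y))
    (hL : ∀ y, ‖y‖ ≤ r → ‖fderiv ℝ G (x, y) ∘L .inr ℝ E F‖ ≤ 1 / 2) {y y' : F}
    (hy : ‖y‖ ≤ r) (hy' : ‖y'‖ ≤ r) : ‖G (x, y) - G (x, y')‖ ≤ 1 / 2 * ‖y - y'‖ := by
  refine (convex_closedBall (0 : F) r).norm_image_sub_le_of_norm_hasFDerivWithin_le
    (f := fun y => G (x, y)) (f' := fun y => fderiv ℝ G (x, y) ∘L .inr ℝ E F) ?_ ?_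
    (by simpa using hy') (by simpa using hy)
  · intro z hz
    have hz' : ‖z‖ ≤ r := by simpa using hz
    exact ((hG z hz').hasFDerivAt.comp z (hasFDerivAt_prodMk_right x z)).hasFDerivWithinAt
  · intro z hz
    exact hL z (by simpa using hz)

variable [CompleteSpace F]

theorem isInvertible_id_sub {A : F →L[ℝ] F} (hA : ‖A‖ < 1) :
    (ContinuousLinearMap.id ℝ F - A).IsInvertible := by
  obtain ⟨u, hu⟩ := isUnit_one_sub_of_norm_lt_one hA
  exact ⟨ContinuousLinearEquiv.unitsEquiv ℝ F u, by ext x; simpa using congrArg (fun B => B x) hu⟩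

variable [CompleteSpace E]

/-- For each x the map is a contraction of the closed r-ball, with a fixed point strictly inside it.
Uniqueness in the ball identifies this fixed point near x with the implicit function through (x, u
x), which is smooth. -/
theorem exists_contDiff_fixedPoint {G : E × F → F} {U : Set E} (hU : IsOpen U) {r : ℝ} (hr : 0 < r)
    (hG : ∀ x ∈ U, ∀ y, ‖y‖ ≤ r → ContDiffAt ℝ ∞ G (x, y))
    (hL : ∀ x ∈ U, ∀ y, ‖y‖ ≤ r → ‖fderiv ℝ G (x, y) ∘L .inr ℝ E F‖ ≤ 1 / 2)
    (h0 : ∀ x ∈ U, ‖G (x, 0)‖ < r / 2) :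
    ∃ u : E → F, ∀ x ∈ U, ‖u x‖ ≤ 2 * ‖G (x, 0)‖ ∧ u x = G (x, u x) ∧
      (∀ y, ‖y‖ ≤ r → y = G (x, y) → y = u x) ∧ ContDiffAt ℝ ∞ u x ∧
      ‖fderiv ℝ u x‖ ≤ 2 * ‖fderiv ℝ G (x, u x) ∘L .inl ℝ E F‖ := by
  classical
  have hdiff : ∀ x ∈ U, ∀ y, ‖y‖ ≤ r → DifferentiableAt ℝ G (x, y) := fun x hx y hy =>
    (hG x hx y hy).differentiableAt (by simp)
  have hlip : ∀ x ∈ U, ∀ y y', ‖y‖ ≤ r → ‖y'‖ ≤ r → ‖G (x, y) - G (x, y')‖ ≤ 1 / 2 * ‖y - y'‖ :=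
    fun x hx y y' hy hy' => norm_sub_le_of_norm_fderiv_inr_le (hdiff x hx) (hL x hx) hy hy'
  choose! u hu1 hu2 using fun x hx =>
    exists_fixedPoint_of_norm_sub_le (K := fun y => G (x, y)) hr (hlip x hx) (h0 x hx)
  have hur : ∀ x ∈ U, ‖u x‖ < r := fun x hx => by
    have := hu1 x hx; have := h0 x hx; linarith
  have huniq : ∀ x ∈ U, ∀ y, ‖y‖ ≤ r → y = G (x, y) → y = u x := by
    intro x hx y hy hyG
    have h1 := hlip x hx y (u x) hy (hur x hx).le
    rw [← hyG, ← hu2 x hx] at h1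
    have : ‖y - u x‖ = 0 := le_antisymm (by linarith) (norm_nonneg _)
    exact sub_eq_zero.1 (norm_eq_zero.1 this)
  refine ⟨u, fun x hx => ?_⟩
  have hGx := hG x hx (u x) (hur x hx).le
  have hcd : ContDiffAt ℝ ∞ u x := by
    -- The partial derivative of y - G(x, y) in y is the identity minus an operator of norm at most
    -- 1/2, hence invertible by a Neumann series.
    have hf : ContDiffAt ℝ ∞ (fun p : E × F => p.2 - G p) (x, u x) := contDiffAt_snd.sub hGx
    have hinv : (fderiv ℝ (fun p : E × F => p.2 - G p) (x, u x) ∘L .inr ℝ E F).IsInvertible := by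
      have e : fderiv ℝ (fun p : E × F => p.2 - G p) (x, u x) ∘L .inr ℝ E F =
          ContinuousLinearMap.id ℝ F - fderiv ℝ G (x, u x) ∘L .inr ℝ E F := by
        rw [fderiv_fun_sub differentiableAt_snd (hGx.differentiableAt (by simp)), fderiv_snd]
        ext y; simp
      rw [e]
      exact isInvertible_id_sub ((hL x hx _ (hur x hx).le).trans_lt (by norm_num))
    have hψ := hf.contDiffAt_implicitFunction (by simp) hinv
    have hψx := hf.implicitFunction_apply_self (by simp) hinv
    have hev := hf.eventually_apply_implicitFunction (by simp) hinv
    have hn : ∀ᶠ z in 𝓝 x, ‖hf.implicitFunction (by simp) hinv z‖ < r := by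
      refine hψ.continuousAt.norm.eventually_lt_const ?_
      change ‖hf.implicitFunction (by simp) hinv x‖ < r
      rw [show hf.implicitFunction (by simp) hinv x = u x from hψx]
      exact hur x hx
    refine hψ.congr_of_eventuallyEq ?_
    filter_upwards [hev, hn, hU.mem_nhds hx] with z h1 h2 h3
    refine (huniq z h3 _ h2.le ?_).symm
    rw [← sub_eq_zero, h1, ← hu2 x hx, sub_self]
  refine ⟨hu1 x hx, hu2 x hx, huniq x hx, hcd, ?_⟩
  have hdu : HasFDerivAt u (fderiv ℝ u x) x := (hcd.differentiableAt (by simp)).hasFDerivAt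
  have hcomp : HasFDerivAt (fun z => G (z, u z))
      (fderiv ℝ G (x, u x) ∘L (ContinuousLinearMap.id ℝ E).prod (fderiv ℝ u x)) x :=
    (hGx.differentiableAt (by simp)).hasFDerivAt.comp x ((hasFDerivAt_id x).prodMk hdu)
  have heq : fderiv ℝ u x =
      fderiv ℝ G (x, u x) ∘L (ContinuousLinearMap.id ℝ E).prod (fderiv ℝ u x) := by
    refine hdu.unique (hcomp.congr_of_eventuallyEq ?_)
    filter_upwards [hU.mem_nhds hx] with z hz using hu2 z hz
  -- From du = G_x + G_y du with ‖G_y‖ ≤ 1/2, the last term is absorbed on the left; this produces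
  -- the factor 2.
  have heq2 : fderiv ℝ u x = fderiv ℝ G (x, u x) ∘L .inl ℝ E F +
      (fderiv ℝ G (x, u x) ∘L .inr ℝ E F) ∘L fderiv ℝ u x := by
    conv_lhs => rw [heq]
    ext v
    simp [← map_add]
  have h1 := norm_add_le (fderiv ℝ G (x, u x) ∘L .inl ℝ E F)
    ((fderiv ℝ G (x, u x) ∘L .inr ℝ E F) ∘L fderiv ℝ u x)
  rw [← heq2] at h1
  have h2 := ContinuousLinearMap.opNorm_comp_le (fderiv ℝ G (x, u x) ∘L .inr ℝ E F) (fderiv ℝ u x)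
  have h3 := mul_le_mul_of_nonneg_right (hL x hx (u x) (hur x hx).le) (norm_nonneg (fderiv ℝ u x))
  linarith

end FixedPoint

end
end Babenko

/-! ### The abstract reduction with its estimates in ε -/

namespace Babenko
noncomputable section

open scoped Topology ContDiff ENNReal NNReal

section Reduction

variable {E F : Type*} [NormedAddCommGroup E] [NormedSpace ℝ E]
  [NormedAddCommGroup F] [NormedSpace ℝ F]

/-- The map whose fixed points in `y` are sought: a fixed nonlinearity `K`, and a linear
perturbation with small coefficients. -/
def perturbedMap (K : E × F → F) (S : E → F) (L₁ L₂ : F →L[ℝ] F) (a b : ℝ) (p : E × F) : F :=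
  K p + (a • L₁ (S p.1 + p.2) + b • L₂ (S p.1 + p.2))

variable {K : E × F → F} {S : E → F} {L₁ L₂ : F →L[ℝ] F} {a b : ℝ}

theorem contDiffAt_perturbedMap {p : E × F} (hK : ContDiffAt ℝ ∞ K p) (hS : ContDiffAt ℝ ∞ S p.1) :
    ContDiffAt ℝ ∞ (perturbedMap K S L₁ L₂ a b) p := by
  have h : ContDiffAt ℝ ∞ (fun p : E × F => S p.1 + p.2) p :=
    (hS.comp p contDiffAt_fst).add contDiffAt_snd
  exact hK.add (((L₁.contDiff.contDiffAt.comp p h).const_smul a).add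
    ((L₂.contDiff.contDiffAt.comp p h).const_smul b))

theorem fderiv_perturbedMap {p : E × F} (hK : DifferentiableAt ℝ K p)
    (hS : DifferentiableAt ℝ S p.1) :
    fderiv ℝ (perturbedMap K S L₁ L₂ a b) p = fderiv ℝ K p + (a • L₁ + b • L₂) ∘L
      (fderiv ℝ S p.1 ∘L .fst ℝ E F + .snd ℝ E F) := by
  have h : HasFDerivAt (fun p : E × F => S p.1 + p.2)
      (fderiv ℝ S p.1 ∘L .fst ℝ E F + .snd ℝ E F) p :=
    (hS.hasFDerivAt.comp p hasFDerivAt_fst).add hasFDerivAt_snd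
  have h2 := hK.hasFDerivAt.add ((a • L₁ + b • L₂).hasFDerivAt.comp p h)
  exact h2.fderiv

theorem norm_perturbation_le {A ε : ℝ} (ha : |a| ≤ A * ε ^ 2) (hb : |b| ≤ A * ε ^ 2) :
    ‖a • L₁ + b • L₂‖ ≤ A * (‖L₁‖ + ‖L₂‖) * ε ^ 2 := by
  refine (norm_add_le _ _).trans ?_
  rw [norm_smul, norm_smul, norm_eq_abs, norm_eq_abs]
  nlinarith [mul_le_mul_of_nonneg_right ha (norm_nonneg L₁),
    mul_le_mul_of_nonneg_right hb (norm_nonneg L₂)]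

theorem norm_comp_inl_le (A : E × F →L[ℝ] F) : ‖A ∘L .inl ℝ E F‖ ≤ ‖A‖ :=
  ContinuousLinearMap.opNorm_le_bound _ (norm_nonneg _) fun x => by
    simpa using A.le_opNorm (x, 0)

theorem norm_comp_inr_le (A : E × F →L[ℝ] F) : ‖A ∘L .inr ℝ E F‖ ≤ ‖A‖ :=
  ContinuousLinearMap.opNorm_le_bound _ (norm_nonneg _) fun x => by
    simpa using A.le_opNorm (0, x)

/-- Order of choice: R₂ from the radii where the data are controlled, then R₁ small against R₂, so
that the scaled ball lies in the norm ball of radius R₂, then ε₀. The bounds 1/4 are the shares of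
the final derivative estimate. -/
theorem exists_radii {ρ r B c d : ℝ} (hρ : 0 < ρ) (hr : 0 < r) (hB : 0 ≤ B) (hc : 0 ≤ c)
    (hd : 0 ≤ d) :
    ∃ R₁ R₂ ε₀ : ℝ, 0 < R₁ ∧ 0 < R₂ ∧ 0 < ε₀ ∧ R₁ ≤ 1 ∧ R₁ ≤ r ∧ R₂ ≤ r / 2 ∧ R₂ ≤ ρ / 2 ∧
      B * R₁ < R₂ ∧ B * R₁ ≤ 1 ∧ c * R₁ ≤ 1 / 4 ∧ ε₀ ≤ 1 ∧ d * ε₀ ≤ 1 / 4 := by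
  obtain ⟨R₂, hR₂⟩ : ∃ R₂, R₂ = min ρ r / 2 := ⟨_, rfl⟩
  have hR₂0 : 0 < R₂ := by rw [hR₂]; positivity
  obtain ⟨R₁, hR₁⟩ : ∃ R₁, R₁ = min (min 1 r) (min (min (R₂ / (2 * (B + 1))) (1 / (B + 1)))
    (1 / (4 * (c + 1)))) := ⟨_, rfl⟩
  have hR₁0 : 0 < R₁ := by rw [hR₁]; positivity
  have h1 : R₁ ≤ R₂ / (2 * (B + 1)) := by
    rw [hR₁]; exact (min_le_right _ _).trans ((min_le_left _ _).trans (min_le_left _ _))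
  have h2 : R₁ ≤ 1 / (B + 1) := by
    rw [hR₁]; exact (min_le_right _ _).trans ((min_le_left _ _).trans (min_le_right _ _))
  have h3 : R₁ ≤ 1 / (4 * (c + 1)) := by
    rw [hR₁]; exact (min_le_right _ _).trans (min_le_right _ _)
  rw [le_div_iff₀ (by positivity)] at h1 h2 h3
  have h4 : min 1 (1 / (4 * (d + 1))) ≤ 1 / (4 * (d + 1)) := min_le_right _ _
  rw [le_div_iff₀ (by positivity)] at h4
  refine ⟨R₁, R₂, min 1 (1 / (4 * (d + 1))), hR₁0, hR₂0, by positivity, ?_, ?_, ?_, ?_, ?_, ?_, ?_,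
    min_le_left _ _, ?_⟩
  · rw [hR₁]; exact (min_le_left _ _).trans (min_le_left _ _)
  · rw [hR₁]; exact (min_le_left _ _).trans (min_le_right _ _)
  · rw [hR₂]; gcongr; exact min_le_right _ _
  · rw [hR₂]; gcongr; exact min_le_left _ _
  · nlinarith
  · linarith
  · linarith
  · have : 0 ≤ min 1 (1 / (4 * (d + 1))) := by positivity
    linarith

/-- Quantitative smallness of the data near `0`. -/
theorem exists_uniform_radius (hK : ContDiffAt ℝ ω K 0) (hK' : fderiv ℝ K 0 = 0)
    (hS : ContDiffAt ℝ ω S 0) (hS' : fderiv ℝ S 0 = 0) :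
    ∃ Λ : ℝ, 0 ≤ Λ ∧ ∃ ρ > 0, (∀ p, ‖p‖ ≤ ρ → ContDiffAt ℝ ∞ K p ∧ ‖fderiv ℝ K p‖ ≤ 1 / 4 ∧
      ∀ p', ‖p'‖ ≤ ρ → ‖fderiv ℝ K p - fderiv ℝ K p'‖ ≤ Λ * ‖p - p'‖) ∧
      ∀ x, ‖x‖ ≤ ρ → ContDiffAt ℝ ∞ S x ∧ ‖fderiv ℝ S x‖ ≤ 1 := by
  obtain ⟨Λ, s, hs, hlip⟩ := (hK.fderiv_right (m := 1) (by simp)).exists_lipschitzOnWith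
  have h1 : ∀ᶠ p in 𝓝 (0 : E × F), ‖fderiv ℝ K p‖ < 1 / 4 :=
    (hK.continuousAt_fderiv (by simp)).norm.eventually_lt_const (by simp [hK'])
  have h2 : ∀ᶠ x in 𝓝 (0 : E), ‖fderiv ℝ S x‖ < 1 :=
    (hS.continuousAt_fderiv (by simp)).norm.eventually_lt_const (by simp [hS'])
  have h3 := hK.eventually (by simp)
  have h4 := hS.eventually (by simp)
  obtain ⟨ρ₁, hρ₁, H1⟩ := Metric.eventually_nhds_iff_ball.1 ((h1.and h3).and hs)
  obtain ⟨ρ₂, hρ₂, H2⟩ := Metric.eventually_nhds_iff_ball.1 (h2.and h4)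
  have hlt : min ρ₁ ρ₂ / 2 < min ρ₁ ρ₂ := half_lt_self (by positivity)
  have m1 : ∀ p : E × F, ‖p‖ ≤ min ρ₁ ρ₂ / 2 → p ∈ Metric.ball 0 ρ₁ := fun p hp => by
    rw [mem_ball_zero_iff]; exact hp.trans_lt (hlt.trans_le (min_le_left _ _))
  have m2 : ∀ x : E, ‖x‖ ≤ min ρ₁ ρ₂ / 2 → x ∈ Metric.ball 0 ρ₂ := fun x hx => by
    rw [mem_ball_zero_iff]; exact hx.trans_lt (hlt.trans_le (min_le_right _ _))
  refine ⟨Λ, Λ.2, min ρ₁ ρ₂ / 2, by positivity, fun p hp => ⟨?_, ?_, fun p' hp' => ?_⟩,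
    fun x hx => ⟨?_, ?_⟩⟩
  · exact (H1 p (m1 p hp)).1.2.of_le le_top
  · exact (H1 p (m1 p hp)).1.1.le
  · simpa [dist_eq_norm] using hlip.dist_le_mul p (H1 p (m1 p hp)).2 p' (H1 p' (m1 p' hp')).2
  · exact (H2 x (m2 x hx)).2.of_le le_top
  · exact (H2 x (m2 x hx)).1.le

variable [CompleteSpace E] [CompleteSpace F]

-- Write n for the scaled norm of x. As t ≤ B√ε n, the hypothesis `hest` makes the x-derivative at y
-- = 0 equal to O(εn²) from K plus O(ε²n) from the linear perturbation. The mean value theorem and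
-- ‖x‖ ≤ Bn turn this into G(x, 0) = O(εn²), which the fixed point inherits.
set_option maxHeartbeats 1000000 in
theorem exists_fixedPoint_perturbedMap (hK : ContDiffAt ℝ ω K 0) (hK0 : K 0 = 0)
    (hK' : fderiv ℝ K 0 = 0) (hS : ContDiffAt ℝ ω S 0) (hS0 : S 0 = 0) (hS' : fderiv ℝ S 0 = 0)
    {A B D : ℝ} (hA : 0 ≤ A) (hB : 0 ≤ B) (hD : 0 ≤ D) (wn : E → ℝ≥0∞) (nE : ℝ → E → ℝ)
    (hest : ∀ᶠ x in 𝓝 (0 : E), ∀ t : ℝ, 0 ≤ t → t ≤ 1 → wn x ≤ ENNReal.ofReal t →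
      ‖fderiv ℝ (fun z => K (z, 0)) x‖ ≤ D * t ^ 2 ∧ ‖fderiv ℝ S x‖ ≤ D * t)
    (hn0 : ∀ ε x, 0 ≤ nE ε x) (hn1 : ∀ ε x (s : ℝ), nE ε (s • x) = |s| * nE ε x)
    (hwn : ∀ ε x, 0 < ε → wn x ≤ ENNReal.ofReal (B * √ε * nE ε x))
    (hEn : ∀ ε x, 0 < ε → ‖x‖ ≤ B * nE ε x) :
    ∃ C > 0, ∀ r > 0, ∃ R₁ > 0, R₁ ≤ r ∧ ∃ R₂ > 0, R₂ ≤ r ∧ ∃ ε₀ > 0, ε₀ ≤ 1 ∧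
      ∀ ε : ℝ, 0 < ε → ε ≤ ε₀ →
      ∀ a b : ℝ, |a| ≤ A * ε ^ 2 → |b| ≤ A * ε ^ 2 →
      ∃ u : E → F, ∀ x, nE ε x ≤ R₁ → ‖x‖ ≤ r ∧ ‖u x‖ ≤ R₂ ∧
        u x = perturbedMap K S L₁ L₂ a b (x, u x) ∧
        (∀ y, ‖y‖ ≤ R₂ → y = perturbedMap K S L₁ L₂ a b (x, y) → y = u x) ∧
        ContDiffAt ℝ ∞ u x ∧ ‖u x‖ ≤ C * ε * nE ε x ^ 2 ∧ ‖fderiv ℝ u x‖ ≤ ε * nE ε x := by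
  obtain ⟨Λ, hΛ, ρ₁, hρ₁, HK, HS⟩ := exists_uniform_radius hK hK' hS hS'
  obtain ⟨ρ₂, hρ₂, Hest⟩ := Metric.eventually_nhds_iff.1 hest
  obtain ⟨N, hN⟩ : ∃ N, N = A * (‖L₁‖ + ‖L₂‖) := ⟨_, rfl⟩
  have hN0 : 0 ≤ N := by rw [hN]; positivity
  obtain ⟨P, hP⟩ : ∃ P, P = D * B ^ 2 := ⟨_, rfl⟩
  obtain ⟨Q, hQ⟩ : ∃ Q, Q = N * (D * B) := ⟨_, rfl⟩
  have hP0 : 0 ≤ P := by rw [hP]; positivity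
  have hQ0 : 0 ≤ Q := by rw [hQ]; positivity
  obtain ⟨C₁, hC₁⟩ : ∃ C₁, C₁ = (P + Q) * B := ⟨_, rfl⟩
  have hC₁0 : 0 ≤ C₁ := by rw [hC₁]; positivity
  -- C is fixed before r, so it does not depend on the radii. The factor 2 comes from ‖u x‖ ≤ 2‖G(x,
  -- 0)‖, and the 1 only secures positivity.
  refine ⟨2 * C₁ + 1, by positivity, fun r hr => ?_⟩
  obtain ⟨R₁, R₂, ε₀, hR₁0, hR₂0, hε₀0, hR₁1, hR₁r, hR₂r, hR₂ρ, hR₁B, hR₁B1, hR₁P, hε₀1, hε₀Q⟩ :=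
    exists_radii (B := B) (c := P + 2 * Λ * C₁) (d := Q + N) (lt_min hρ₁ hρ₂) hr hB
      (by positivity) (by positivity)
  have hR₂ρ₁ : R₂ ≤ ρ₁ / 2 := hR₂ρ.trans (by gcongr; exact min_le_left _ _)
  have hR₂ρ₂ : R₂ ≤ ρ₂ / 2 := hR₂ρ.trans (by gcongr; exact min_le_right _ _)
  refine ⟨R₁, hR₁0, hR₁r, R₂, hR₂0, by linarith, ε₀, hε₀0, hε₀1, ?_⟩
  intro ε hε hεε₀ a b ha hb
  have hε1 : ε ≤ 1 := hεε₀.trans hε₀1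
  have hεQ : (Q + N) * ε ≤ 1 / 4 := by nlinarith
  have hpert : ‖a • L₁ + b • L₂‖ ≤ N * ε ^ 2 := hN ▸ norm_perturbation_le ha hb
  have hpert' : ‖a • L₁ + b • L₂‖ ≤ 1 / 4 := hpert.trans (by nlinarith [mul_nonneg hN0 hε.le, mul_nonneg hQ0 hε.le])
  obtain ⟨G, hG⟩ : ∃ G, G = perturbedMap K S L₁ L₂ a b := ⟨_, rfl⟩
  rw [← hG]
  have hpρ : ∀ x y, ‖x‖ < R₂ → ‖y‖ ≤ R₂ → ‖((x, y) : E × F)‖ ≤ ρ₁ := fun x y hx hy => by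
    rw [Prod.norm_mk]; exact max_le (by linarith) (by linarith)
  have hxρ : ∀ x : E, ‖x‖ < R₂ → ‖x‖ ≤ ρ₁ := fun x hx => by linarith
  have hGsm : ∀ x ∈ Metric.ball (0 : E) R₂, ∀ y, ‖y‖ ≤ R₂ → ContDiffAt ℝ ∞ G (x, y) := by
    intro x hx y hy
    have hx : ‖x‖ < R₂ := by simpa using hx
    rw [hG]
    exact contDiffAt_perturbedMap (HK _ (hpρ x y hx hy)).1 (HS x (hxρ x hx)).1
  have hfd : ∀ x y, ‖x‖ < R₂ → ‖y‖ ≤ R₂ → fderiv ℝ G (x, y) = fderiv ℝ K (x, y) +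
      (a • L₁ + b • L₂) ∘L (fderiv ℝ S x ∘L .fst ℝ E F + .snd ℝ E F) := fun x y hx hy =>
    hG ▸ fderiv_perturbedMap ((HK _ (hpρ x y hx hy)).1.differentiableAt (by simp))
      ((HS x (hxρ x hx)).1.differentiableAt (by simp))
  have hGlip : ∀ x ∈ Metric.ball (0 : E) R₂, ∀ y, ‖y‖ ≤ R₂ →
      ‖fderiv ℝ G (x, y) ∘L .inr ℝ E F‖ ≤ 1 / 2 := by
    intro x hx y hy
    have hx : ‖x‖ < R₂ := by simpa using hx
    rw [hfd x y hx hy, ContinuousLinearMap.add_comp]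
    have e : ((a • L₁ + b • L₂) ∘L (fderiv ℝ S x ∘L .fst ℝ E F + .snd ℝ E F)) ∘L .inr ℝ E F =
        a • L₁ + b • L₂ := by ext z; simp
    rw [e]
    have h1 := (norm_comp_inr_le (fderiv ℝ K (x, y))).trans (HK _ (hpρ x y hx hy)).2.1
    exact (norm_add_le _ _).trans (by linarith)
  have h0R : ‖(0 : F)‖ ≤ R₂ := by simpa using hR₂0.le
  have hfl : ∀ x, ‖x‖ < R₂ → fderiv ℝ G (x, 0) ∘L .inl ℝ E F =
      fderiv ℝ K (x, 0) ∘L .inl ℝ E F + (a • L₁ + b • L₂) ∘L fderiv ℝ S x := by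
    intro x hx
    rw [hfd x 0 hx h0R]
    ext z
    simp
  -- A crude bound, with 1/4 from K and 1/4 from the perturbation, which yields the strict
  -- inequality needed to run the contraction.
  have hx0 : ∀ x : E, ‖x‖ < R₂ → ‖G (x, 0)‖ ≤ 1 / 2 * ‖x‖ := by
    intro x hx
    have hG00 : G (0, 0) = 0 := by
      rw [hG, perturbedMap]
      simp [hS0, show K (0, 0) = 0 from hK0]
    have h := (convex_ball (0 : E) R₂).norm_image_sub_le_of_norm_hasFDerivWithin_le
      (f := fun z => G (z, 0)) (f' := fun z => fderiv ℝ G (z, 0) ∘L .inl ℝ E F) (C := 1 / 2)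
      (x := 0) (y := x) (fun z hz => ((hGsm z hz 0 h0R).differentiableAt
        (by simp)).hasFDerivAt.comp z (hasFDerivAt_prodMk_left z 0) |>.hasFDerivWithinAt) ?_
      (by simpa using hR₂0) (by simpa using hx)
    · simpa [hG00] using h
    · intro z hz
      have hz : ‖z‖ < R₂ := by simpa using hz
      rw [hfl z hz]
      have h1 := (norm_comp_inl_le (fderiv ℝ K (z, 0))).trans (HK _ (hpρ z 0 hz h0R)).2.1
      have h2 := (ContinuousLinearMap.opNorm_comp_le (a • L₁ + b • L₂) (fderiv ℝ S z)).trans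
        (mul_le_mul hpert' (HS z (hxρ z hz)).2 (norm_nonneg _) (by norm_num))
      exact (norm_add_le _ _).trans (by linarith)
  have hG0 : ∀ x ∈ Metric.ball (0 : E) R₂, ‖G (x, 0)‖ < R₂ / 2 := by
    intro x hx
    have hx : ‖x‖ < R₂ := by simpa using hx
    linarith [hx0 x hx]
  obtain ⟨u, hu⟩ := exists_contDiff_fixedPoint Metric.isOpen_ball hR₂0 hGsm hGlip hG0
  -- the derivative in `x` at `y = 0`
  have hd0 : ∀ x, nE ε x ≤ R₁ → ‖x‖ < R₂ ∧
      ‖fderiv ℝ G (x, 0) ∘L .inl ℝ E F‖ ≤ P * ε * nE ε x ^ 2 + Q * ε ^ 2 * nE ε x := by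
    intro x hx
    have hn := hn0 ε x
    have hxB : ‖x‖ < R₂ := ((hEn ε x hε).trans (by gcongr)).trans_lt hR₁B
    refine ⟨hxB, ?_⟩
    have hsε : √ε ≤ 1 := sqrt_le_one.2 hε1
    have hsε2 : √ε ^ 2 = ε := sq_sqrt hε.le
    have ht1 : B * √ε * nE ε x ≤ 1 := by
      calc B * √ε * nE ε x ≤ B * 1 * R₁ := by gcongr
        _ ≤ 1 := by linarith
    obtain ⟨e1, e2⟩ := Hest (by rw [dist_zero_right]; linarith) _ (by positivity) ht1
      (hwn ε x hε)
    have e3 : fderiv ℝ (fun z => K (z, 0)) x = fderiv ℝ K (x, 0) ∘L .inl ℝ E F :=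
      (((HK _ (hpρ x 0 hxB h0R)).1.differentiableAt (by simp)).hasFDerivAt.comp x
        (hasFDerivAt_prodMk_left x 0)).fderiv
    rw [hfl x hxB, ← e3]
    have e4 := (ContinuousLinearMap.opNorm_comp_le (a • L₁ + b • L₂) (fderiv ℝ S x)).trans
      (mul_le_mul hpert e2 (norm_nonneg _) (by positivity))
    refine (norm_add_le _ _).trans ((add_le_add e1 e4).trans ?_)
    calc D * (B * √ε * nE ε x) ^ 2 + N * ε ^ 2 * (D * (B * √ε * nE ε x))
        = P * √ε ^ 2 * nE ε x ^ 2 + Q * ε ^ 2 * nE ε x * √ε := by rw [hP, hQ]; ring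
      _ ≤ P * √ε ^ 2 * nE ε x ^ 2 + Q * ε ^ 2 * nE ε x * 1 := by gcongr
      _ = _ := by rw [hsε2, mul_one]
  have hGb : ∀ x, nE ε x ≤ R₁ → ‖G (x, 0)‖ ≤ C₁ * ε * nE ε x ^ 2 := by
    intro x hx
    have hn := hn0 ε x
    have hG00 : G (0, 0) = 0 := by
      have := hx0 0 (by simpa using hR₂0)
      simpa using this
    have hseg : ∀ z ∈ segment ℝ 0 x, nE ε z ≤ nE ε x := by
      intro z hz
      obtain ⟨θ, ⟨hθ0, hθ1⟩, rfl⟩ := (segment_eq_image' ℝ 0 x ▸ hz :)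
      simp only [zero_add, sub_zero]
      rw [hn1, abs_of_nonneg hθ0]
      exact mul_le_of_le_one_left hn hθ1
    -- Along the segment the scaled norm does not exceed that of x, so one derivative bound holds
    -- throughout. Since n ≤ R₁ ≤ 1 and ε ≤ 1, it may be taken linear in both ε and n.
    have h := (convex_segment (𝕜 := ℝ) (0 : E) x).norm_image_sub_le_of_norm_hasFDerivWithin_le
      (f := fun z => G (z, 0)) (f' := fun z => fderiv ℝ G (z, 0) ∘L .inl ℝ E F)
      (C := (P + Q) * ε * nE ε x) (x := 0) (y := x)
      (fun z hz => ((hGsm z (by simpa using (hd0 z ((hseg z hz).trans hx)).1) 0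
        h0R).differentiableAt (by simp)).hasFDerivAt.comp z
          (hasFDerivAt_prodMk_left z 0) |>.hasFDerivWithinAt) ?_
      (left_mem_segment ℝ _ _) (right_mem_segment ℝ _ _)
    · rw [hG00, sub_zero, sub_zero] at h
      refine h.trans ?_
      calc (P + Q) * ε * nE ε x * ‖x‖ ≤ (P + Q) * ε * nE ε x * (B * nE ε x) := by
            gcongr
            exact hEn ε x hε
        _ = _ := by rw [hC₁]; ring
    · intro z hz
      have hzn := hseg z hz
      have hz0 := hn0 ε z
      refine (hd0 z (hzn.trans hx)).2.trans ?_
      have h1 : nE ε z ^ 2 ≤ 1 * nE ε x := by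
        rw [sq]; exact mul_le_mul ((hzn.trans hx).trans hR₁1) hzn hz0 zero_le_one
      calc P * ε * nE ε z ^ 2 + Q * ε ^ 2 * nE ε z
          ≤ P * ε * (1 * nE ε x) + Q * (ε * 1) * nE ε x := by
            rw [sq ε]; gcongr
        _ = _ := by ring
  refine ⟨u, fun x hx => ?_⟩
  have hxR := (hd0 x hx).1
  obtain ⟨hu1, hu2, hu3, hu4, hu5⟩ := hu x (by simpa using hxR)
  have hux : ‖u x‖ ≤ 2 * (C₁ * ε * nE ε x ^ 2) := hu1.trans (by linarith [hGb x hx])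
  have huR : ‖u x‖ ≤ R₂ := hu1.trans (by linarith [hx0 x hxR])
  have hn := hn0 ε x
  refine ⟨by linarith, huR, hu2, hu3, hu4, hux.trans ?_, hu5.trans ?_⟩
  · have := mul_nonneg hε.le (sq_nonneg (nE ε x))
    calc 2 * (C₁ * ε * nE ε x ^ 2) ≤ 2 * (C₁ * ε * nE ε x ^ 2) + ε * nE ε x ^ 2 := by linarith
      _ = _ := by ring
  -- The perturbation has the same derivative at (x, u x) and (x, 0), so only the Lipschitz constant
  -- of dK enters.
  · have h1 : ‖fderiv ℝ G (x, u x) ∘L .inl ℝ E F - fderiv ℝ G (x, 0) ∘L .inl ℝ E F‖ ≤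
        Λ * ‖u x‖ := by
      have h0 : ‖(0 : F)‖ ≤ R₂ := by simpa using hR₂0.le
      rw [← ContinuousLinearMap.sub_comp]
      refine (norm_comp_inl_le _).trans ?_
      rw [hfd x _ hxR huR, hfd x 0 hxR h0, add_sub_add_right_eq_sub]
      refine ((HK _ (hpρ x _ hxR huR)).2.2 _ (hpρ x 0 hxR h0)).trans (le_of_eq ?_)
      congr 1
      simp
    have h2 := norm_le_norm_add_norm_sub' (fderiv ℝ G (x, u x) ∘L .inl ℝ E F)
      (fderiv ℝ G (x, 0) ∘L .inl ℝ E F)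
    have h3 := (hd0 x hx).2
    have h4 := mul_le_mul_of_nonneg_left hux hΛ
    generalize nE ε x = n at *
    -- One power of n is spent on the smallness of R₁ here, and one power of ε on that of ε₀ next;
    -- after doubling the two quarters add up to εn.
    have e1 : ε * n * ((P + 2 * Λ * C₁) * n) ≤ ε * n * (1 / 4) := by
      refine mul_le_mul_of_nonneg_left (le_trans ?_ hR₁P) (by positivity)
      gcongr
    have e2 : ε * n * (Q * ε) ≤ ε * n * (1 / 4) := by
      refine mul_le_mul_of_nonneg_left (le_trans ?_ hεQ) (by positivity)
      gcongr
      linarith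
    calc _ ≤ 2 * (P * ε * n ^ 2 + Q * ε ^ 2 * n + Λ * (2 * (C₁ * ε * n ^ 2))) := by linarith
      _ = 2 * (ε * n * ((P + 2 * Λ * C₁) * n)) + 2 * (ε * n * (Q * ε)) := by ring
      _ ≤ _ := by linarith

end Reduction

end
end Babenko

/-! ### Multipliers between H², H¹ and L², and the capillary nonlinearity -/

namespace Babenko
noncomputable section

open scoped Topology ContDiff ENNReal NNReal

/-! ### First-order multipliers -/

/-- A symbol of order at most one. -/
def FirstOrder (k : ℝ → ℂ) : Prop := Measurable k ∧ ∀ η, ‖k η‖ ≤ weight₁ η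

/-- The symbol of the identity. -/
def symOne (_ : ℝ) : ℂ := 1

/-- The symbol of `|D|` at `ξ = 2π η`. -/
def symAbs (η : ℝ) : ℂ := ((|2 * π * η| : ℝ) : ℂ)

/-- The symbol of `∂_α` at `ξ = 2π η`. -/
def symDer (η : ℝ) : ℂ := Complex.I * ((2 * π * η : ℝ) : ℂ)

theorem firstOrder_symOne : FirstOrder symOne :=
  ⟨measurable_const, fun η => by simpa [symOne] using isWeight₁.one_le η⟩

theorem firstOrder_symAbs : FirstOrder symAbs :=
  ⟨by unfold symAbs; fun_prop, fun η => by
    rw [symAbs, Complex.norm_real, norm_eq_abs, abs_abs, weight₁]; linarith⟩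

theorem firstOrder_symDer : FirstOrder symDer :=
  ⟨by unfold symDer; fun_prop, fun η => by
    rw [symDer, norm_mul, Complex.norm_I, one_mul, Complex.norm_real, norm_eq_abs, weight₁]
    linarith⟩

theorem weight₁_sq_le (η : ℝ) : weight₁ η * weight₁ η ≤ 2 * weight₂ η := by
  unfold weight₁ weight₂
  nlinarith [sq_abs (2 * π * η), sq_nonneg (|2 * π * η| - 1)]

theorem FirstOrder.norm_in_le {k : ℝ → ℂ} (hk : FirstOrder k) (η : ℝ) :
    ‖((weight₁ η * (weight₂ η)⁻¹ : ℝ) : ℂ) * k η‖ ≤ 2 := by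
  have h1 := isWeight₁.pos η
  have h2 := isWeight₂.pos η
  rw [norm_mul, Complex.norm_real, norm_eq_abs, abs_of_pos (by positivity)]
  calc weight₁ η * (weight₂ η)⁻¹ * ‖k η‖ ≤ weight₁ η * (weight₂ η)⁻¹ * weight₁ η := by
        gcongr; exact hk.2 η
    _ = (weight₁ η * weight₁ η) * (weight₂ η)⁻¹ := by ring
    _ ≤ (2 * weight₂ η) * (weight₂ η)⁻¹ := 
        mul_le_mul_of_nonneg_right (weight₁_sq_le η) (by positivity)
    _ = 2 := by field_simp

theorem FirstOrder.norm_out_le {k : ℝ → ℂ} (hk : FirstOrder k) (η : ℝ) :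
    ‖(((weight₁ η)⁻¹ : ℝ) : ℂ) * k η‖ ≤ 1 := by
  have h1 := isWeight₁.pos η
  rw [norm_mul, Complex.norm_real, norm_eq_abs, abs_of_pos (by positivity)]
  calc (weight₁ η)⁻¹ * ‖k η‖ ≤ (weight₁ η)⁻¹ * weight₁ η := by gcongr; exact hk.2 η
    _ = 1 := by field_simp

theorem FirstOrder.bdd_in {k : ℝ → ℂ} (hk : FirstOrder k) :
    BddSymbol fun η => ((weight₁ η * (weight₂ η)⁻¹ : ℝ) : ℂ) * k η :=
  .of_le ((Complex.measurable_ofReal.comp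
    (isWeight₁.measurable.mul isWeight₂.measurable.inv)).mul hk.1) 2 hk.norm_in_le

theorem FirstOrder.bdd_out {k : ℝ → ℂ} (hk : FirstOrder k) :
    BddSymbol fun η => (((weight₁ η)⁻¹ : ℝ) : ℂ) * k η :=
  .of_le ((Complex.measurable_ofReal.comp isWeight₁.measurable.inv).mul hk.1) 1 hk.norm_out_le

/-- The multiplier `k` from `H²` to `H¹`, on weighted transforms. -/
def opIn {k : ℝ → ℂ} (hk : FirstOrder k) : L2C →L[ℝ] L2C := bmul _ hk.bdd_in

/-- The multiplier `k` from `H¹` to `L²`, on weighted transforms. -/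
def opOut {k : ℝ → ℂ} (hk : FirstOrder k) : L2C →L[ℝ] L2C := bmul _ hk.bdd_out

theorem wnorm_opIn_le {k : ℝ → ℂ} (hk : FirstOrder k) (Φ : L2C) :
    wnorm (opIn hk Φ) ≤ ENNReal.ofReal 2 * wnorm Φ := wnorm_bmul_le hk.bdd_in hk.norm_in_le Φ

theorem wnorm_opOut_le {k : ℝ → ℂ} (hk : FirstOrder k) (Φ : L2C) :
    wnorm (opOut hk Φ) ≤ ENNReal.ofReal 1 * wnorm Φ := wnorm_bmul_le hk.bdd_out hk.norm_out_le Φ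

/-- The identity from `H²` to `H¹`, on weighted transforms. -/
abbrev inI : L2C →L[ℝ] L2C := opIn firstOrder_symOne
/-- `|D|` from `H²` to `H¹`, on weighted transforms. -/
abbrev inA : L2C →L[ℝ] L2C := opIn firstOrder_symAbs
/-- `∂_α` from `H²` to `H¹`, on weighted transforms. -/
abbrev inD : L2C →L[ℝ] L2C := opIn firstOrder_symDer
/-- The identity from `H¹` to `L²`, on weighted transforms. -/
abbrev outI : L2C →L[ℝ] L2C := opOut firstOrder_symOne
/-- `|D|` from `H¹` to `L²`, on weighted transforms. -/
abbrev outA : L2C →L[ℝ] L2C := opOut firstOrder_symAbs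
/-- `∂_α` from `H¹` to `L²`, on weighted transforms. -/
abbrev outD : L2C →L[ℝ] L2C := opOut firstOrder_symDer

/-- The product of `H¹`, on weighted transforms. -/
abbrev mul₁ : L2C →L[ℝ] L2C →L[ℝ] L2C := isWeight₁.mul
/-- The product of `H²`, on weighted transforms. -/
abbrev mul₂ : L2C →L[ℝ] L2C →L[ℝ] L2C := isWeight₂.mul
/-- The point values of the function in `H¹` with weighted transform `Φ`. -/
abbrev val₁ : L2C → ℝ → ℂ := isWeight₁.val

/-! ### The inverse square root of `J` -/

/-- `(1 + a)² + q² - 1`. -/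
def jacobian (a q : L2C) : L2C := (2 : ℝ) • a + mul₁ a a + mul₁ q q

/-- `(1 + y)² ((1 + a)² + q²) - 1`. -/
def sqrtDefect (p : (L2C × L2C) × L2C) : L2C :=
  (2 : ℝ) • p.2 + mul₁ p.2 p.2 + jacobian p.1.1 p.1.2 + (2 : ℝ) • mul₁ (jacobian p.1.1 p.1.2) p.2 +
    mul₁ (jacobian p.1.1 p.1.2) (mul₁ p.2 p.2)

theorem contDiff_clm_bilin {E : Type*} [NormedAddCommGroup E] [NormedSpace ℝ E] {n : ℕ∞ω}
    (m : L2C →L[ℝ] L2C →L[ℝ] L2C) {f h : E → L2C} (hf : ContDiff ℝ n f) (hh : ContDiff ℝ n h) :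
    ContDiff ℝ n fun x => m (f x) (h x) := (m.contDiff.comp hf).clm_apply hh

theorem contDiff_sqrtDefect : ContDiff ℝ ω sqrtDefect := by
  have ha : ContDiff ℝ ω fun p : (L2C × L2C) × L2C => p.1.1 := contDiff_fst.comp contDiff_fst
  have hq : ContDiff ℝ ω fun p : (L2C × L2C) × L2C => p.1.2 := contDiff_snd.comp contDiff_fst
  have hy : ContDiff ℝ ω fun p : (L2C × L2C) × L2C => p.2 := contDiff_snd
  have hj : ContDiff ℝ ω fun p : (L2C × L2C) × L2C => jacobian p.1.1 p.1.2 :=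
    ((ha.const_smul (2 : ℝ)).add (contDiff_clm_bilin _ ha ha)).add (contDiff_clm_bilin _ hq hq)
  exact ((((hy.const_smul (2 : ℝ)).add (contDiff_clm_bilin _ hy hy)).add hj).add
    ((contDiff_clm_bilin _ hj hy).const_smul (2 : ℝ))).add
    (contDiff_clm_bilin _ hj (contDiff_clm_bilin _ hy hy))

/-- At a = q = 0 the defect is 2y + y², whose derivative at y = 0 is twice the identity, so the
implicit function theorem applies. H¹ has no unit, hence everything is written in terms of J^(-1/2)
- 1. -/
theorem exists_invSqrt : ∃ Y : L2C × L2C → L2C, ContDiffAt ℝ ω Y 0 ∧ Y 0 = 0 ∧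
    ∀ᶠ p in 𝓝 (0 : L2C × L2C), sqrtDefect (p, Y p) = 0 := by
  have hf : ContDiffAt ℝ ω sqrtDefect ((0, 0) : (L2C × L2C) × L2C) :=
    contDiff_sqrtDefect.contDiffAt
  have hd : fderiv ℝ sqrtDefect ((0, 0) : (L2C × L2C) × L2C) ∘L .inr ℝ (L2C × L2C) L2C =
      (2 : ℝ) • ContinuousLinearMap.id ℝ L2C := by
    have h1 : HasFDerivAt (fun y : L2C => sqrtDefect (0, y))
        (fderiv ℝ sqrtDefect ((0, 0) : (L2C × L2C) × L2C) ∘L .inr ℝ (L2C × L2C) L2C) 0 :=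
      (hf.differentiableAt (by simp)).hasFDerivAt.comp 0 (hasFDerivAt_prodMk_right 0 0)
    have h2 : (fun y : L2C => sqrtDefect (0, y)) = fun y => (2 : ℝ) • y + mul₁ y y := by
      ext1 y; simp [sqrtDefect, jacobian]
    have h3 := ((hasFDerivAt_id (𝕜 := ℝ) (0 : L2C)).const_smul (2 : ℝ)).add
      (mul₁.hasFDerivAt_of_bilinear (hasFDerivAt_id (𝕜 := ℝ) (0 : L2C)) (hasFDerivAt_id (0 : L2C)))
    rw [h2] at h1
    rw [h1.unique h3]
    ext1 z
    simp
  have hinv : (fderiv ℝ sqrtDefect ((0, 0) : (L2C × L2C) × L2C) ∘L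
      .inr ℝ (L2C × L2C) L2C).IsInvertible := by
    rw [hd]
    exact ⟨ContinuousLinearEquiv.smulLeft (Units.mk0 (2 : ℝ) two_ne_zero), by ext1 z; rfl⟩
  refine ⟨hf.implicitFunction (by simp) hinv, hf.contDiffAt_implicitFunction (by simp) hinv,
    hf.implicitFunction_apply_self (by simp) hinv, ?_⟩
  filter_upwards [hf.eventually_apply_implicitFunction (by simp) hinv] with p hp
  rw [hp]
  simp [sqrtDefect, jacobian]

/-- The weighted transform of `((1 + a)² + q²)^(-1/2) - 1`, near `0`. -/
def invSqrt : L2C × L2C → L2C := exists_invSqrt.choose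

theorem contDiffAt_invSqrt : ContDiffAt ℝ ω invSqrt 0 := exists_invSqrt.choose_spec.1

theorem invSqrt_zero : invSqrt 0 = 0 := exists_invSqrt.choose_spec.2.1

theorem eventually_sqrtDefect : ∀ᶠ p in 𝓝 (0 : L2C × L2C), sqrtDefect (p, invSqrt p) = 0 :=
  exists_invSqrt.choose_spec.2.2

/-- `q ((1 + a)² + q²)^(-1/2) - q + q a`. -/
def capSin (p : L2C × L2C) : L2C := mul₁ p.2 (invSqrt p) + mul₁ p.2 p.1

/-- `(1 + a) ((1 + a)² + q²)^(-1/2) - 1 + q² / 2`. -/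
def capCos (p : L2C × L2C) : L2C :=
  p.1 + invSqrt p + mul₁ p.1 (invSqrt p) + (2⁻¹ : ℝ) • mul₁ p.2 p.2

theorem val₁_sub (Φ Ψ : L2C) (x : ℝ) : val₁ (Φ - Ψ) x = val₁ Φ x - val₁ Ψ x := by
  rw [sub_eq_add_neg, ← neg_one_smul ℝ Ψ, val₁, isWeight₁.val_add, isWeight₁.val_smul]
  simp [sub_eq_add_neg]

theorem val₁_neg (Φ : L2C) (x : ℝ) : val₁ (-Φ) x = -val₁ Φ x := by
  rw [← neg_one_smul ℝ Φ, val₁, isWeight₁.val_smul]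
  simp

theorem val₁_zero (x : ℝ) : val₁ 0 x = 0 := by
  have := val₁_sub 0 0 x
  simpa using this

theorem eq_of_val₁ {Φ Ψ : L2C} (h : ∀ x, val₁ Φ x = val₁ Ψ x) : Φ = Ψ :=
  isWeight₁.val_injective (funext h)

theorem val₁_sqrtDefect {a q y : L2C} (h : sqrtDefect ((a, q), y) = 0) (x : ℝ) :
    (1 + val₁ y x) ^ 2 * ((1 + val₁ a x) ^ 2 + val₁ q x ^ 2) = 1 := by
  have h1 := congrArg (fun Φ => val₁ Φ x) h
  simp only [sqrtDefect, jacobian, isWeight₁.val_add, isWeight₁.val_smul, isWeight₁.val_mul,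
    val₁_zero, Complex.real_smul, Complex.ofReal_ofNat] at h1
  linear_combination h1

section Order

variable {a q : H2 → L2C}

/-- Let 1 + y = J^(-1/2) and 1 + e = (1 + a)(1 + y). The defining relation reads (1 + e)² + (1 +
y)²q² = 1, which makes e quadratic. Then `capSin` is q(e - ay), and `capCos` is e + q²/2 = -(e² +
2yq² + y²q²)/2; both are cubic. -/
theorem vanishesToOrder_capillary (ha : VanishesToOrder mulNorm 1 a)
    (hq : VanishesToOrder mulNorm 1 q) (ha0 : a 0 = 0) (hq0 : q 0 = 0) :
    VanishesToOrder mulNorm 3 (fun U => capSin (a U, q U)) ∧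
      VanishesToOrder mulNorm 3 (fun U => capCos (a U, q U)) := by
  have G := isGauge_mulNorm
  have hpc : ContDiffAt ℝ ω (fun U => (a U, q U)) 0 := ha.contDiffAt.prodMk hq.contDiffAt
  have hp0 : (a 0, q 0) = (0 : L2C × L2C) := by rw [ha0, hq0]; rfl
  have hyc : ContDiffAt ℝ ω (fun U => invSqrt (a U, q U)) 0 :=
    ContDiffAt.comp (0 : H2) (by rw [hp0]; exact contDiffAt_invSqrt) hpc
  have hy0 : invSqrt (a 0, q 0) = 0 := by rw [hp0, invSqrt_zero]
  have hev : ∀ᶠ U in 𝓝 (0 : H2), sqrtDefect ((a U, q U), invSqrt (a U, q U)) = 0 := by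
    have hc := hpc.continuousAt
    rw [ContinuousAt, hp0] at hc
    exact hc.eventually eventually_sqrtDefect
  obtain ⟨y, hy⟩ : ∃ y : H2 → L2C, y = fun U => invSqrt (a U, q U) := ⟨_, rfl⟩
  have hyU : ∀ U, invSqrt (a U, q U) = y U := fun U => by rw [hy]
  simp only [hyU] at hyc hy0 hev
  have hq2 : VanishesToOrder mulNorm 2 (fun U => mul₁ (q U) (q U)) := hq.mul G hq
  have o0 : VanishesToOrder mulNorm 0 y := .of_contDiffAt hyc
  have hj : VanishesToOrder mulNorm 1 (fun U => jacobian (a U) (q U)) :=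
    ((ha.const_smul G 2).add G ((ha.mul G ha).mono (by norm_num))).add G (hq2.mono (by norm_num))
  -- With j = J - 1 the relation becomes 2(-y) = (j + 2jy + jy²) + y², and the bracket has order 1
  -- as soon as y is bounded.
  have hy1 : VanishesToOrder mulNorm 1 y := by
    have hp : VanishesToOrder mulNorm 1 (fun U => jacobian (a U) (q U) +
        (2 : ℝ) • mul₁ (jacobian (a U) (q U)) (y U) +
        mul₁ (jacobian (a U) (q U)) (mul₁ (y U) (y U))) :=
      (hj.add G ((hj.mul G o0).const_smul G 2)).add G (hj.mul G (o0.mul G o0))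
    have h := VanishesToOrder.of_two_smul_eq hp (h := fun U => -y U) hyc.neg (by simp [hy0]) (by
      filter_upwards [hev] with U hU
      rw [sqrtDefect] at hU
      simp only [map_neg, neg_apply, neg_neg, smul_neg]
      rw [← sub_eq_zero, ← neg_eq_zero, ← hU]
      abel)
    simpa only [smul_neg, neg_smul, one_smul, neg_neg] using h.const_smul G (-1)
  have hay : VanishesToOrder mulNorm 2 (fun U => mul₁ (a U) (y U)) := ha.mul G hy1
  have he0 : VanishesToOrder mulNorm 1 (fun U => y U + a U + mul₁ (a U) (y U)) :=
    (hy1.add G ha).add G (hay.mono (by norm_num))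
  have hyq : VanishesToOrder mulNorm 3 (fun U => (2 : ℝ) • mul₁ (y U) (mul₁ (q U) (q U)) +
      mul₁ (mul₁ (y U) (y U)) (mul₁ (q U) (q U))) :=
    ((hy1.mul G hq2).const_smul G 2).add G (((hy1.mul G hy1).mul G hq2).mono (by norm_num))
  -- Here the relation is 2(-e) = (1 + y)²q² + e².
  have he : VanishesToOrder mulNorm 2 (fun U => y U + a U + mul₁ (a U) (y U)) := by
    have h := VanishesToOrder.of_two_smul_eq (hq2.add G (hyq.mono (by norm_num)))
      (h := fun U => -(y U + a U + mul₁ (a U) (y U))) he0.contDiffAt.neg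
      (by simp [hy0, ha0]) (by
      filter_upwards [hev] with U hU
      refine eq_of_val₁ fun x => ?_
      have h1 := val₁_sqrtDefect hU x
      simp only [isWeight₁.val_add, isWeight₁.val_smul, isWeight₁.val_mul, val₁_neg,
        Complex.real_smul, Complex.ofReal_ofNat]
      linear_combination (-1 : ℂ) * h1)
    simpa only [smul_neg, neg_smul, one_smul, neg_neg] using h.const_smul G (-1)
  constructor
  · refine VanishesToOrder.congr (hq.mul G (he.sub G hay)) (.of_forall fun U => ?_)
    simp only [capSin, hyU]
    rw [← map_add]
    congr 1
    abel
  · refine VanishesToOrder.congr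
      ((hyq.add G ((he.mul G he).mono (by norm_num : 3 ≤ 4))).const_smul G (-2⁻¹)) ?_
    filter_upwards [hev] with U hU
    refine eq_of_val₁ fun x => ?_
    have h1 := val₁_sqrtDefect hU x
    simp only [capCos, hyU, isWeight₁.val_add, isWeight₁.val_smul, isWeight₁.val_mul,
        Complex.real_smul, Complex.ofReal_ofNat, Complex.ofReal_neg, Complex.ofReal_inv]
    linear_combination (-2⁻¹ : ℂ) * h1

end Order

end
end Babenko

namespace Babenko
noncomputable section

open scoped Topology ContDiff ENNReal NNReal

/-! ### Derivative bounds in terms of the `L¹` norm of the weighted transform -/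

/-- The derivative of `h` at `U` is of order `t ^ n`, where `t` is the `L¹` norm of
`(1 + ξ²) Û`. -/
structure DerivOrder {G : Type*} [NormedAddCommGroup G] [NormedSpace ℝ G] (n : ℕ) (h : H2 → G) :
    Prop where
  contDiffAt : ContDiffAt ℝ ω h 0
  bound : ∃ C : ℝ, 0 ≤ C ∧ ∀ᶠ U in 𝓝 (0 : H2), ∀ t : ℝ, 0 ≤ t → t ≤ 1 →
    wnorm (weightedL U) ≤ ENNReal.ofReal t → ‖fderiv ℝ h U‖ ≤ C * t ^ n

theorem VanishesToOrder.derivOrder {ν : L2C → ℝ≥0∞} {n : ℕ} {h : H2 → L2C}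
    (hh : VanishesToOrder ν (n + 1) h) : DerivOrder n h := by
  obtain ⟨C, hC, H⟩ := hh.bound
  refine ⟨hh.contDiffAt, C, hC, ?_⟩
  filter_upwards [H] with U hU t ht ht1 hw using (hU t ht ht1 hw).2

namespace DerivOrder

variable {G G' : Type*} [NormedAddCommGroup G] [NormedSpace ℝ G] [NormedAddCommGroup G']
  [NormedSpace ℝ G'] {n : ℕ} {f h : H2 → G}

theorem add (hf : DerivOrder n f) (hh : DerivOrder n h) : DerivOrder n (fun U => f U + h U) := by
  obtain ⟨C, hC, H⟩ := hf.bound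
  obtain ⟨C', hC', H'⟩ := hh.bound
  refine ⟨hf.contDiffAt.add hh.contDiffAt, C + C', by positivity, ?_⟩
  filter_upwards [H, H', hf.contDiffAt.eventually_differentiableAt,
    hh.contDiffAt.eventually_differentiableAt] with U hU hU' df dh t ht ht1 hw
  rw [fderiv_fun_add df dh, add_mul]
  exact (norm_add_le _ _).trans (add_le_add (hU t ht ht1 hw) (hU' t ht ht1 hw))

theorem clm (L : G →L[ℝ] G') (hf : DerivOrder n f) : DerivOrder n (fun U => L (f U)) := by
  obtain ⟨C, hC, H⟩ := hf.bound
  refine ⟨L.contDiff.contDiffAt.comp (0 : H2) hf.contDiffAt, ‖L‖ * C, by positivity, ?_⟩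
  filter_upwards [H, hf.contDiffAt.eventually_differentiableAt] with U hU df t ht ht1 hw
  have e : fderiv ℝ (fun U => L (f U)) U = L ∘L fderiv ℝ f U :=
    (L.hasFDerivAt.comp U df.hasFDerivAt).fderiv
  rw [e, mul_assoc]
  exact (L.opNorm_comp_le _).trans (mul_le_mul_of_nonneg_left (hU t ht ht1 hw) (norm_nonneg _))

theorem const_smul (r : ℝ) (hf : DerivOrder n f) : DerivOrder n (fun U => r • f U) :=
  hf.clm (r • ContinuousLinearMap.id ℝ G)

theorem neg (hf : DerivOrder n f) : DerivOrder n (fun U => -f U) :=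
  hf.clm (-ContinuousLinearMap.id ℝ G)

theorem sub (hf : DerivOrder n f) (hh : DerivOrder n h) : DerivOrder n (fun U => f U - h U) := by
  simpa only [sub_eq_add_neg] using hf.add hh.neg

/-- At U = 0 the parameter t = 0 is allowed, and a positive power of it vanishes. -/
theorem hasFDerivAt_zero (hf : DerivOrder (n + 1) f) : HasFDerivAt f (0 : H2 →L[ℝ] G) 0 := by
  obtain ⟨C, hC, H⟩ := hf.bound
  have h := H.self_of_nhds 0 le_rfl zero_le_one (by
    rw [map_zero, wnorm, eLpNorm_congr_ae (Lp.coeFn_zero ℂ 2 volume)]; simp)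
  rw [zero_pow n.succ_ne_zero, mul_zero] at h
  rw [← norm_le_zero_iff.1 h]
  exact (hf.contDiffAt.differentiableAt (by simp)).hasFDerivAt

end DerivOrder

/-! ### The quadratic and cubic terms -/

/-- The weighted transform of `(γ²/2) U V + g U |D|V + (g/2) |D|(U V) - (σ/2) |D|(|D|U |D|V)`. -/
def quadForm (g γ σ : ℝ) (Φ Ψ : L2C) : L2C :=
  outI ((γ ^ 2 / 2) • mul₁ (inI Φ) (inI Ψ) + g • mul₁ (inI Φ) (inA Ψ)) +
    outA ((g / 2) • mul₁ (inI Φ) (inI Ψ) - (σ / 2) • mul₁ (inA Φ) (inA Ψ))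

/-- The weighted transform of the terms of order at least three in the remainder equation. -/
def cubicTerms (γ σ : ℝ) (Φ : L2C) : L2C :=
  outI ((γ ^ 2 / 2) • mul₁ (inI Φ) (inA (mul₂ Φ Φ)) -
      (γ ^ 2 / 2) • mul₁ (mul₁ (inI Φ) (inI Φ)) (inA Φ)) -
    (γ ^ 2 / 6) • outA (mul₁ (mul₁ (inI Φ) (inI Φ)) (inI Φ)) +
    σ • outD (capSin (inA Φ, inD Φ)) - σ • outA (capCos (inA Φ, inD Φ))

/-- Meant for Ψ the transform of F(U): each term beyond the first then has a factor of order 2. The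
form is not symmetric, so the order of the arguments matters. -/
theorem quadForm_add (g γ σ : ℝ) (Φ Ψ : L2C) :
    quadForm g γ σ (Φ + Ψ) (Φ + Ψ) =
      quadForm g γ σ Φ Φ + (quadForm g γ σ Ψ (Φ + Ψ) + quadForm g γ σ Φ Ψ) := by
  simp only [quadForm, map_add, map_sub, add_apply, map_smul]
  module

theorem VanishesToOrder.quadForm {f h : H2 → L2C} {n k : ℕ} (g γ σ : ℝ)
    (hf : VanishesToOrder wnorm n f) (hh : VanishesToOrder wnorm k h) :
    VanishesToOrder wnorm (n + k) (fun U => quadForm g γ σ (f U) (h U)) := by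
  have G := isWeight₁.isGauge_wnorm
  have fI := hf.clm inI (wnorm_opIn_le _)
  have fA := hf.clm inA (wnorm_opIn_le _)
  have hI := hh.clm inI (wnorm_opIn_le _)
  have hA := hh.clm inA (wnorm_opIn_le _)
  exact ((((fI.mul G hI).const_smul G _).add G ((fI.mul G hA).const_smul G _)).clm outI
    (wnorm_opOut_le _)).add G ((((fI.mul G hI).const_smul G _).sub G
      ((fA.mul G hA).const_smul G _)).clm outA (wnorm_opOut_le _))

theorem derivOrder_cubicTerms {f : H2 → L2C} (γ σ : ℝ) (hf : VanishesToOrder wnorm 1 f)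
    (f0 : f 0 = 0) : DerivOrder 2 (fun U => cubicTerms γ σ (f U)) := by
  have G := isWeight₁.isGauge_wnorm
  have hI := hf.clm inI (wnorm_opIn_le _)
  have hA := hf.clm inA (wnorm_opIn_le _)
  have hD := hf.clm inD (wnorm_opIn_le _)
  obtain ⟨hs, hc⟩ := vanishesToOrder_capillary hA.to_mulNorm hD.to_mulNorm (by simp [f0])
    (by simp [f0])
  have h2 := (hf.mul isWeight₂.isGauge_wnorm hf).clm inA (wnorm_opIn_le _)
  have hII := hI.mul G hI
  have p1 : DerivOrder 2 _ := (hI.mul G h2).derivOrder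
  have p2 : DerivOrder 2 _ := (hII.mul G hA).derivOrder
  have p3 : DerivOrder 2 _ := (hII.mul G hI).derivOrder
  exact (((((p1.const_smul _).sub (p2.const_smul _)).clm outI).sub
    ((p3.clm outA).const_smul _)).add ((hs.derivOrder.clm outD).const_smul _)).sub
    ((hc.derivOrder.clm outA).const_smul _)

/-! ### The terms of the remainder equation as analytic maps -/

section Maps

variable {g γ σ cs w δ : ℝ} (hB : InvLBdd g γ σ cs w δ)

/-- The operator `F` as a map from `H²` to `𝒳₂`. -/
def quadMap (U : H2) : X2 w δ := -invLX2 hB (quadForm g γ σ (weightedL U) (weightedL U))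

/-- The terms of order at least three of the remainder equation. -/
def cubicMap (U : H2) : X2 w δ := invLX2 hB (cubicTerms γ σ (weightedL U))

/-- The embedding of `𝒳₂`, on weighted transforms. -/
def weightedX2 : X2 w δ →L[ℝ] L2C := weightedL ∘L (X2 w δ).subtypeL

theorem vanishesToOrder_invLX2 {n : ℕ} {h : H2 → L2C} (hh : VanishesToOrder wnorm n h) :
    VanishesToOrder wnorm n (fun U => weightedX2 (invLX2 hB (h U))) := by
  obtain ⟨C, -, H⟩ := wnorm_invLX2_le hB
  exact hh.clm (weightedX2 ∘L invLX2 hB) H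

theorem quadMap_zero : quadMap hB 0 = 0 := by
  simp [quadMap, quadForm]

theorem vanishesToOrder_quadMap :
    VanishesToOrder wnorm 2 (fun U => weightedX2 (quadMap hB U)) := by
  have h := (vanishesToOrder_invLX2 hB (VanishesToOrder.weighted.quadForm g γ σ
    VanishesToOrder.weighted)).const_smul isWeight₁.isGauge_wnorm (-1)
  simpa only [quadMap, map_neg, neg_smul, one_smul] using h

theorem derivOrder_quadMap : DerivOrder 1 (quadMap hB) :=
  ((VanishesToOrder.weighted.quadForm g γ σ VanishesToOrder.weighted).derivOrder.clm
    (invLX2 hB)).neg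

theorem derivOrder_cubicMap : DerivOrder 2 (cubicMap hB) :=
  (derivOrder_cubicTerms γ σ VanishesToOrder.weighted (map_zero _)).clm (invLX2 hB)

/-- The map `U ↦ U + F(U)`. -/
def corrected (U : H2) : H2 := U + quadMap hB U

theorem vanishesToOrder_corrected :
    VanishesToOrder wnorm 1 (fun U => weightedL (corrected hB U)) := by
  have h := VanishesToOrder.weighted.add isWeight₁.isGauge_wnorm
    ((vanishesToOrder_quadMap hB).mono (by norm_num : 1 ≤ 2))
  exact h.congr (.of_forall fun U => (map_add weightedL _ _).symm)

theorem corrected_zero : corrected hB 0 = 0 := by simp [corrected, quadMap_zero]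

/-- This is where inserting F(U₁) pays off: subtracting F(U₁) removes the quadratic part, and what
is left has order 3, hence a derivative of order 2. -/
theorem derivOrder_restricted :
    DerivOrder 2 (fun U => cubicMap hB (corrected hB U) +
      (quadMap hB (corrected hB U) - quadMap hB U)) := by
  refine ((derivOrder_cubicTerms γ σ (vanishesToOrder_corrected hB) ?_).clm (invLX2 hB)).add ?_
  · rw [corrected_zero, map_zero]
  · have h1 : DerivOrder 2 (fun U => quadForm g γ σ (weightedX2 (quadMap hB U))
        (weightedL (corrected hB U)) +
          quadForm g γ σ (weightedL U) (weightedX2 (quadMap hB U))) :=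
      (VanishesToOrder.derivOrder (n := 2) ((vanishesToOrder_quadMap hB).quadForm g γ σ
        (vanishesToOrder_corrected hB))).add
      (VanishesToOrder.derivOrder (n := 2) (VanishesToOrder.weighted.quadForm g γ σ
        (vanishesToOrder_quadMap hB)))
    have h2 := (h1.clm (invLX2 hB)).neg
    convert h2 using 2 with U
    have e : weightedL (corrected hB U) = weightedL U + weightedX2 (quadMap hB U) :=
      map_add weightedL _ _
    rw [quadMap, e, quadForm_add, map_add, quadMap]
    abel

/-- The full argument `U = U₁ + F(U₁) + U₃`. -/
def fullArg (p : X1 w δ × X2 w δ) : H2 := corrected hB p.1 + p.2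

/-- The part of the right-hand side of the remainder equation that is independent of `c`. -/
def nonlinearPart (p : X1 w δ × X2 w δ) : X2 w δ :=
  cubicMap hB (fullArg hB p) + (quadMap hB (fullArg hB p) - quadMap hB p.1)

/-- The operator `F` on `𝒳₁`. -/
def quadX1 (x : X1 w δ) : X2 w δ := quadMap hB x

/-- The operator `γ (1 - χ(D)) / L(D)` on `𝒳₂`. -/
def linI : X2 w δ →L[ℝ] X2 w δ := γ • (invLX2 hB ∘L outI ∘L inI ∘L weightedX2)

/-- The operator `|D| (1 - χ(D)) / L(D)` on `𝒳₂`. -/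
def linA : X2 w δ →L[ℝ] X2 w δ := invLX2 hB ∘L outI ∘L inA ∘L weightedX2

theorem contDiffAt_quadX1 : ContDiffAt ℝ ω (quadX1 hB) 0 :=
  (show ContDiffAt ℝ ω (quadMap hB) ((X1 w δ).subtypeL 0) by
    rw [map_zero]; exact (derivOrder_quadMap hB).contDiffAt).comp 0
    (X1 w δ).subtypeL.contDiff.contDiffAt

theorem quadX1_zero : quadX1 hB 0 = 0 := quadMap_zero hB

theorem fderiv_quadX1_zero : fderiv ℝ (quadX1 hB) 0 = 0 := by
  have h : HasFDerivAt (quadMap hB) (0 : H2 →L[ℝ] X2 w δ) ((X1 w δ).subtypeL 0) := by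
    rw [map_zero]; exact (derivOrder_quadMap hB).hasFDerivAt_zero
  have := (h.comp (0 : X1 w δ) (X1 w δ).subtypeL.hasFDerivAt).fderiv
  rw [ContinuousLinearMap.zero_comp] at this
  exact this

theorem contDiffAt_fullArg : ContDiffAt ℝ ω (fullArg hB) 0 := by
  have h1 : ContDiffAt ℝ ω (fun p : X1 w δ × X2 w δ => quadX1 hB p.1) 0 :=
    ContDiffAt.comp (g := quadX1 hB) (0 : X1 w δ × X2 w δ) (contDiffAt_quadX1 hB) contDiffAt_fst
  have h2 : ContDiff ℝ ω (fun p : X1 w δ × X2 w δ => (p.1 : H2)) :=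
    (X1 w δ).subtypeL.contDiff.comp contDiff_fst
  have h3 : ContDiff ℝ ω (fun p : X1 w δ × X2 w δ => (p.2 : H2)) :=
    (X2 w δ).subtypeL.contDiff.comp contDiff_snd
  exact (h2.contDiffAt.add ((X2 w δ).subtypeL.contDiff.contDiffAt.comp _ h1)).add h3.contDiffAt

theorem fullArg_zero : fullArg hB 0 = 0 := by
  have : fullArg hB 0 = corrected hB 0 + 0 := rfl
  rw [this, corrected_zero, add_zero]

theorem contDiffAt_nonlinearPart : ContDiffAt ℝ ω (nonlinearPart hB) 0 := by
  have h := contDiffAt_fullArg hB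
  have h1 : ContDiffAt ℝ ω (fun p : X1 w δ × X2 w δ => quadX1 hB p.1) 0 :=
    ContDiffAt.comp (g := quadX1 hB) (0 : X1 w δ × X2 w δ) (contDiffAt_quadX1 hB) contDiffAt_fst
  have hc : ContDiffAt ℝ ω (cubicMap hB) (fullArg hB 0) := by
    rw [fullArg_zero]; exact (derivOrder_cubicMap hB).contDiffAt
  have hq : ContDiffAt ℝ ω (quadMap hB) (fullArg hB 0) := by
    rw [fullArg_zero]; exact (derivOrder_quadMap hB).contDiffAt
  have h2 := ContDiffAt.comp (0 : X1 w δ × X2 w δ) hc h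
  have h3 := ContDiffAt.comp (0 : X1 w δ × X2 w δ) hq h
  have h4 := h2.add (h3.sub h1)
  exact h4

theorem nonlinearPart_zero : nonlinearPart hB 0 = 0 := by
  have : nonlinearPart hB 0 = cubicMap hB (fullArg hB 0) +
    (quadMap hB (fullArg hB 0) - quadMap hB 0) := rfl
  rw [this, fullArg_zero, sub_self, add_zero, cubicMap]
  simp [cubicTerms, capSin, capCos, invSqrt_zero,
    show ((0, 0) : L2C × L2C) = 0 from rfl]

theorem fderiv_nonlinearPart_zero : fderiv ℝ (nonlinearPart hB) 0 = 0 := by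
  obtain ⟨ψ', h⟩ := (contDiffAt_fullArg hB).differentiableAt (by simp)
  have hc : HasFDerivAt (cubicMap hB) (0 : H2 →L[ℝ] X2 w δ) (fullArg hB 0) := by
    rw [fullArg_zero]; exact (derivOrder_cubicMap hB).hasFDerivAt_zero
  have hq : HasFDerivAt (quadMap hB) (0 : H2 →L[ℝ] X2 w δ) (fullArg hB 0) := by
    rw [fullArg_zero]; exact (derivOrder_quadMap hB).hasFDerivAt_zero
  have hs : HasFDerivAt (quadX1 hB) (0 : X1 w δ →L[ℝ] X2 w δ) (0 : X1 w δ × X2 w δ).1 := by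
    rw [← fderiv_quadX1_zero hB]
    exact ((contDiffAt_quadX1 hB).differentiableAt (by simp)).hasFDerivAt
  have h1 : HasFDerivAt (fun p => cubicMap hB (fullArg hB p)) _ 0 := hc.comp _ h
  have h2 : HasFDerivAt (fun p => quadMap hB (fullArg hB p)) _ 0 := hq.comp _ h
  have h3 := HasFDerivAt.comp (g := quadX1 hB) (0 : X1 w δ × X2 w δ) hs hasFDerivAt_fst
  rw [ContinuousLinearMap.zero_comp] at h1 h2 h3
  have h4 := h1.add (h2.sub h3)
  rw [sub_zero, add_zero] at h4
  exact h4.fderiv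

theorem norm_fderiv_restrict_le {G : Type*} [NormedAddCommGroup G] [NormedSpace ℝ G] {f : H2 → G}
    {S : Submodule ℝ H2} {x : S} (hf : DifferentiableAt ℝ f x) :
    ‖fderiv ℝ (fun y : S => f y) x‖ ≤ ‖fderiv ℝ f x‖ := by
  have h : HasFDerivAt (fun y : S => f y) (fderiv ℝ f x ∘L S.subtypeL) x :=
    HasFDerivAt.comp x (f := S.subtypeL) hf.hasFDerivAt S.subtypeL.hasFDerivAt
  rw [h.fderiv]
  exact (ContinuousLinearMap.opNorm_comp_le _ _).trans
    (mul_le_of_le_one_right (norm_nonneg _) S.norm_subtypeL_le)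

theorem exists_deriv_bounds : ∃ D : ℝ, 0 ≤ D ∧ ∀ᶠ x : X1 w δ in 𝓝 0, ∀ t : ℝ, 0 ≤ t → t ≤ 1 →
    wnorm (weightedL (x : H2)) ≤ ENNReal.ofReal t →
      ‖fderiv ℝ (fun z => nonlinearPart hB (z, 0)) x‖ ≤ D * t ^ 2 ∧
        ‖fderiv ℝ (quadX1 hB) x‖ ≤ D * t := by
  obtain ⟨C, hC, H⟩ := (derivOrder_restricted hB).bound
  obtain ⟨C', hC', H'⟩ := (derivOrder_quadMap hB).bound
  refine ⟨C + C', by positivity, ?_⟩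
  have h0 : Filter.Tendsto (fun x : X1 w δ => (x : H2)) (𝓝 0) (𝓝 0) :=
    (X1 w δ).subtypeL.continuous.tendsto' 0 0 (map_zero _)
  filter_upwards [h0.eventually H, h0.eventually H',
    h0.eventually (derivOrder_restricted hB).contDiffAt.eventually_differentiableAt,
    h0.eventually (derivOrder_quadMap hB).contDiffAt.eventually_differentiableAt]
    with x hx hx' df df' t ht ht1 hw
  have e : (fun z : X1 w δ => nonlinearPart hB (z, 0)) = fun z : X1 w δ =>
      cubicMap hB (corrected hB z) + (quadMap hB (corrected hB z) - quadMap hB z) := by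
    ext1 z
    have : fullArg hB (z, 0) = corrected hB z := add_zero _
    rw [nonlinearPart, this]
  constructor
  · rw [e]
    refine (norm_fderiv_restrict_le df).trans ((hx t ht ht1 hw).trans ?_)
    gcongr; linarith
  · refine (norm_fderiv_restrict_le df').trans ((hx' t ht ht1 hw).trans ?_)
    rw [pow_one]
    gcongr; linarith

end Maps

end
end Babenko

namespace Babenko
noncomputable section

open scoped FourierTransform ComplexConjugate Topology ENNReal NNReal

/-! ### Functions represented by weighted transforms -/

/-- The function `f` has Fourier transform `Φ / w`. -/
def IsWeight.Rep {w : ℝ → ℝ} (hw : IsWeight w) (f : ℝ → ℝ) (Φ : L2C) : Prop := HasFT f (hw.unw Φ)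

section Rep

variable {w : ℝ → ℝ} {hw : IsWeight w} {f h : ℝ → ℝ} {Φ Ψ : L2C}

theorem IsWeight.Rep.add (hf : hw.Rep f Φ) (hh : hw.Rep h Ψ) :
    hw.Rep (fun x => f x + h x) (Φ + Ψ) :=
  (HasFT.add hf hh).congr_right (hw.unw_add Φ Ψ).symm

theorem IsWeight.Rep.const_mul (hf : hw.Rep f Φ) (r : ℝ) :
    hw.Rep (fun x => r * f x) (r • Φ) :=
  (HasFT.const_mul hf r).congr_right ((hw.unw_smul r Φ).trans (by simp)).symm

theorem IsWeight.Rep.sub (hf : hw.Rep f Φ) (hh : hw.Rep h Ψ) :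
    hw.Rep (fun x => f x - h x) (Φ - Ψ) := by
  simpa [sub_eq_add_neg] using hf.add (hh.const_mul (-1))

theorem IsWeight.Rep.mul (hf : hw.Rep f Φ) (hh : hw.Rep h Ψ) :
    hw.Rep (fun x => f x * h x) (hw.mul Φ Ψ) :=
  (HasFT.mul hf hh (hw.integrable_unw Φ) (hw.integrable_unw Ψ)).congr_right (hw.unw_mul Φ Ψ).symm

theorem IsWeight.Rep.ae_eq_val (hf : hw.Rep f Φ) : (fun x => (f x : ℂ)) =ᵐ[volume] hw.val Φ :=
  HasFT.ae_eq_fourierInv hf (hw.integrable_unw Φ)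

theorem IsWeight.rep_of_ae_eq_val (h : (fun x => (f x : ℂ)) =ᵐ[volume] hw.val Φ) : hw.Rep f Φ :=
  HasFT.of_ae_eq_fourierInv (hw.memLp_unw Φ) (hw.integrable_unw Φ) h

theorem HasFT.add_coe (hf : HasFT f Φ) (hh : HasFT h Ψ) :
    HasFT (fun x => f x + h x) (Φ + Ψ : L2C) :=
  (hf.add hh).congr_right (Lp.coeFn_add Φ Ψ).symm

theorem HasFT.const_mul_coe (hf : HasFT f Φ) (r : ℝ) :
    HasFT (fun x => r * f x) (r • Φ : L2C) :=
  (hf.const_mul r).congr_right ((Lp.coeFn_smul r Φ).trans (by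
    filter_upwards with η; simp)).symm

theorem HasFT.sub_coe (hf : HasFT f Φ) (hh : HasFT h Ψ) :
    HasFT (fun x => f x - h x) (Φ - Ψ : L2C) := by
  simpa [sub_eq_add_neg] using hf.add_coe (hh.const_mul_coe (-1))

end Rep

section Multipliers

variable {k m : ℝ → ℂ} {f : ℝ → ℝ} {Φ : L2C}

theorem unw_opIn (hk : FirstOrder k) (Φ : L2C) :
    isWeight₁.unw (opIn hk Φ) =ᵐ[volume] fun η => k η * isWeight₂.unw Φ η := by
  filter_upwards [bmul_ae _ hk.bdd_in Φ] with η h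
  have h1 : ((weight₁ η : ℝ) : ℂ) ≠ 0 := Complex.ofReal_ne_zero.2 (isWeight₁.pos η).ne'
  rw [IsWeight.unw, opIn, h, IsWeight.unw]
  push_cast
  field_simp

theorem opOut_ae (hk : FirstOrder k) (Φ : L2C) :
    opOut hk Φ =ᵐ[volume] fun η => k η * isWeight₁.unw Φ η := by
  filter_upwards [bmul_ae _ hk.bdd_out Φ] with η h
  rw [opOut, h, IsWeight.unw]
  ring

theorem rep_opIn (hk : FirstOrder k) (hm : ∀ η, m (2 * π * η) = k η)
    (hs : ∀ ξ, m (-ξ) = conj (m ξ)) (hf : isWeight₂.Rep f Φ) :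
    isWeight₁.Rep (mult m f) (opIn hk Φ) := by
  have e : (fun η => m (2 * π * η) * isWeight₂.unw Φ η) =ᵐ[volume] isWeight₁.unw (opIn hk Φ) := by
    simp only [hm]; exact (unw_opIn hk Φ).symm
  exact (HasFT.mult hf hs ((memLp_congr_ae e).2 (isWeight₁.memLp_unw _))).congr_right e

theorem hasFT_opOut (hk : FirstOrder k) (hm : ∀ η, m (2 * π * η) = k η)
    (hs : ∀ ξ, m (-ξ) = conj (m ξ)) (hf : isWeight₁.Rep f Φ) :
    HasFT (mult m f) (opOut hk Φ) := by
  have e : (fun η => m (2 * π * η) * isWeight₁.unw Φ η) =ᵐ[volume] opOut hk Φ := by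
    simp only [hm]; exact (opOut_ae hk Φ).symm
  exact (HasFT.mult hf hs ((memLp_congr_ae e).2 (Lp.memLp _))).congr_right e

theorem rep_inI (hf : isWeight₂.Rep f Φ) : isWeight₁.Rep f (inI Φ) :=
  HasFT.congr_right hf ((unw_opIn firstOrder_symOne Φ).trans (by simp [symOne])).symm

theorem rep_inA (hf : isWeight₂.Rep f Φ) : isWeight₁.Rep (absD f) (inA Φ) :=
  rep_opIn firstOrder_symAbs (fun _ => rfl) (by simp) hf

theorem rep_inD (hf : isWeight₂.Rep f Φ) : isWeight₁.Rep (dα f) (inD Φ) :=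
  rep_opIn firstOrder_symDer (fun _ => rfl) (by simp) hf

theorem hasFT_outI (hf : isWeight₁.Rep f Φ) : HasFT f (outI Φ) :=
  HasFT.congr_right hf ((opOut_ae firstOrder_symOne Φ).trans (by simp [symOne])).symm

theorem hasFT_outA (hf : isWeight₁.Rep f Φ) : HasFT (absD f) (outA Φ) :=
  hasFT_opOut firstOrder_symAbs (fun _ => rfl) (by simp) hf

theorem hasFT_outD (hf : isWeight₁.Rep f Φ) : HasFT (dα f) (outD Φ) :=
  hasFT_opOut firstOrder_symDer (fun _ => rfl) (by simp) hf

theorem hasFT_absDSq (hf : isWeight₂.Rep f Φ) : HasFT (absDSq f) (-outD (inD Φ) : L2C) := by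
  have e : (fun η => ((|2 * π * η| ^ 2 : ℝ) : ℂ) * isWeight₂.unw Φ η) =ᵐ[volume]
      (-outD (inD Φ) : L2C) := by
    filter_upwards [Lp.coeFn_neg (outD (inD Φ)), opOut_ae firstOrder_symDer (inD Φ),
      unw_opIn firstOrder_symDer Φ] with η a b c
    rw [a, Pi.neg_apply, b, c, symDer, sq_abs]
    push_cast
    linear_combination (2 * π * η : ℂ) ^ 2 * isWeight₂.unw Φ η * Complex.I_sq
  exact (HasFT.mult (m := fun ξ => ((|ξ| ^ 2 : ℝ) : ℂ)) hf (by simp)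
    ((memLp_congr_ae e).2 (Lp.memLp _))).congr_right e

/-- For opposite signs both brackets vanish, and for equal signs |u + v| = |u| + |v|. -/
theorem absD_mul_identity (u v : ℝ) :
    (u + v) * (|u| * v + u * |v|) = |u + v| * (|u| * |v| + u * v) := by
  rcases le_total 0 u with hu | hu <;> rcases le_total 0 v with hv | hv
  · rw [abs_of_nonneg hu, abs_of_nonneg hv, abs_of_nonneg (add_nonneg hu hv)]
  · rw [abs_of_nonneg hu, abs_of_nonpos hv]; ring
  · rw [abs_of_nonpos hu, abs_of_nonneg hv]; ring
  · rw [abs_of_nonpos hu, abs_of_nonpos hv, abs_of_nonpos (add_nonpos hu hv)]; ring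

/-- The identity `2 ∂_α (|D|U U_α) = |D| (U_α² - (|D|U)²)`. -/
theorem outD_mul_eq (Φ : L2C) :
    (2 : ℝ) • outD (mul₁ (inA Φ) (inD Φ)) =
      outA (mul₁ (inD Φ) (inD Φ)) - outA (mul₁ (inA Φ) (inA Φ)) := by
  obtain ⟨φ, hφ⟩ : ∃ φ, φ = isWeight₂.unw Φ := ⟨_, rfl⟩
  have eA : isWeight₁.unw (inA Φ) =ᵐ[volume] fun η => symAbs η * φ η := by
    rw [hφ]; exact unw_opIn firstOrder_symAbs Φ
  have eD : isWeight₁.unw (inD Φ) =ᵐ[volume] fun η => symDer η * φ η := by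
    rw [hφ]; exact unw_opIn firstOrder_symDer Φ
  have iA := (isWeight₁.integrable_unw (inA Φ)).congr eA
  have iD := (isWeight₁.integrable_unw (inD Φ)).congr eD
  apply Lp.ext
  filter_upwards [Lp.coeFn_smul (2 : ℝ) (outD (mul₁ (inA Φ) (inD Φ))),
    Lp.coeFn_sub (outA (mul₁ (inD Φ) (inD Φ))) (outA (mul₁ (inA Φ) (inA Φ))),
    opOut_ae firstOrder_symDer (mul₁ (inA Φ) (inD Φ)),
    opOut_ae firstOrder_symAbs (mul₁ (inD Φ) (inD Φ)),
    opOut_ae firstOrder_symAbs (mul₁ (inA Φ) (inA Φ)),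
    isWeight₁.unw_mul (inA Φ) (inD Φ), isWeight₁.unw_mul (inD Φ) (inD Φ),
    isWeight₁.unw_mul (inA Φ) (inA Φ),
    iA.ae_convolution_exists (ContinuousLinearMap.mul ℂ ℂ) iD,
    iD.ae_convolution_exists (ContinuousLinearMap.mul ℂ ℂ) iA,
    iA.ae_convolution_exists (ContinuousLinearMap.mul ℂ ℂ) iA,
    iD.ae_convolution_exists (ContinuousLinearMap.mul ℂ ℂ) iD]
    with η h1 h2 h3 h4 h5 h6 h7 h8 c1 c2 c3 c4
  rw [h1, h2, Pi.smul_apply, Pi.sub_apply, h3, h4, h5, h6, h7, h8, conv_congr eA eD,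
    conv_congr eD eD, conv_congr eA eA, Complex.real_smul]
  -- The factor 2 is used to symmetrise the convolution; only the symmetrised symbol satisfies the
  -- pointwise identity under the integral.
  have s : ((2 : ℝ) : ℂ) * (symDer η * conv (fun η => symAbs η * φ η)
      (fun η => symDer η * φ η) η) = symDer η * (conv (fun η => symAbs η * φ η)
      (fun η => symDer η * φ η) η + conv (fun η => symDer η * φ η)
      (fun η => symAbs η * φ η) η) := by
    rw [conv_comm (fun η => symDer η * φ η) (fun η => symAbs η * φ η)]
    push_cast; ring
  rw [s, ← mul_sub]
  unfold ConvolutionExistsAt at c1 c2 c3 c4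
  simp only [conv, convolution_def]
  rw [← integral_add c1 c2, ← integral_sub c4 c3, ← integral_const_mul, ← integral_const_mul]
  congr 1
  ext t
  have h := congrArg (fun r : ℝ => (r : ℂ)) (absD_mul_identity (2 * π * t) (2 * π * (η - t)))
  rw [show 2 * π * t + 2 * π * (η - t) = 2 * π * η by ring] at h
  simp only [ContinuousLinearMap.mul_apply', symAbs, symDer]
  push_cast at h ⊢
  linear_combination (Complex.I ^ 2 * (φ t * φ (η - t))) * h + ((|2 * π * η| : ℝ) : ℂ) *
    (|2 * π * t| : ℝ) * (|2 * π * (η - t)| : ℝ) * (φ t * φ (η - t)) * Complex.I_sq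

end Multipliers

/-! ### The inverse square root of `J` as a function -/

/-- The smallness under which `invSqrt` represents `J^(-1/2) - 1`. -/
def Admissible (W : L2C) : Prop :=
  sqrtDefect ((inA W, inD W), invSqrt (inA W, inD W)) = 0 ∧
    isWeight₁.const.toReal * ‖invSqrt (inA W, inD W)‖ < 1

theorem eventually_admissible : ∀ᶠ W in 𝓝 (0 : L2C), Admissible W := by
  have h1 : Filter.Tendsto (fun W : L2C => (inA W, inD W)) (𝓝 0) (𝓝 (0 : L2C × L2C)) :=
    Continuous.tendsto' (by fun_prop) _ _ (by simp)
  have h2 : Filter.Tendsto (fun p : L2C × L2C => isWeight₁.const.toReal * ‖invSqrt p‖) (𝓝 0)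
      (𝓝 0) := by
    have := (contDiffAt_invSqrt.continuousAt.norm.const_mul isWeight₁.const.toReal)
    simpa [ContinuousAt, invSqrt_zero] using this
  exact (h1.eventually eventually_sqrtDefect).and
    (h1.eventually (h2.eventually_lt_const one_pos))

/-- The equation forces j ≠ 0 and leaves two roots; |z| < 1 gives 1 + z a positive real part, which
excludes the negative one. -/
theorem pos_and_eq_inv_sqrt {j : ℝ} {z : ℂ} (hj : 0 ≤ j) (h : (1 + z) ^ 2 * j = 1)
    (hz : ‖z‖ < 1) : 0 < j ∧ (((√j)⁻¹ - 1 : ℝ) : ℂ) = z := by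
  have hj0 : 0 < j := by
    refine hj.lt_of_ne fun h0 => ?_
    rw [← h0] at h
    simp at h
  refine ⟨hj0, ?_⟩
  have hs : 0 < √j := sqrt_pos.2 hj0
  have h2 : ((1 + z) * (√j : ℝ)) ^ 2 = 1 := by
    rw [mul_pow, ← Complex.ofReal_pow, sq_sqrt hj, h]
  have hne : ((√j : ℝ) : ℂ) ≠ 0 := Complex.ofReal_ne_zero.2 hs.ne'
  rcases mul_self_eq_one_iff.1 ((sq _).symm.trans h2) with h3 | h3
  · push_cast
    rw [← eq_div_iff hne] at h3
    rw [← add_sub_cancel_left (1 : ℂ) z, h3, one_div]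
  · exfalso
    have h4 := congrArg Complex.re h3
    rw [Complex.re_mul_ofReal] at h4
    have h5 := (abs_le.1 (Complex.abs_re_le_norm z)).1
    simp at h4
    nlinarith

variable {f : ℝ → ℝ} {W : L2C}

theorem ae_J_pos_and_eq (ha : Admissible W) (hf : isWeight₂.Rep f W) :
    ∀ᵐ x, 0 < J f x ∧ (((√(J f x))⁻¹ - 1 : ℝ) : ℂ) = val₁ (invSqrt (inA W, inD W)) x := by
  filter_upwards [(rep_inA hf).ae_eq_val, (rep_inD hf).ae_eq_val] with x a q
  refine pos_and_eq_inv_sqrt (by unfold J; positivity) ?_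
    ((isWeight₁.norm_val_le _ x).trans_lt ha.2)
  have h := val₁_sqrtDefect ha.1 x
  change _ = val₁ _ _ at a q
  rw [← a, ← q] at h
  unfold J
  push_cast
  exact h

theorem rep_invSqrt (ha : Admissible W) (hf : isWeight₂.Rep f W) :
    isWeight₁.Rep (fun x => (√(J f x))⁻¹ - 1) (invSqrt (inA W, inD W)) :=
  IsWeight.rep_of_ae_eq_val ((ae_J_pos_and_eq ha hf).mono fun _ h => h.2)

/-- With a = |D|f and q = f_α, the linear terms cancel by |D|² = -∂_α². The quadratic remnants
∂_α(qa), |D|(q²) and |D|(a²) cancel by `outD_mul_eq`, leaving the two cubic terms. -/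
theorem hasFT_capillary (σ : ℝ) (ha : Admissible W) (hf : isWeight₂.Rep f W) :
    HasFT (fun x => σ * absDSq f x - σ / 2 * absD (fun y => absD f y ^ 2) x - capillary σ f x)
      (σ • outD (capSin (inA W, inD W)) - σ • outA (capCos (inA W, inD W)) : L2C) := by
  have hy := rep_invSqrt ha hf
  have hA := rep_inA hf
  have hD := rep_inD hf
  have h1 : isWeight₁.Rep (fun y => dα f y / √(J f y))
      (inD W + mul₁ (inD W) (invSqrt (inA W, inD W))) := by
    convert hD.add (hD.mul hy) using 2 with x
    ring
  have h2 : isWeight₁.Rep (fun y => (1 + absD f y) / √(J f y) - 1)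
      (inA W + invSqrt (inA W, inD W) + mul₁ (inA W) (invSqrt (inA W, inD W))) := by
    convert (hA.add hy).add (hA.mul hy) using 2 with x
    ring
  have h3 : isWeight₁.Rep (fun y => absD f y ^ 2) (mul₁ (inA W) (inA W)) := by
    convert hA.mul hA using 2 with x
    ring
  have h4 := (((hasFT_absDSq hf).const_mul_coe σ).sub_coe
    ((hasFT_outA h3).const_mul_coe (σ / 2))).sub_coe
    (((hasFT_outD h1).const_mul_coe (-σ)).add_coe ((hasFT_outA h2).const_mul_coe σ))
  have e : outD (mul₁ (inD W) (inA W)) = (2⁻¹ : ℝ) •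
      (outA (mul₁ (inD W) (inD W)) - outA (mul₁ (inA W) (inA W))) := by
    rw [← outD_mul_eq W, smul_smul, isWeight₁.mul_comm' (inD W)]
    norm_num
  refine h4.congr_right (.of_eq (congrArg (fun Φ : L2C => (Φ : ℝ → ℂ)) ?_))
  simp only [capSin, capCos, map_add, e, map_smul]
  module

end
end Babenko

namespace Babenko
noncomputable section

open scoped Topology ENNReal NNReal

/-! ### The remainder equation as a fixed-point equation -/

section Terms

variable {f : ℝ → ℝ} {W : L2C}

theorem hasFT_quadForm (g γ σ : ℝ) (hf : isWeight₂.Rep f W) :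
    HasFT (fun y => γ ^ 2 / 2 * f y ^ 2 + g * f y * absD f y + g / 2 * absD (fun z => f z ^ 2) y
        - σ / 2 * absD (fun z => absD f z ^ 2) y) (quadForm g γ σ W W) := by
  have hI := rep_inI hf
  have hA := rep_inA hf
  have h1 : isWeight₁.Rep (fun z => f z ^ 2) (mul₁ (inI W) (inI W)) := by
    simpa only [← sq] using hI.mul hI
  have h2 : isWeight₁.Rep (fun z => absD f z ^ 2) (mul₁ (inA W) (inA W)) := by
    simpa only [← sq] using hA.mul hA
  have h3 := (((hasFT_outI ((h1.const_mul (γ ^ 2 / 2)).add ((hI.mul hA).const_mul g))).add_coe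
    ((hasFT_outA h1).const_mul_coe (g / 2))).sub_coe ((hasFT_outA h2).const_mul_coe (σ / 2)))
  refine (h3.congr_left (.of_forall fun x => by ring)).congr_right
    (.of_eq (congrArg (fun Φ : L2C => (Φ : ℝ → ℂ)) ?_))
  simp only [quadForm, map_sub, map_smul]
  abel

/-- The explicit ∂_α((U_α)³) cancels the one inside `remR`, so it leaves no trace in `cubicTerms`.
-/
theorem hasFT_cubicTerms (γ σ : ℝ) (ha : Admissible W) (hf : isWeight₂.Rep f W) :
    HasFT (fun y => -(σ / 2 * dα (fun z => dα f z ^ 3) y)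
        + γ ^ 2 / 2 * (f y * absD (fun z => f z ^ 2) y) - γ ^ 2 / 2 * (f y ^ 2 * absD f y)
        - γ ^ 2 / 6 * absD (fun z => f z ^ 3) y - remR σ f y) (cubicTerms γ σ W) := by
  have hI := rep_inI hf
  have hA := rep_inA hf
  -- The square is formed in H², because |D| of it must lie in H¹ to be multiplied once more.
  have h1 : isWeight₂.Rep (fun z => f z ^ 2) (mul₂ W W) := by
    simpa only [← sq] using IsWeight.Rep.mul hf hf
  have h3 : isWeight₁.Rep (fun z => f z ^ 3) (mul₁ (mul₁ (inI W) (inI W)) (inI W)) := by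
    simpa only [← sq, ← pow_succ] using (hI.mul hI).mul hI
  have h4 := ((hasFT_outI (((hI.mul (rep_inA h1)).const_mul (γ ^ 2 / 2)).sub
    (((hI.mul hI).mul hA).const_mul (γ ^ 2 / 2)))).sub_coe
      ((hasFT_outA h3).const_mul_coe (γ ^ 2 / 6))).add_coe (hasFT_capillary σ ha hf)
  refine (h4.congr_left (.of_forall fun x => ?_)).congr_right
    (.of_eq (congrArg (fun Φ : L2C => (Φ : ℝ → ℂ)) ?_))
  · simp only [remR]
    ring
  · simp only [cubicTerms]
    abel

end Terms

theorem rep_coe (u : H2) : isWeight₂.Rep u (weightedL u) :=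
  (hasFT_coe (H2.toL2 u)).congr_right (unw_weightedL u).symm

theorem H2.coe_add (u v : H2) : (u + v : H2) =ᵐ[volume] fun x => u x + v x := by
  rw [map_add]; exact Lp.coeFn_add _ _

theorem H2.coe_sub (u v : H2) : (u - v : H2) =ᵐ[volume] fun x => u x - v x := by
  rw [map_sub]; exact Lp.coeFn_sub _ _

theorem H2.coe_neg (u : H2) : (-u : H2) =ᵐ[volume] fun x => -u x := by
  rw [map_neg]; exact Lp.coeFn_neg _

section Link

variable {g γ σ cs w δ : ℝ} (hB : InvLBdd g γ σ cs w δ)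

theorem F_ae {f : ℝ → ℝ} {U : H2} (hf : f =ᵐ[volume] U) :
    F g γ σ cs w δ f =ᵐ[volume] (quadMap hB U : H2) := by
  have h := HasFT.invL_ae hB (hasFT_quadForm g γ σ ((rep_coe U).congr_left hf.symm))
  have e : (quadMap hB U : H2) = -(invLX2 hB (quadForm g γ σ (weightedL U) (weightedL U)) : H2) :=
    rfl
  rw [e]
  filter_upwards [h, H2.coe_neg (invLX2 hB (quadForm g γ σ (weightedL U) (weightedL U)) : H2)]
    with x h1 h2
  rw [h2, ← h1]
  rfl

theorem fullArg_ae (x : X1 w δ) (y : X2 w δ) :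
    (fun s => (x : H2) s + F g γ σ cs w δ (x : H2) s + (y : H2) s) =ᵐ[volume]
      fullArg hB (x, y) := by
  filter_upwards [F_ae hB (f := (x : H2)) .rfl, H2.coe_add (corrected hB x) y,
    H2.coe_add (x : H2) (quadMap hB x)] with s h1 h2 h3
  rw [fullArg, h2, corrected, h3, h1]

/-- The symbol vanishes on the band, and the transform of x vanishes off it. -/
theorem invLX2_outI_eq_zero {k : ℝ → ℂ} (hk : FirstOrder k) (x : X1 w δ) :
    invLX2 hB (outI (opIn hk (weightedL x))) = 0 := by
  apply Subtype.ext
  rw [coe_invLX2]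
  have : bmul _ hB (outI (opIn hk (weightedL (x : H2)))) = 0 := by
    rw [Lp.eq_zero_iff_ae_eq_zero]
    filter_upwards [bmul_ae _ hB (outI (opIn hk (weightedL (x : H2)))),
      opOut_ae firstOrder_symOne (opIn hk (weightedL (x : H2))), unw_opIn hk (weightedL (x : H2)),
      unw_weightedL (x : H2), x.2] with η h1 h2 h3 h4 h5
    rw [h1, h2, h3, h4]
    by_cases h : 2 * π * η ∈ band w δ
    · simp [invLSymbol_eq_zero h]
    · simp [h5 h]
  rw [this, map_zero]
  rfl

/-- The right-hand side of the remainder equation as a map from `𝒳₁ × 𝒳₂` to `𝒳₂`. -/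
def rhsMap (c : ℝ) : X1 w δ × X2 w δ → X2 w δ :=
  perturbedMap (nonlinearPart hB) (quadX1 hB) (linI hB) (linA hB) (cs - c) (c ^ 2 - cs ^ 2)

/-- Shows that every multiplier in the equation is applied inside its domain, so the conventional
value 0 never occurs and the concrete equation coincides with the abstract one. -/
theorem rhs_ae {c : ℝ} {x : X1 w δ} {y : X2 w δ}
    (ha : Admissible (weightedL (fullArg hB (x, y)))) :
    rhs g γ σ cs c w δ (x : H2)
        (fun s => (x : H2) s + F g γ σ cs w δ (x : H2) s + (y : H2) s) =ᵐ[volume]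
      (rhsMap hB c (x, y) : H2) := by
  have hae := fullArg_ae hB x y
  obtain ⟨f, hf⟩ : ∃ f, f = fun s => (x : H2) s + F g γ σ cs w δ (x : H2) s + (y : H2) s :=
    ⟨_, rfl⟩
  rw [← hf] at hae ⊢
  obtain ⟨V, hV⟩ : ∃ V, V = fullArg hB (x, y) := ⟨_, rfl⟩
  rw [← hV] at hae ha
  have hr : isWeight₂.Rep f (weightedL V) := (rep_coe V).congr_left hae.symm
  have h1 := HasFT.invL_ae hB (((hasFT_outI (((rep_inI hr).const_mul ((cs - c) * γ)).add
    ((rep_inA hr).const_mul (c ^ 2 - cs ^ 2)))).add_coe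
      (hasFT_cubicTerms γ σ ha hr)).congr_left (g := fun y =>
      (cs - c) * γ * f y + (c ^ 2 - cs ^ 2) * absD f y
        - σ / 2 * dα (fun z => dα f z ^ 3) y
        + γ ^ 2 / 2 * (f y * absD (fun z => f z ^ 2) y)
        - γ ^ 2 / 2 * (f y ^ 2 * absD f y)
        - γ ^ 2 / 6 * absD (fun z => f z ^ 3) y
        - remR σ f y) (.of_forall fun s => by ring))
  have e : rhsMap hB c (x, y) = invLX2 hB (outI (((cs - c) * γ) • inI (weightedL V) +
        (c ^ 2 - cs ^ 2) • inA (weightedL V)) + cubicTerms γ σ (weightedL V)) +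
          quadMap hB V - quadMap hB x := by
    have hW : weightedL V = weightedL (x : H2) + weightedX2 (quadX1 hB x + y) := by
      rw [hV, fullArg, corrected, add_assoc, map_add]; rfl
    have hI : invLX2 hB (outI (inI (weightedL V))) =
        invLX2 hB (outI (inI (weightedX2 (quadX1 hB x + y)))) := by
      rw [hW, map_add, map_add, map_add, invLX2_outI_eq_zero, zero_add]
    have hA : invLX2 hB (outI (inA (weightedL V))) =
        invLX2 hB (outI (inA (weightedX2 (quadX1 hB x + y)))) := by
      rw [hW, map_add, map_add, map_add, invLX2_outI_eq_zero, zero_add]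
    have hl : invLX2 hB (outI (((cs - c) * γ) • inI (weightedL V) +
        (c ^ 2 - cs ^ 2) • inA (weightedL V)) + cubicTerms γ σ (weightedL V)) =
        ((cs - c) * γ) • invLX2 hB (outI (inI (weightedL V))) +
          (c ^ 2 - cs ^ 2) • invLX2 hB (outI (inA (weightedL V))) + cubicMap hB V := by
      simp only [map_add, map_smul, cubicMap]
    rw [hl, hI, hA, mul_smul]
    have : rhsMap hB c (x, y) = (cubicMap hB (fullArg hB (x, y)) +
        (quadMap hB (fullArg hB (x, y)) - quadMap hB x)) +
          ((cs - c) • (γ • invLX2 hB (outI (inI (weightedX2 (quadX1 hB x + y))))) +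
          (c ^ 2 - cs ^ 2) • invLX2 hB (outI (inA (weightedX2 (quadX1 hB x + y))))) := rfl
    rw [this, ← hV]
    abel
  rw [e]
  obtain ⟨P, hP⟩ : ∃ P, P = invLX2 hB (outI (((cs - c) * γ) • inI (weightedL V) +
        (c ^ 2 - cs ^ 2) • inA (weightedL V)) + cubicTerms γ σ (weightedL V)) := ⟨_, rfl⟩
  rw [← hP] at h1 ⊢
  have e2 : ((P + quadMap hB V - quadMap hB x : X2 w δ) : H2) =
      ((P : H2) + (quadMap hB V : H2)) - (quadMap hB x : H2) := rfl
  rw [e2]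
  filter_upwards [h1, F_ae hB hae, F_ae hB (f := (x : H2)) .rfl,
    H2.coe_sub ((P : H2) + (quadMap hB V : H2)) (quadMap hB x : H2),
    H2.coe_add (P : H2) (quadMap hB V : H2)] with s a1 a2 a3 a4 a5
  rw [rhs, a1, a2, a3, a4, a5]

theorem X2.ext_ae {u v : X2 w δ} (h : (u : H2) =ᵐ[volume] (v : H2)) : u = v :=
  Subtype.ext (H2.toL2_injective (Lp.ext h))

theorem remainderEq_iff {c : ℝ} {x : X1 w δ} {y : X2 w δ}
    (ha : Admissible (weightedL (fullArg hB (x, y)))) :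
    RemainderEq g γ σ cs c w δ (x : H2) (y : H2) ↔
      y = rhsMap hB c (x, y) := by
  have h := rhs_ae hB (c := c) ha
  constructor
  · exact fun h1 => X2.ext_ae (h1.trans h)
  · intro h1
    have h2 : (y : H2) =ᵐ[volume] (rhsMap hB c (x, y) : H2) := by rw [← h1]
    exact h2.trans h.symm

theorem ae_J_pos {U : H2} (ha : Admissible (weightedL U)) : ∀ᵐ x : ℝ, 0 < J U x :=
  (ae_J_pos_and_eq ha (rep_coe U)).mono fun _ h => h.1

end Link

end
end Babenko

namespace Babenko
noncomputable section

open scoped Topology ENNReal NNReal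

/-! ### The symbol of `L(D)` at a critical velocity -/

section Symbol

variable {g γ σ cs w δ : ℝ}

/-- Criticality is the vanishing of the discriminant, so c⁎² = -2σω and g + c⁎γ = σω², and the
symbol is a perfect square. -/
theorem ell_eq (hcs : cs ^ 4 = 4 * σ * (g + cs * γ)) (hw : w < 0)
    (hdisp : σ * w ^ 2 + cs ^ 2 * w + (g + cs * γ) = 0) (ξ : ℝ) :
    ell g γ σ cs ξ = σ * (|ξ| - |w|) ^ 2 := by
  have h1 : (2 * σ * w + cs ^ 2) ^ 2 = 0 := by linear_combination 4 * σ * hdisp + hcs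
  have h2 : cs ^ 2 = -2 * σ * w := by
    have := pow_eq_zero_iff (two_ne_zero) |>.1 h1
    linarith
  have h3 : g + cs * γ = σ * w ^ 2 := by
    rw [h2] at hdisp; linarith
  rw [ell, h3, h2, abs_of_neg hw]
  ring

theorem le_abs_sub_of_notMem_band {ξ : ℝ} (h : ξ ∉ band w δ) : δ ≤ |(|ξ| - |w|)| := by
  by_contra! hlt
  rw [abs_lt] at hlt
  apply h
  rcases abs_cases ξ with ⟨h1, h2⟩ | ⟨h1, h2⟩
  · right; constructor <;> linarith
  · left; constructor <;> linarith

theorem abs_le_of_mem_band {ξ : ℝ} (hw : δ < |w|) (h : ξ ∈ band w δ) : |ξ| ≤ |w| + δ := by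
  rw [abs_le]
  rcases h with h | h <;> constructor <;> linarith [h.1, h.2]

theorem invLBdd (hσ : 0 < σ) (hcs : cs ^ 4 = 4 * σ * (g + cs * γ)) (hw : w < 0)
    (hdisp : σ * w ^ 2 + cs ^ 2 * w + (g + cs * γ) = 0) (hδ : 0 < δ) :
    InvLBdd g γ σ cs w δ := by
  have hχ : Measurable (χ w δ) := measurable_one.indicator (measurableSet_band w δ)
  have hell : Measurable (ell g γ σ cs) := by unfold ell; fun_prop
  have hwt : Measurable weight := Complex.measurable_ofReal.comp isWeight₂.measurable
  refine .of_le (hwt.mul (Complex.measurable_ofReal.comp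
    (((measurable_const.sub hχ).div hell).comp (by fun_prop : Measurable fun η : ℝ => 2 * π * η))))
    (((1 + 2 * w ^ 2) / δ ^ 2 + 2) / σ) fun η => ?_
  obtain ⟨ξ, hξ⟩ : ∃ ξ, ξ = 2 * π * η := ⟨_, rfl⟩
  have hwe : weight η = ((1 + ξ ^ 2 : ℝ) : ℂ) := by rw [hξ]; rfl
  rw [← hξ, hwe]
  by_cases h : ξ ∈ band w δ
  · rw [invLSymbol_eq_zero h, mul_zero, norm_zero]
    positivity
  · have hd := le_abs_sub_of_notMem_band h
    have hd2 : δ ^ 2 ≤ (|ξ| - |w|) ^ 2 := by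
      rw [← sq_abs (|ξ| - |w|)]; gcongr
    have hd0 : 0 < (|ξ| - |w|) ^ 2 := by nlinarith
    -- From ξ² ≤ 2(|ξ| - |ω|)² + 2ω², with the constant part paid for by (|ξ| - |ω|)² ≥ δ² off the
    -- band.
    have hx : 1 + ξ ^ 2 ≤ ((1 + 2 * w ^ 2) / δ ^ 2 + 2) * (|ξ| - |w|) ^ 2 := by
      have h1 : 1 + 2 * w ^ 2 ≤ (1 + 2 * w ^ 2) / δ ^ 2 * (|ξ| - |w|) ^ 2 := by
        rw [div_mul_eq_mul_div, le_div_iff₀ (by positivity)]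
        gcongr
      nlinarith [sq_abs ξ, sq_abs w, sq_nonneg (|ξ| - 2 * |w|)]
    rw [invLSymbol, χ, Set.indicator_of_notMem h, ell_eq hcs hw hdisp, ← Complex.ofReal_mul,
      Complex.norm_real, norm_eq_abs, abs_of_nonneg (by rw [sub_zero]; positivity), sub_zero,
      mul_one_div, div_le_div_iff₀ (by positivity) hσ]
    nlinarith

end Symbol

/-! ### The scaled norm -/

theorem norm_L2C_eq (Φ : L2C) : ‖Φ‖ = √(∫ η, ‖Φ η‖ ^ 2) := by
  have h := L2.inner_def (𝕜 := ℂ) Φ Φ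
  rw [inner_self_eq_norm_sq_to_K] at h
  have h2 : (∫ η, inner ℂ (Φ η) (Φ η)) = ((∫ η, ‖Φ η‖ ^ 2 : ℝ) : ℂ) := by
    refine Eq.trans ?_ (integral_ofReal (𝕜 := ℂ))
    congr 1; ext η
    rw [inner_self_eq_norm_sq_to_K]
    push_cast; rfl
  rw [h2] at h
  have h3 : ‖Φ‖ ^ 2 = ∫ η, ‖Φ η‖ ^ 2 := by
    have : ((‖Φ‖ ^ 2 : ℝ) : ℂ) = ((∫ η, ‖Φ η‖ ^ 2 : ℝ) : ℂ) := by
      rw [← h]; push_cast; rfl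
    exact_mod_cast this
  rw [← h3, sqrt_sq (norm_nonneg _)]

/-- The weight `(1 + ε⁻² (|ξ| - |ω|)²)^(1/2)` at `ξ = 2π η`. -/
def scaledWeight (ε w η : ℝ) : ℝ := √(1 + (ε ^ 2)⁻¹ * (|2 * π * η| - |w|) ^ 2)

theorem one_le_scaledWeight (ε w η : ℝ) : 1 ≤ scaledWeight ε w η := by
  rw [scaledWeight, one_le_sqrt]
  have : 0 ≤ (ε ^ 2)⁻¹ * (|2 * π * η| - |w|) ^ 2 := by positivity
  linarith

theorem measurable_scaledWeight (ε w : ℝ) : Measurable (scaledWeight ε w) := by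
  unfold scaledWeight; fun_prop

/-- The symbol of the scaled norm with respect to the norm of `H²`. -/
def scaledSymbol (ε w δ η : ℝ) : ℂ :=
  (band w δ).indicator 1 (2 * π * η) * ((scaledWeight ε w η * (weight₂ η)⁻¹ : ℝ) : ℂ)

variable {w δ : ℝ}

theorem bddSymbol_scaledSymbol (hδ : δ < |w|) (ε : ℝ) : BddSymbol (scaledSymbol ε w δ) := by
  refine .of_le ((bddSymbol_indicator (measurableSet_band w δ)).1.mul (Complex.measurable_ofReal.comp
    ((measurable_scaledWeight ε w).mul isWeight₂.measurable.inv)))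
    (√(1 + (ε ^ 2)⁻¹ * (|w| + δ + |w|) ^ 2)) fun η => ?_
  rw [scaledSymbol]
  by_cases h : 2 * π * η ∈ band w δ
  · have h1 := abs_le_of_mem_band hδ h
    have h2 := isWeight₂.pos η
    have h3 := one_le_scaledWeight ε w η
    rw [Set.indicator_of_mem h, Pi.one_apply, one_mul, Complex.norm_real, norm_eq_abs,
      abs_of_pos (by positivity)]
    refine (mul_le_of_le_one_right (by positivity)
      (inv_le_one_of_one_le₀ (isWeight₂.one_le η))).trans ?_
    unfold scaledWeight
    gcongr √(1 + _ * ?_)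
    refine sq_le_sq' ?_ ?_ <;> linarith [abs_nonneg (2 * π * η), abs_nonneg w]
  · rw [Set.indicator_of_notMem h, zero_mul, norm_zero]
    positivity

/-- The map `u ↦ (1 + ε⁻² (|ξ| - |ω|)²)^(1/2) û` on `𝒳₁`. -/
def scaledL (hδ : δ < |w|) (ε : ℝ) : X1 w δ →L[ℝ] L2C :=
  bmul _ (bddSymbol_scaledSymbol hδ ε) ∘L weightedL ∘L (X1 w δ).subtypeL

theorem scaledL_ae (hδ : δ < |w|) (ε : ℝ) (u : X1 w δ) :
    scaledL hδ ε u =ᵐ[volume] fun η => (scaledWeight ε w η : ℂ) * H2.hat u η := by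
  have h1 : scaledL hδ ε u =ᵐ[volume] _ :=
    bmul_ae _ (bddSymbol_scaledSymbol hδ ε) (weightedL (u : H2))
  filter_upwards [h1, weightedL_ae (u : H2), u.2] with η a b c
  rw [a, b, scaledSymbol]
  by_cases h : 2 * π * η ∈ band w δ
  · have := Complex.ofReal_ne_zero.2 (isWeight₂.pos η).ne'
    rw [Set.indicator_of_mem h, weight_eq]
    push_cast
    field_simp
    simp
  · rw [Set.indicator_of_notMem h, c h]; simp

theorem normE_eq (hδ : δ < |w|) (ε : ℝ) (u : X1 w δ) : normE ε w u = ‖scaledL hδ ε u‖ := by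
  rw [norm_L2C_eq, normE]
  congr 1
  refine integral_congr_ae ?_
  filter_upwards [scaledL_ae hδ ε u] with η h
  rw [h, norm_mul, mul_pow, Complex.norm_real, norm_eq_abs, sq_abs, scaledWeight,
    sq_sqrt (by positivity)]

/-- On the band the weight 1 + ξ² is at most 1 + (|ω| + δ)², so on 𝒳₁ only the scaled weight
matters. -/
theorem norm_weightedL_apply_le (hδ : δ < |w|) (ε : ℝ) (u : X1 w δ) :
    ∀ᵐ η, ‖weightedL (u : H2) η‖ ≤
      (1 + (|w| + δ) ^ 2) * ((scaledWeight ε w η)⁻¹ * ‖scaledL hδ ε u η‖) := by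
  filter_upwards [scaledL_ae hδ ε u, weightedL_ae (u : H2), u.2] with η a b c
  have h3 := one_le_scaledWeight ε w η
  rw [a, b, norm_mul, norm_mul, Complex.norm_real, norm_eq_abs,
    abs_of_pos (zero_lt_one.trans_le h3), inv_mul_cancel_left₀ (zero_lt_one.trans_le h3).ne']
  by_cases h : 2 * π * η ∈ band w δ
  · have h1 := abs_le_of_mem_band hδ h
    gcongr
    rw [weight_eq, Complex.norm_real, norm_eq_abs, abs_of_pos (isWeight₂.pos η), weight₂,
      ← sq_abs (2 * π * η)]
    gcongr
  · simp [c h]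

theorem norm_le_normE (hδ : δ < |w|) (ε : ℝ) (u : X1 w δ) :
    ‖u‖ ≤ (1 + (|w| + δ) ^ 2) * normE ε w u := by
  rw [normE_eq hδ]
  change ‖weightedL (u : H2)‖ ≤ _
  refine Lp.norm_le_mul_norm_of_ae_le_mul ?_
  filter_upwards [norm_weightedL_apply_le hδ ε u] with η h
  refine h.trans ?_
  gcongr
  exact mul_le_of_le_one_left (norm_nonneg _) (inv_le_one_of_one_le₀ (one_le_scaledWeight ε w η))

theorem integrable_cauchy {ε : ℝ} (hε : 0 < ε) (a : ℝ) :
    Integrable fun η : ℝ => (1 + ((2 * π / ε) * (η - a)) ^ 2)⁻¹ :=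
  (integrable_inv_one_add_sq.comp_mul_left' (by positivity : 2 * π / ε ≠ 0)).comp_sub_right a

theorem integral_cauchy {ε : ℝ} (hε : 0 < ε) (a : ℝ) :
    ∫ η : ℝ, (1 + ((2 * π / ε) * (η - a)) ^ 2)⁻¹ = ε / 2 := by
  rw [integral_sub_right_eq_self (fun η : ℝ => (1 + ((2 * π / ε) * η) ^ 2)⁻¹) a,
    Measure.integral_comp_mul_left (fun η : ℝ => (1 + η ^ 2)⁻¹), integral_univ_inv_one_add_sq,
    abs_of_pos (by positivity), smul_eq_mul]
  field_simp

/-- Each sign of η selects one of two Cauchy profiles of width proportional to ε centred at ±|ω|.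
Each has integral ε/2, so the square integral is at most ε. -/
theorem inv_scaledWeight_sq_le {ε : ℝ} (hε : 0 < ε) (w η : ℝ) :
    (scaledWeight ε w η)⁻¹ ^ 2 ≤ (1 + ((2 * π / ε) * (η - |w| / (2 * π))) ^ 2)⁻¹ +
      (1 + ((2 * π / ε) * (η - -(|w| / (2 * π)))) ^ 2)⁻¹ := by
  rw [inv_pow, scaledWeight, sq_sqrt (by positivity)]
  have hp := pi_pos
  rcases le_total 0 η with h | h
  · refine le_add_of_le_of_nonneg (le_of_eq ?_) (by positivity)
    rw [abs_of_nonneg (by positivity)]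
    congr 2
    field_simp
  · refine le_add_of_nonneg_of_le (by positivity) (le_of_eq ?_)
    rw [abs_of_nonpos (mul_nonpos_of_nonneg_of_nonpos (by positivity) h)]
    congr 2
    field_simp
    ring

theorem eLpNorm_inv_scaledWeight_le {ε : ℝ} (hε : 0 < ε) (w : ℝ) :
    eLpNorm (fun η => (scaledWeight ε w η)⁻¹) 2 volume ≤ ENNReal.ofReal √ε := by
  rw [← eLpNorm_enorm]
  have : eLpNorm (fun η => ‖(scaledWeight ε w η)⁻¹‖ₑ) 2 volume ^ 2 ≤ ENNReal.ofReal √ε ^ 2 := by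
    rw [eLpNorm_two_sq, ← ENNReal.ofReal_pow (sqrt_nonneg _), sq_sqrt hε.le]
    have i1 := integrable_cauchy hε (|w| / (2 * π))
    have i2 := integrable_cauchy hε (-(|w| / (2 * π)))
    calc ∫⁻ η, ‖(scaledWeight ε w η)⁻¹‖ₑ ^ 2
        ≤ ∫⁻ η, ENNReal.ofReal ((1 + ((2 * π / ε) * (η - |w| / (2 * π))) ^ 2)⁻¹ +
          (1 + ((2 * π / ε) * (η - -(|w| / (2 * π)))) ^ 2)⁻¹) := by
          refine lintegral_mono fun η => ?_
          rw [← ofReal_norm, ← ENNReal.ofReal_pow (norm_nonneg _), norm_eq_abs, sq_abs]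
          exact ENNReal.ofReal_le_ofReal (inv_scaledWeight_sq_le hε w η)
      _ = ENNReal.ofReal (∫ η, ((1 + ((2 * π / ε) * (η - |w| / (2 * π))) ^ 2)⁻¹ +
          (1 + ((2 * π / ε) * (η - -(|w| / (2 * π)))) ^ 2)⁻¹)) := by
          refine (ofReal_integral_eq_lintegral_ofReal (i1.add i2) ?_).symm
          filter_upwards with η
          simp only [Pi.add_apply, Pi.zero_apply]
          positivity
      _ = ENNReal.ofReal ε := by
          rw [integral_add i1 i2, integral_cauchy hε, integral_cauchy hε, add_halves]
  exact (ENNReal.pow_le_pow_left_iff two_ne_zero).1 this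

/-- Cauchy–Schwarz against the reciprocal of the scaled weight, whose L² norm is at most √ε. -/
theorem wnorm_weightedL_le {ε : ℝ} (hε : 0 < ε) (hδ : δ < |w|) (u : X1 w δ) :
    wnorm (weightedL (u : H2)) ≤ ENNReal.ofReal ((1 + (|w| + δ) ^ 2) * √ε * normE ε w u) := by
  have h := eLpNorm_smul_le_mul_eLpNorm (p := 2) (q := 2) (r := 1) (f := scaledL hδ ε u)
    (φ := fun η => (scaledWeight ε w η)⁻¹) (Lp.aestronglyMeasurable _)
    (measurable_scaledWeight ε w).inv.aestronglyMeasurable (μ := volume)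
  have h1 : wnorm (weightedL (u : H2)) ≤ ENNReal.ofReal (1 + (|w| + δ) ^ 2) *
      eLpNorm ((fun η => (scaledWeight ε w η)⁻¹) • (scaledL hδ ε u : ℝ → ℂ)) 1 volume := by
    refine eLpNorm_le_mul_eLpNorm_of_ae_le_mul ?_ _
    filter_upwards [norm_weightedL_apply_le hδ ε u] with η hη
    refine hη.trans (le_of_eq ?_)
    rw [Pi.smul_apply', norm_smul, norm_inv, norm_eq_abs,
      abs_of_pos (zero_lt_one.trans_le (one_le_scaledWeight ε w η))]
  refine h1.trans ((mul_le_mul_right (h.trans (mul_le_mul_left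
    (eLpNorm_inv_scaledWeight_le hε w) _)) _).trans (le_of_eq ?_))
  rw [IsWeight.eLpNorm_coe, normE_eq hδ, ← ENNReal.ofReal_mul (sqrt_nonneg _),
    ← ENNReal.ofReal_mul (by positivity), mul_assoc]

theorem normHatL1_le (u : H2) :
    normHatL1 u ≤ √(2 * π) * (isWeight₂.const.toReal * ‖u‖) := by
  unfold normHatL1
  gcongr
  have h := isWeight₂.eLpNorm_unw_one_le (weightedL u)
  rw [eLpNorm_congr_ae (unw_weightedL u), norm_weightedL] at h
  have h1 : Integrable (H2.hat u) := (isWeight₂.integrable_unw _).congr (unw_weightedL u)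
  rw [integral_norm_eq_lintegral_enorm h1.1, ← eLpNorm_one_eq_lintegral_enorm]
  refine ENNReal.toReal_le_of_le_ofReal (by positivity) (h.trans_eq ?_)
  rw [ENNReal.ofReal_mul ENNReal.toReal_nonneg, ENNReal.ofReal_toReal isWeight₂.const_ne_top]

/-- The ball is the preimage of a closed ball under a bounded linear map, hence convex with
interior, so derivatives within it are well defined up to the boundary. -/
theorem uniqueDiffOn_ballE (hδ : δ < |w|) (ε : ℝ) {R : ℝ} (hR : 0 < R) :
    UniqueDiffOn ℝ (ballE ε w δ R) := by
  have e : ballE ε w δ R = scaledL hδ ε ⁻¹' Metric.closedBall 0 R := by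
    ext u
    rw [Set.mem_preimage, mem_closedBall_zero_iff, ← normE_eq hδ]
    rfl
  rw [e]
  refine uniqueDiffOn_convex ((convex_closedBall _ _).linear_preimage (scaledL hδ ε).toLinearMap)
    ⟨0, ?_⟩
  refine interior_mono (Set.preimage_mono Metric.ball_subset_closedBall) ?_
  rw [(Metric.isOpen_ball.preimage (scaledL hδ ε).continuous).interior_eq]
  simpa using hR

end
end Babenko

/-! ### The radius on which the equation makes sense -/

namespace Babenko
noncomputable section

open scoped Topology ENNReal NNReal

section Radius

variable {g γ σ cs w δ : ℝ} (hB : InvLBdd g γ σ cs w δ)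

/-- All the conditions are open and hold at 0. The radius refers to the H² norm, so it does not
depend on ε. -/
theorem exists_radius {M : ℝ} (hM : 0 < M) : ∃ r > 0, ∀ x : X1 w δ, ‖x‖ ≤ r →
    ContDiffAt ℝ ((⊤ : ℕ∞) : WithTop ℕ∞) (quadX1 hB) x ∧ normHatL1 (x : H2) < M / 2 ∧
      ∀ y : X2 w δ, ‖y‖ ≤ r →
        Admissible (weightedL (fullArg hB (x, y))) ∧ ‖quadX1 hB x + y‖ < M / 2 := by
  have h1 : ∀ᶠ x in 𝓝 (0 : X1 w δ), ContDiffAt ℝ ((⊤ : ℕ∞) : WithTop ℕ∞) (quadX1 hB) x := by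
    filter_upwards [(contDiffAt_quadX1 hB).eventually (by simp)] with x hx using hx.of_le le_top
  have h2 : ∀ᶠ x in 𝓝 (0 : X1 w δ), √(2 * π) * (isWeight₂.const.toReal * ‖x‖) < M / 2 := by
    have : Filter.Tendsto (fun x : X1 w δ => √(2 * π) * (isWeight₂.const.toReal * ‖x‖)) (𝓝 0)
        (𝓝 0) := Continuous.tendsto' (by fun_prop) _ _ (by simp)
    exact this.eventually_lt_const (by positivity)
  have h3 : ∀ᶠ p in 𝓝 (0 : X1 w δ × X2 w δ), Admissible (weightedL (fullArg hB p)) := by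
    have : Filter.Tendsto (fun p => weightedL (fullArg hB p)) (𝓝 (0 : X1 w δ × X2 w δ))
        (𝓝 0) := by
      have h := weightedL.continuous.continuousAt.comp (contDiffAt_fullArg hB).continuousAt
      rwa [ContinuousAt, Function.comp_apply, fullArg_zero, map_zero] at h
    exact this.eventually eventually_admissible
  have h4 : ∀ᶠ p in 𝓝 (0 : X1 w δ × X2 w δ), ‖quadX1 hB p.1 + p.2‖ < M / 2 := by
    have hc : ContinuousAt (fun p : X1 w δ × X2 w δ => quadX1 hB p.1) 0 :=
      ContinuousAt.comp (g := quadX1 hB) (f := Prod.fst) (contDiffAt_quadX1 hB).continuousAt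
        continuousAt_fst
    have := (hc.add continuousAt_snd).norm
    refine Filter.Tendsto.eventually_lt_const (u := M / 2) ?_ this
    simpa [quadX1_zero] using hM
  obtain ⟨ρ₁, hρ₁, H₁⟩ := Metric.eventually_nhds_iff_ball.1 (h1.and h2)
  obtain ⟨ρ₂, hρ₂, H₂⟩ := Metric.eventually_nhds_iff_ball.1 (h3.and h4)
  have hlt : min ρ₁ ρ₂ / 2 < min ρ₁ ρ₂ := half_lt_self (by positivity)
  refine ⟨min ρ₁ ρ₂ / 2, by positivity, fun x hx => ?_⟩
  have hx1 := H₁ x (by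
    rw [mem_ball_zero_iff]; exact hx.trans_lt (hlt.trans_le (min_le_left _ _)))
  refine ⟨hx1.1, (normHatL1_le (x : H2)).trans_lt hx1.2, fun y hy => H₂ (x, y) ?_⟩
  rw [mem_ball_zero_iff, Prod.norm_mk]
  exact max_lt (hx.trans_lt (hlt.trans_le (min_le_right _ _)))
    (hy.trans_lt (hlt.trans_le (min_le_right _ _)))

theorem quadX1_add_ae (x : X1 w δ) (y : X2 w δ) :
    ((quadX1 hB x + y : X2 w δ) : H2) =ᵐ[volume]
      fun s => F g γ σ cs w δ (x : H2) s + (y : H2) s := by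
  filter_upwards [F_ae hB (f := (x : H2)) .rfl, H2.coe_add (quadX1 hB x : H2) y] with s h1 h2
  rw [Submodule.coe_add, h2, h1]
  rfl

theorem fullArg_eq (x : X1 w δ) (y : X2 w δ) :
    fullArg hB (x, y) = (x : H2) + ((quadX1 hB x + y : X2 w δ) : H2) := add_assoc _ _ _

end Radius

theorem abs_sq_sub_sq_le {c cs ε : ℝ} (hε : 0 < ε) (hε1 : ε ≤ 1) (hc : |c - cs| ≤ ε ^ 2) :
    |c ^ 2 - cs ^ 2| ≤ (2 * |cs| + 1) * ε ^ 2 := by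
  have h1 : |c + cs| ≤ 2 * |cs| + 1 := by
    calc |c + cs| = |(c - cs) + 2 * cs| := by ring_nf
      _ ≤ |c - cs| + |2 * cs| := abs_add_le _ _
      _ ≤ 1 + 2 * |cs| := by
        rw [abs_mul, abs_two]
        gcongr
        exact hc.trans (pow_le_one₀ hε.le hε1)
      _ = 2 * |cs| + 1 := by ring
  rw [sq_sub_sq, abs_mul]
  gcongr

end
end Babenko

/-! ### Conclusion -/

theorem propositiont
    -- gravity, vorticity, surface tension; critical velocity and frequency; band width
    (g γ σ cs ω δ : ℝ) (hg : 0 ≤ g) (hσ : 0 < σ)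
    (hcs : cs ^ 4 = 4 * σ * (g + cs * γ)) (hpos : 0 < g + cs * γ)
    (hω : ω < 0) (hdisp : σ * ω ^ 2 + cs ^ 2 * ω + (g + cs * γ) = 0)
    (hδ : 0 < δ) (hδω : δ < |ω|) :
    ∃ M₀ > 0, ∃ C > 0, ∀ M : ℝ, 0 < M → M ≤ M₀ →
    ∃ R₁ > 0, ∃ R₂ > 0, ∃ ε₀ > 0, ∀ ε : ℝ, 0 < ε → ε ≤ ε₀ →
    ∀ c : ℝ, |c - cs| ≤ ε ^ 2 →
      -- on `X₁ × X₂` everything stays in the small ball, where the equation makes sense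
      (∀ U₁ ∈ ballE ε ω δ R₁, normHatL1 (U₁ : H2) < M / 2 ∧
        ∀ U₃ : X2 ω δ, ‖U₃‖ ≤ R₂ →
          ∃ U₂ : X2 ω δ,
            ((U₂ : H2) =ᵐ[volume]
              fun x => F g γ σ cs ω δ (U₁ : H2) x + (U₃ : H2) x) ∧
            ‖U₂‖ < M / 2 ∧
            ∀ᵐ x : ℝ, 0 < J ((U₁ : H2) + (U₂ : H2) : H2) x) ∧
      -- the solution map `U₃` and the resulting map `U₂ = F + U₃`
      ∃ U₃ U₂ : X1 ω δ → X2 ω δ,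
        (∀ U₁ ∈ ballE ε ω δ R₁,
          ‖U₃ U₁‖ ≤ R₂ ∧
          RemainderEq g γ σ cs c ω δ (U₁ : H2) (U₃ U₁ : H2) ∧
          ∀ V : X2 ω δ, ‖V‖ ≤ R₂ →
            RemainderEq g γ σ cs c ω δ (U₁ : H2) (V : H2) → V = U₃ U₁) ∧
        ContDiffOn ℝ ((⊤ : ℕ∞) : WithTop ℕ∞) U₃ (ballE ε ω δ R₁) ∧
        (∀ U₁ ∈ ballE ε ω δ R₁,
          ‖U₃ U₁‖ ≤ C * ε * normE ε ω U₁ ^ 2 ∧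
          ‖fderivWithin ℝ U₃ (ballE ε ω δ R₁) U₁‖ ≤ ε * normE ε ω U₁) ∧
        (∀ U₁ ∈ ballE ε ω δ R₁,
          (U₂ U₁ : H2) =ᵐ[volume]
            fun x => F g γ σ cs ω δ (U₁ : H2) x + (U₃ U₁ : H2) x) ∧
        ContDiffOn ℝ ((⊤ : ℕ∞) : WithTop ℕ∞) U₂ (ballE ε ω δ R₁) ∧
        ContDiffOn ℝ ((⊤ : ℕ∞) : WithTop ℕ∞)
          (fun U₁ : X1 ω δ => (U₁ : H2) + (U₂ U₁ : H2)) (ballE ε ω δ R₁) := by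
  have hB : InvLBdd g γ σ cs ω δ := invLBdd hσ hcs hω hdisp hδ
  obtain ⟨D, hD, hest⟩ := exists_deriv_bounds hB
  obtain ⟨C, hC, H⟩ := exists_fixedPoint_perturbedMap (L₁ := linI hB) (L₂ := linA hB)
    (contDiffAt_nonlinearPart hB) (nonlinearPart_zero hB) (fderiv_nonlinearPart_zero hB)
    (contDiffAt_quadX1 hB) (quadX1_zero hB) (fderiv_quadX1_zero hB)
    (A := 2 * |cs| + 1) (B := 1 + (|ω| + δ) ^ 2) (by positivity) (by positivity) hD
    (fun x => wnorm (weightedL (x : H2))) (fun ε x => normE ε ω x) hest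
    (fun _ _ => sqrt_nonneg _)
    (fun ε x s => by rw [normE_eq hδω, normE_eq hδω, map_smul, norm_smul, norm_eq_abs])
    (fun ε x hε => wnorm_weightedL_le hε hδω x) (fun ε x _ => norm_le_normE hδω ε x)
  refine ⟨1, one_pos, C, hC, fun M hM _ => ?_⟩
  obtain ⟨r, hr, Hr⟩ := exists_radius hB hM
  obtain ⟨R₁, hR₁, -, R₂, hR₂, hR₂r, ε₀, hε₀, hε₀1, Hε⟩ := H r hr
  refine ⟨R₁, hR₁, R₂, hR₂, ε₀, hε₀, fun ε hε hεε₀ c hc => ?_⟩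
  -- Both coefficients are at most (2|c⁎| + 1)ε²; the velocity enters the fixed-point problem only
  -- through them.
  obtain ⟨u, hu⟩ := Hε ε hε hεε₀ (cs - c) (c ^ 2 - cs ^ 2)
    (by rw [abs_sub_comm]; nlinarith [abs_nonneg cs, sq_nonneg ε])
    (abs_sq_sub_sq_le hε (hεε₀.trans hε₀1) hc)
  have hud := uniqueDiffOn_ballE hδω ε hR₁
  have hsmooth : ContDiffOn ℝ ((⊤ : ℕ∞) : WithTop ℕ∞) u (ballE ε ω δ R₁) := fun x hx =>
    (hu x hx).2.2.2.2.1.contDiffWithinAt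
  have hsmooth₂ : ContDiffOn ℝ ((⊤ : ℕ∞) : WithTop ℕ∞) (fun x => quadX1 hB x + u x)
      (ballE ε ω δ R₁) := fun x hx =>
    ((Hr x (hu x hx).1).1.add (hu x hx).2.2.2.2.1).contDiffWithinAt
  refine ⟨fun x hx => ⟨(Hr x (hu x hx).1).2.1, fun y hy => ?_⟩, u, fun x => quadX1 hB x + u x,
    fun x hx => ?_, hsmooth, fun x hx => ?_, fun x _ => quadX1_add_ae hB x (u x), hsmooth₂,
    (X1 ω δ).subtypeL.contDiff.contDiffOn.add
      ((X2 ω δ).subtypeL.contDiff.comp_contDiffOn hsmooth₂)⟩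
  · obtain ⟨ha, hn⟩ := (Hr x (hu x hx).1).2.2 y (hy.trans hR₂r)
    exact ⟨quadX1 hB x + y, quadX1_add_ae hB x y, hn, fullArg_eq hB x y ▸ ae_J_pos ha⟩
  · obtain ⟨h1, h2, h3, h4, -⟩ := hu x hx
    refine ⟨h2, (remainderEq_iff hB ((Hr x h1).2.2 _ (h2.trans hR₂r)).1).2 h3, fun V hV hVe => ?_⟩
    exact h4 V hV ((remainderEq_iff hB ((Hr x h1).2.2 V (hV.trans hR₂r)).1).1 hVe)
  · obtain ⟨-, -, -, -, h5, h6, h7⟩ := hu x hx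
    refine ⟨h6, ?_⟩
    -- The solution map is differentiable in a full neighbourhood of each point of the closed ball,
    -- so the derivative within the ball is the ordinary one.
    rw [(h5.differentiableAt (by simp)).fderivWithin (hud x hx)]
    exact h7
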